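/- Let $n\ge 3$ and let $M$ be Euclidean space $\mathbf R^n$, hyperbolic space $\mathbf H^n$ (curvature $-1$) or the unit sphere $\mathbf S^n$, with total volume $|M|\in(0,\infty]$. For $0<v<|M|$ let $A(v)$ be the boundary area of a round ball of volume $v$ in $M$. For $v,w>0$ with $v+w<|M|$ let $A(v,w)$ be the area of the standard double bubble in $M$ that encloses and separates a region of volume $v$ and a region of volume $w$; this double bubble consists of three spherical caps (in $\mathbf R^n$ the cap separating the two regions may be a flat disc; in $\mathbf H^n$ that cap may also lie on a horosphere, a hypersphere or a totally geodesic hyperplane) that meet at $120^\circ$ angles along a common boundary $(n-2)$-sphere, and it is unique up to isometries of $M$. The Hutchings function is $$F(v,w)=2A\!\left(\tfrac v2\right)+A(w)+A(v+w)-2A(v,w).$$ If $w<v\le 2w$, $v+w<|M|$ and $F\!\left(\tfrac{v+w}2,\tfrac{v+w}2\right)>0$, then $F(v,w)>0$. -/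

import Mathlib

open MeasureTheory Set

noncomputable section

/-- The three families of simply connected space forms: `ℝⁿ`, `ℍⁿ` (curvature `-1`) and the unit
sphere `𝕊ⁿ` (curvature `1`). -/
inductive SpaceForm where
  | euclidean
  | hyperbolic
  | spherical

namespace SpaceForm

/-- The constant sectional curvature `κ`. -/
def curvature : SpaceForm → ℝ
  | euclidean => 0
  | hyperbolic => -1
  | spherical => 1

/-- The conformal model. The space form of curvature `κ` is the set of `x ∈ ℝⁿ` with
`1 + κ‖x‖²/4 > 0`, with the Riemannian metric `|dx|² / (1 + κ‖x‖²/4)²`. It is all of `ℝⁿ` with the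
flat metric if `κ = 0`, the Poincaré ball (of Euclidean radius `2`) if `κ = -1`, and the
stereographic image of the unit sphere without one point if `κ = 1`. -/
def domain (X : SpaceForm) (n : ℕ) : Set (EuclideanSpace ℝ (Fin n)) :=
  {x | 0 < 1 + X.curvature * ‖x‖ ^ 2 / 4}

/-- The conformal factor: the length of a vector `ξ` at `x` is `density x * ‖ξ‖`. -/
def density (X : SpaceForm) {n : ℕ} (x : EuclideanSpace ℝ (Fin n)) : ℝ :=
  (1 + X.curvature * ‖x‖ ^ 2 / 4)⁻¹

/-- Riemannian volume of a subset. For the sphere, the point missing from the model is a null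
set. -/
def vol (X : SpaceForm) {n : ℕ} (E : Set (EuclideanSpace ℝ (Fin n))) : ENNReal :=
  ∫⁻ x in E ∩ X.domain n, ENNReal.ofReal (X.density x ^ n)

/-- Riemannian `(n-1)`-dimensional area of a hypersurface: the integral of the `(n-1)`-st power of
the conformal factor against the normalized `(n-1)`-dimensional Hausdorff measure. -/
def area (X : SpaceForm) {n : ℕ} (S : Set (EuclideanSpace ℝ (Fin n))) : ℝ :=
  (∫⁻ x in S ∩ X.domain n, ENNReal.ofReal (X.density x ^ (n - 1)) ∂μHE[n - 1]).toReal

/-- `A(v)`: the boundary area of a round ball of volume `v`. The balls are centered at the origin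
of the model, which is no restriction since space forms are homogeneous; `sInf` extracts the
element of a set with exactly one element when `0 < v < vol univ`. -/
def ballArea (X : SpaceForm) (n : ℕ) (v : ℝ) : ℝ :=
  sInf {a : ℝ | ∃ t : ℝ, 0 < t ∧
    Metric.closedBall (0 : EuclideanSpace ℝ (Fin n)) t ⊆ X.domain n ∧
    X.vol (Metric.ball (0 : EuclideanSpace ℝ (Fin n)) t) = ENNReal.ofReal v ∧
    a = X.area (Metric.sphere (0 : EuclideanSpace ℝ (Fin n)) t)}

end SpaceForm

/-- Let `C` be the `(n-2)`-sphere `{x₀ = 0, ‖x‖ = s}`. The argument of the complex number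
`bipolar s x` is the bipolar angle of `x` relative to `C`; its level sets are the spherical caps
bounded by `C`. -/
def bipolar {n : ℕ} [NeZero n] (s : ℝ) (x : EuclideanSpace ℝ (Fin n)) : ℂ :=
  ⟨‖x‖ ^ 2 - s ^ 2, 2 * s * x 0⟩

/-- The spherical cap with boundary `C = {x₀ = 0, ‖x‖ = s}` that leaves `C` at the angle `β`. It is
one of the two pieces into which `C` divides the sphere
`(‖x‖² - s²) sin β = 2 s x₀ cos β` (a hyperplane if `sin β = 0`: the flat disc inside `C` for
`β = π`, its complement for `β = 0`). At a point `s • e` of `C` (`e` a unit vector orthogonal to the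
zeroth basis vector `e₀`) the derivative of `bipolar s` in direction `ξ` is
`2 s (⟪e, ξ⟫ + i ⟪e₀, ξ⟫)`, so the direction in which the cap leaves `C` is
`cos β • e + sin β • e₀`, and two caps meet along `C` at the difference of their angles. The model
metrics are conformal to the Euclidean one, so these are also their angles in the space form, and
the caps are pieces of geodesic spheres, horospheres, hyperspheres (equidistant hypersurfaces) or
totally geodesic hyperplanes. -/
def sphericalCap {n : ℕ} [NeZero n] (s β : ℝ) : Set (EuclideanSpace ℝ (Fin n)) :=
  {x | ∃ r : ℝ, 0 ≤ r ∧ bipolar s x = r * Complex.exp (β * Complex.I)}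

/-- The open region swept by the caps with boundary `C = {x₀ = 0, ‖x‖ = s}` at angles strictly
between `a` and `b`; it lies between the caps at the angles `a` and `b`. -/
def betweenCaps {n : ℕ} [NeZero n] (s a b : ℝ) : Set (EuclideanSpace ℝ (Fin n)) :=
  {x | ∃ r θ : ℝ, 0 < r ∧ a < θ ∧ θ < b ∧ bipolar s x = r * Complex.exp (θ * Complex.I)}

/-- A standard double bubble: three spherical caps meeting at `120°` along their common boundary,
an `(n-2)`-sphere. Up to an isometry of the space form this common boundary is
`{x₀ = 0, ‖x‖ = s}` in the conformal model, so that a standard double bubble is given by `s` and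
the angle `α` of the interface.
In `ℝⁿ` and `ℍⁿ` the two enclosed regions have to be relatively compact; in particular the outer
caps then are pieces of geodesic spheres. In the compact space `𝕊ⁿ` there is no condition, and any
of the three regions cut out by the caps may be the exterior. -/
structure StandardDoubleBubble (X : SpaceForm) (n : ℕ) [NeZero n] where
  /-- radius of the singular sphere in the model -/
  s : ℝ
  /-- angle of the interface -/
  α : ℝ
  s_pos : 0 < s
  enclosed : X ≠ SpaceForm.spherical →
    ∃ K : Set (EuclideanSpace ℝ (Fin n)), IsCompact K ∧ K ⊆ X.domain n ∧
      betweenCaps s α (α + 2 * Real.pi / 3) ∪ betweenCaps s (α - 2 * Real.pi / 3) α ⊆ K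

namespace StandardDoubleBubble

variable {X : SpaceForm} {n : ℕ} [NeZero n]

/-- The first enclosed region. -/
def region₁ (B : StandardDoubleBubble X n) : Set (EuclideanSpace ℝ (Fin n)) :=
  betweenCaps B.s B.α (B.α + 2 * Real.pi / 3)

/-- The second enclosed region. -/
def region₂ (B : StandardDoubleBubble X n) : Set (EuclideanSpace ℝ (Fin n)) :=
  betweenCaps B.s (B.α - 2 * Real.pi / 3) B.α

/-- The union of the interface and the two outer caps. -/
def surface (B : StandardDoubleBubble X n) : Set (EuclideanSpace ℝ (Fin n)) :=
  sphericalCap B.s B.α ∪ sphericalCap B.s (B.α + 2 * Real.pi / 3) ∪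
    sphericalCap B.s (B.α - 2 * Real.pi / 3)

end StandardDoubleBubble

namespace SpaceForm

/-- `A(v, w)`: the area of the standard double bubble enclosing and separating volumes `v` and `w`.
It exists and is unique up to isometry when `v, w > 0` and `v + w < vol univ`, so that `sInf`
extracts the element of a set with exactly one element. -/
def doubleBubbleArea (X : SpaceForm) (n : ℕ) [NeZero n] (v w : ℝ) : ℝ :=
  sInf {a : ℝ | ∃ B : StandardDoubleBubble X n,
    X.vol B.region₁ = ENNReal.ofReal v ∧ X.vol B.region₂ = ENNReal.ofReal w ∧
    a = X.area B.surface}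

/-- The Hutchings function `F(v, w) = 2 A(v/2) + A(w) + A(v + w) - 2 A(v, w)`. -/
def hutchings (X : SpaceForm) (n : ℕ) [NeZero n] (v w : ℝ) : ℝ :=
  2 * X.ballArea n (v / 2) + X.ballArea n w + X.ballArea n (v + w) - 2 * X.doubleBubbleArea n v w

end SpaceForm

end

/-! Put `M = (v + w) / 2`. The term `A(v + w)` occurs in both `F(v, w)` and `F(M, M)`, so `F(v, w) ≥
F(M, M)` follows from two inequalities: `2 A(v/2) + A(w) ≥ 2 A(M/2) + A(M)` for balls
(`ballArea_mean_le`) and `A(v, w) ≤ A(M, M)` for double bubbles (`doubleBubbleArea_le`).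

Balls. The hypotheses give `M/2 < v/2 ≤ w < M`. The volume intervals `[M/2, v/2]` and `[w, M]` have
lengths `δ/2` and `δ`, the second lying to the right of the first. The derivative of `A` is a
multiple of the mean curvature of the sphere, which decreases with the radius, so `A` grows by at
most twice as much over the second interval as over the first (`slope_le`).

Double bubbles. Write `n = m + 1`. Let `C` and `S` be the geodesic cosine and sine of the radius of
the singular sphere and `α` the angle of the interface. Up to a common constant, the cap at angle
`β` has area `S ^ m * a(C cos β)`, and the region between two caps has volume `S ^ (m + 1) / m`
times the integral of `a'(C cos θ)` over the angles between them. Here `a` is `capProfile`, which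
satisfies `(1 - x²) a' = 1 + m x a`. In the parameter `(X, Y) = (C / S) (cos α, sin α)` the mean
curvatures `p₁`, `p₂` of the outer caps are linear functions, `p₁ - p₂ = Y` belongs to the
interface, and the admissible parameters form a convex set. The ODE yields the first variation `dA =
m (p₁ dV₁ + p₂ dV₂)`: the remaining terms cancel because three unit vectors at 120° sum to zero. It
also shows that `dp₁ dV₁ + dp₂ dV₂` is minus a sum of squares of the three curvature variations,
with the nonnegative weights `capWeight`.

Integrating along the segment from one parameter to another gives the tangent inequality
`totalArea_sub_le` for area as a function of the two volumes. Applied at a bubble with totally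
geodesic interface, where `p₁ = p₂`, it involves only the total volume and says that no bubble with
the same total volume has larger area. It remains to compute areas and volumes in the conformal
model (`area_surface`, `vol_betweenCaps`), to show that every double bubble has an admissible
parameter, and to produce a symmetric bubble enclosing `M` and `M` by continuity
(`exists_symmetricVol_eq`). -/

/-! ### Polar coordinates for lower integrals -/

open scoped ENNReal NNReal Topology in
theorem lintegral_fun_norm_addHaar {E : Type*} [NormedAddCommGroup E] [NormedSpace ℝ E]
    [Nontrivial E] [FiniteDimensional ℝ E] [MeasurableSpace E] [BorelSpace E] (μ : Measure E)
    [μ.IsAddHaarMeasure] {f : ℝ → ℝ≥0∞} (hf : Measurable f) :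
    ∫⁻ x, f ‖x‖ ∂μ = (Module.finrank ℝ E * μ (Metric.ball 0 1)) *
      ∫⁻ r in Ioi (0 : ℝ), ENNReal.ofReal (r ^ (Module.finrank ℝ E - 1)) * f r := by
  calc
    ∫⁻ x, f ‖x‖ ∂μ = ∫⁻ x : ({(0)}ᶜ : Set E), f ‖x.1‖ ∂(μ.comap (↑)) := by
      rw [lintegral_subtype_comap (measurableSet_singleton _).compl fun x ↦ f ‖x‖,
        restrict_compl_singleton]
    _ = ∫⁻ x, f x.2 ∂μ.toSphere.prod (.volumeIoiPow (Module.finrank ℝ E - 1)) := by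
      simpa using μ.measurePreserving_homeomorphUnitSphereProd.lintegral_comp_emb
        (Homeomorph.measurableEmbedding _) (f ∘ Subtype.val ∘ Prod.snd)
    _ = μ.toSphere univ *
        ∫⁻ x : Ioi (0 : ℝ), f x ∂.volumeIoiPow (Module.finrank ℝ E - 1) := by
      rw [lintegral_prod _ (by fun_prop)]
      simp [mul_comm]
    _ = _ := by
      rw [μ.toSphere_apply_univ, Measure.volumeIoiPow,
        lintegral_withDensity_eq_lintegral_mul _ (by fun_prop) (by fun_prop),
        ← lintegral_subtype_comap measurableSet_Ioi]
      rfl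

/-! ### The area formula for conformal maps -/

section Conformal

open scoped ENNReal NNReal Topology

variable {m n : ℕ} {ψ : EuclideanSpace ℝ (Fin m) → EuclideanSpace ℝ (Fin n)}
  {lam : EuclideanSpace ℝ (Fin m) → ℝ} {U : Set (EuclideanSpace ℝ (Fin m))}

theorem euclideanHausdorffMeasure_image_le_of_dist_le {K : ℝ} (hK : 0 ≤ K)
    (h : ∀ y ∈ U, ∀ y' ∈ U, dist (ψ y) (ψ y') ≤ K * dist y y') :
    μHE[m] (ψ '' U) ≤ ENNReal.ofReal (K ^ m) * volume U := by
  have hL : LipschitzOnWith K.toNNReal ψ U := LipschitzOnWith.of_dist_le_mul fun y hy y' hy' => by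
    rw [Real.coe_toNNReal _ hK]
    exact h y hy y' hy'
  have h1 := hL.hausdorffMeasure_image_le (d := m) (by positivity)
  rw [← EuclideanSpace.euclideanHausdorffMeasure_eq_volume,
    Measure.euclideanHausdorffMeasure_def, Measure.euclideanHausdorffMeasure_def]
  simp only [Measure.smul_apply, ENNReal.smul_def, smul_eq_mul]
  rw [mul_left_comm]
  gcongr
  refine h1.trans (le_of_eq ?_)
  rw [ENNReal.ofReal_pow hK, ENNReal.rpow_natCast]
  rfl

/-- The inverse of `ψ` on the image is Lipschitz with constant `c⁻¹`. -/
theorem le_euclideanHausdorffMeasure_image_of_le_dist {c : ℝ} (hc : 0 < c)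
    (h : ∀ y ∈ U, ∀ y' ∈ U, c * dist y y' ≤ dist (ψ y) (ψ y')) :
    ENNReal.ofReal (c ^ m) * volume U ≤ μHE[m] (ψ '' U) := by
  rcases U.eq_empty_or_nonempty with rfl | hU
  · simp
  have hinj : InjOn ψ U := fun y hy y' hy' hyy => by
    have := h y hy y' hy'
    rw [hyy, dist_self] at this
    exact dist_le_zero.1 (by nlinarith [dist_nonneg (x := y) (y := y')])
  set g := Function.invFunOn ψ U
  have hg : ∀ y ∈ U, g (ψ y) = y := fun y hy => hinj.leftInvOn_invFunOn hy
  have hL : LipschitzOnWith (c⁻¹).toNNReal g (ψ '' U) := by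
    refine LipschitzOnWith.of_dist_le_mul ?_
    rintro _ ⟨y, hy, rfl⟩ _ ⟨y', hy', rfl⟩
    rw [hg y hy, hg y' hy', Real.coe_toNNReal _ (by positivity), inv_mul_eq_div, le_div_iff₀ hc,
      mul_comm]
    exact h y hy y' hy'
  have h1 := hL.hausdorffMeasure_image_le (d := m) (by positivity)
  have himg : g '' (ψ '' U) = U := by
    rw [image_image]
    exact (image_congr hg).trans (image_id' U)
  rw [himg] at h1
  rw [← EuclideanSpace.euclideanHausdorffMeasure_eq_volume,
    Measure.euclideanHausdorffMeasure_def, Measure.euclideanHausdorffMeasure_def]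
  simp only [Measure.smul_apply, ENNReal.smul_def, smul_eq_mul]
  rw [mul_left_comm]
  gcongr
  calc ENNReal.ofReal (c ^ m) * μH[(m : ℝ)] U
      ≤ ENNReal.ofReal (c ^ m) * (((c⁻¹).toNNReal : ℝ≥0∞) ^ (m : ℝ) * μH[(m : ℝ)] (ψ '' U)) := by
        gcongr
    _ = μH[(m : ℝ)] (ψ '' U) := by
        rw [← mul_assoc, ENNReal.rpow_natCast, ENNReal.ofReal_pow hc.le, ← mul_pow]
        change (ENNReal.ofReal c * ENNReal.ofReal c⁻¹) ^ m * _ = _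
        rw [← ENNReal.ofReal_mul hc.le, mul_inv_cancel₀ hc.ne']
        simp

/-- Removes the error factor of the area formula below by letting `r` tend to `1`. -/
theorem le_of_forall_le_ofReal_pow_mul {x y : ℝ≥0∞} (m : ℕ)
    (h : ∀ r : ℝ, 1 < r → x ≤ ENNReal.ofReal (r ^ m) * y) : x ≤ y := by
  have ht : Filter.Tendsto (fun r : ℝ => ENNReal.ofReal (r ^ m) * y) (𝓝[>] 1) (𝓝 (1 * y)) := by
    refine ENNReal.Tendsto.mul_const ?_ (Or.inl one_ne_zero)
    have : Filter.Tendsto (fun r : ℝ => ENNReal.ofReal (r ^ m)) (𝓝 1)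
        (𝓝 (ENNReal.ofReal (1 ^ m))) := by
      exact (ENNReal.continuous_ofReal.comp (continuous_pow m)).tendsto 1
    simpa using this.mono_left nhdsWithin_le_nhds
  rw [one_mul] at ht
  exact ge_of_tendsto ht (Filter.eventually_of_mem self_mem_nhdsWithin fun r hr => h r hr)

/-- The area formula for a map that distorts distances by a conformal factor. -/
theorem euclideanHausdorffMeasure_image_of_conformal (hψ : Measurable ψ) (hlam : Measurable lam)
    (hU : MeasurableSet U) (hpos : ∀ y ∈ U, 0 < lam y)
    (h : ∀ y ∈ U, ∀ y' ∈ U, dist (ψ y) (ψ y') ^ 2 = lam y * lam y' * dist y y' ^ 2) :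
    μHE[m] (ψ '' U) = ∫⁻ y in U, ENNReal.ofReal (lam y ^ m) := by
  have hinj : InjOn ψ U := fun y hy y' hy' hyy => by
    have h1 := h y hy y' hy'
    rw [hyy, dist_self, zero_pow two_ne_zero] at h1
    have := mul_pos (hpos y hy) (hpos y' hy')
    have h2 : dist y y' ^ 2 = 0 := by
      rcases mul_eq_zero.1 h1.symm with h3 | h3
      · exact absurd h3 this.ne'
      · exact h3
    exact dist_eq_zero.1 (pow_eq_zero_iff two_ne_zero |>.1 h2)
  have key : ∀ r : ℝ, 1 < r → μHE[m] (ψ '' U) ≤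
      ENNReal.ofReal (r ^ m) * ∫⁻ y in U, ENNReal.ofReal (lam y ^ m) ∧
      ∫⁻ y in U, ENNReal.ofReal (lam y ^ m) ≤ ENNReal.ofReal (r ^ m) * μHE[m] (ψ '' U) := by
    intro r hr
    have hr0 : 0 < r := one_pos.trans hr
    -- On `A k` the factor `lam` lies in `[r ^ k, r ^ (k + 1))`, so `ψ` changes distances there by a
    -- ratio between these bounds. The measure of the image and the integral of `lam ^ m` then lie
    -- between the same two multiples of `volume (A k)`, which differ by the factor `r ^ m`.
    let A : ℤ → Set (EuclideanSpace ℝ (Fin m)) := fun k => U ∩ lam ⁻¹' Ico (r ^ k) (r ^ (k + 1))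
    have hAm : ∀ k, MeasurableSet (A k) := fun k => hU.inter (hlam measurableSet_Ico)
    have hAU : U = ⋃ k, A k := by
      ext y
      simp only [A, mem_iUnion, mem_inter_iff, exists_and_left, iff_self_and]
      intro hy
      exact exists_mem_Ico_zpow (hpos y hy) hr
    have hAd : Pairwise (Function.onFun Disjoint A) := by
      intro i j hij
      refine Set.disjoint_left.2 fun y hyi hyj => hij ?_
      have h1 := (zpow_lt_zpow_iff_right₀ hr).1 (hyi.2.1.trans_lt hyj.2.2)
      have h2 := (zpow_lt_zpow_iff_right₀ hr).1 (hyj.2.1.trans_lt hyi.2.2)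
      omega
    have hlow : ∀ k, ENNReal.ofReal ((r ^ k) ^ m) * volume (A k) ≤ μHE[m] (ψ '' A k) := by
      intro k
      refine le_euclideanHausdorffMeasure_image_of_le_dist (zpow_pos hr0 k) ?_
      intro y hy y' hy'
      refine (sq_le_sq₀ (mul_nonneg (zpow_pos hr0 k).le dist_nonneg) dist_nonneg).1 ?_
      rw [h y hy.1 y' hy'.1, mul_pow, sq (r ^ k)]
      have := zpow_pos hr0 k
      gcongr
      exacts [(hpos y hy.1).le, hy.2.1, hy'.2.1]
    have hup : ∀ k, μHE[m] (ψ '' A k) ≤ ENNReal.ofReal ((r ^ (k + 1)) ^ m) * volume (A k) := by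
      intro k
      refine euclideanHausdorffMeasure_image_le_of_dist_le (zpow_pos hr0 _).le ?_
      intro y hy y' hy'
      have := zpow_pos hr0 (k + 1)
      refine (sq_le_sq₀ dist_nonneg (by positivity)).1 ?_
      rw [h y hy.1 y' hy'.1, mul_pow, sq (r ^ (k + 1))]
      have := (hpos y' hy'.1).le
      gcongr
      exacts [hy.2.2.le, hy'.2.2.le]
    have hsplit : ∀ k : ℤ, ENNReal.ofReal ((r ^ (k + 1)) ^ m) =
        ENNReal.ofReal (r ^ m) * ENNReal.ofReal ((r ^ k) ^ m) := by
      intro k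
      rw [← ENNReal.ofReal_mul (by positivity), ← mul_pow, zpow_add_one₀ hr0.ne', mul_comm r]
    have hI : ∫⁻ y in U, ENNReal.ofReal (lam y ^ m) =
        ∑' k, ∫⁻ y in A k, ENNReal.ofReal (lam y ^ m) := by
      conv_lhs => rw [hAU]
      exact lintegral_iUnion hAm hAd _
    have hIlow : ∀ k, ENNReal.ofReal ((r ^ k) ^ m) * volume (A k) ≤
        ∫⁻ y in A k, ENNReal.ofReal (lam y ^ m) := by
      intro k
      rw [← setLIntegral_const]
      refine setLIntegral_mono' (hAm k) fun y hy => ENNReal.ofReal_le_ofReal ?_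
      have := zpow_pos hr0 k
      exact pow_le_pow_left₀ this.le hy.2.1 m
    have hIup : ∀ k, ∫⁻ y in A k, ENNReal.ofReal (lam y ^ m) ≤
        ENNReal.ofReal ((r ^ (k + 1)) ^ m) * volume (A k) := by
      intro k
      rw [← setLIntegral_const]
      refine setLIntegral_mono' (hAm k) fun y hy => ENNReal.ofReal_le_ofReal ?_
      exact pow_le_pow_left₀ (hpos y hy.1).le hy.2.2.le m
    have hH : μHE[m] (ψ '' U) = ∑' k, μHE[m] (ψ '' A k) := by
      conv_lhs => rw [hAU, image_iUnion]
      refine measure_iUnion ?_ fun k => ?_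
      · intro i j hij
        refine Set.disjoint_left.2 ?_
        rintro _ ⟨y, hy, rfl⟩ ⟨y', hy', hyy⟩
        obtain rfl : y' = y := hinj hy'.1 hy.1 hyy
        exact Set.disjoint_left.1 (hAd hij) hy hy'
      · exact (hAm k).image_of_measurable_injOn hψ (hinj.mono fun y hy => hy.1)
    rw [hI, hH, ← ENNReal.tsum_mul_left, ← ENNReal.tsum_mul_left]
    constructor
    · refine ENNReal.tsum_le_tsum fun k => (hup k).trans ?_
      rw [hsplit, mul_assoc]
      gcongr
      exact hIlow k
    · refine ENNReal.tsum_le_tsum fun k => (hIup k).trans ?_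
      rw [hsplit, mul_assoc]
      gcongr
      exact hlow k
  exact le_antisymm (le_of_forall_le_ofReal_pow_mul m fun r hr => (key r hr).1)
    (le_of_forall_le_ofReal_pow_mul m fun r hr => (key r hr).2)

/-- The area formula on the sets `U ∩ ψ ⁻¹' B` identifies the Hausdorff measure restricted to the
image with the push-forward of `lam ^ m` times Lebesgue measure. -/
theorem setLIntegral_image_of_conformal (hψ : Measurable ψ) (hlam : Measurable lam)
    (hU : MeasurableSet U) (hpos : ∀ y ∈ U, 0 < lam y)
    (h : ∀ y ∈ U, ∀ y' ∈ U, dist (ψ y) (ψ y') ^ 2 = lam y * lam y' * dist y y' ^ 2)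
    {g : EuclideanSpace ℝ (Fin n) → ℝ≥0∞} (hg : Measurable g) :
    ∫⁻ x in ψ '' U, g x ∂μHE[m] = ∫⁻ y in U, ENNReal.ofReal (lam y ^ m) * g (ψ y) := by
  have hmeas : (μHE[m] : Measure (EuclideanSpace ℝ (Fin n))).restrict (ψ '' U) =
      ((volume.restrict U).withDensity fun y => ENNReal.ofReal (lam y ^ m)).map ψ := by
    ext B hB
    rw [Measure.restrict_apply hB, Measure.map_apply hψ hB, withDensity_apply _ (hψ hB),
      Measure.restrict_restrict (hψ hB), inter_comm (ψ ⁻¹' B), inter_comm B,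
      ← image_inter_preimage]
    exact euclideanHausdorffMeasure_image_of_conformal hψ hlam (hU.inter (hψ hB))
      (fun y hy => hpos y hy.1) fun y hy y' hy' => h y hy.1 y' hy'.1
  rw [hmeas, lintegral_map hg hψ, lintegral_withDensity_eq_lintegral_mul _ (by fun_prop)
    (show Measurable fun y => g (ψ y) from hg.comp hψ)]
  rfl

end Conformal

/-! ### The cap profile and its differential equation -/

noncomputable section

open Topology in
theorem hasDerivAt_intervalIntegral_of_continuousOn {f f' : ℝ → ℝ → ℝ} {a b x₀ ε : ℝ} (hε : 0 < ε)
    (hf : ∀ x ∈ Metric.closedBall x₀ ε, ∀ t ∈ uIcc a b, HasDerivAt (fun x => f x t) (f' x t) x)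
    (hfc : ∀ x ∈ Metric.closedBall x₀ ε, ContinuousOn (f x) (uIcc a b))
    (hf' : ContinuousOn (Function.uncurry f') (Metric.closedBall x₀ ε ×ˢ uIcc a b)) :
    HasDerivAt (fun x => ∫ t in a..b, f x t) (∫ t in a..b, f' x₀ t) x₀ := by
  -- Compactness bounds `f'`; the constant is the dominating function.
  obtain ⟨C, hC⟩ := ((isCompact_closedBall x₀ ε).prod isCompact_uIcc).exists_bound_of_continuousOn hf'
  have hx₀ : x₀ ∈ Metric.closedBall x₀ ε := Metric.mem_closedBall_self hε.le
  have hc0 : ContinuousOn (f' x₀) (uIcc a b) :=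
    hf'.comp (f := fun t => (x₀, t)) (by fun_prop) fun t ht => ⟨hx₀, ht⟩
  refine (intervalIntegral.hasDerivAt_integral_of_dominated_loc_of_deriv_le (F := f) (F' := f')
    (bound := fun _ => C) (Metric.closedBall_mem_nhds x₀ hε) ?_ ?_ ?_ ?_ ?_ ?_).2
  · filter_upwards [Metric.closedBall_mem_nhds x₀ hε] with x hx
    exact ((hfc x hx).mono uIoc_subset_uIcc).aestronglyMeasurable measurableSet_uIoc
  · exact (hfc x₀ hx₀).intervalIntegrable
  · exact (hc0.mono uIoc_subset_uIcc).aestronglyMeasurable measurableSet_uIoc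
  · exact Filter.Eventually.of_forall fun t ht x hx => hC (x, t) ⟨hx, uIoc_subset_uIcc ht⟩
  · exact intervalIntegrable_const
  · exact Filter.Eventually.of_forall fun t ht x hx => hf x hx t (uIoc_subset_uIcc ht)

/-- The expression equals `(1 - t)² + 2 t (1 - x)`. The condition `x < 1` will mean that the cap
stays away from infinity. -/
theorem one_add_sq_sub_pos {x t : ℝ} (hx : x < 1) (ht : 0 ≤ t) : 0 < 1 + t ^ 2 - 2 * x * t := by
  rcases ht.eq_or_lt with rfl | ht
  · norm_num
  · nlinarith [sq_nonneg (1 - t), mul_pos ht (sub_pos.2 hx)]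

/-- The radial integrals through which areas of caps and volumes of sectors are expressed. -/
def radialIntegral (m i k : ℕ) (x : ℝ) : ℝ :=
  ∫ t in (0 : ℝ)..1, t ^ i * (1 - t ^ 2) ^ (m - 1) / (1 + t ^ 2 - 2 * x * t) ^ k

theorem continuousOn_radialIntegrand (m i k : ℕ) :
    ContinuousOn (fun p : ℝ × ℝ => p.2 ^ i * (1 - p.2 ^ 2) ^ (m - 1) /
      (1 + p.2 ^ 2 - 2 * p.1 * p.2) ^ k) (Iio 1 ×ˢ Icc 0 1) :=
  ContinuousOn.div (by fun_prop) (by fun_prop) fun p hp =>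
    (pow_pos (one_add_sq_sub_pos hp.1 hp.2.1) k).ne'

theorem continuousOn_radialIntegrand_right (m i k : ℕ) {x : ℝ} (hx : x < 1) :
    ContinuousOn (fun t : ℝ => t ^ i * (1 - t ^ 2) ^ (m - 1) /
      (1 + t ^ 2 - 2 * x * t) ^ k) (uIcc 0 1) := by
  rw [uIcc_of_le zero_le_one]
  exact (continuousOn_radialIntegrand m i k).comp (f := fun t => (x, t)) (by fun_prop)
    fun t ht => ⟨hx, ht⟩

theorem hasDerivAt_radialIntegral (m i k : ℕ) {x : ℝ} (hx : x < 1) :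
    HasDerivAt (radialIntegral m i k) (2 * k * radialIntegral m (i + 1) (k + 1) x) x := by
  have hsub : ∀ y ∈ Metric.closedBall x ((1 - x) / 2), y < 1 := by
    intro y hy
    rw [Real.closedBall_eq_Icc] at hy
    linarith [hy.2]
  have := hasDerivAt_intervalIntegral_of_continuousOn (a := 0) (b := 1) (x₀ := x)
    (ε := (1 - x) / 2)
    (f := fun x t => t ^ i * (1 - t ^ 2) ^ (m - 1) / (1 + t ^ 2 - 2 * x * t) ^ k)
    (f' := fun x t => 2 * k *
      (t ^ (i + 1) * (1 - t ^ 2) ^ (m - 1) / (1 + t ^ 2 - 2 * x * t) ^ (k + 1)))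
    (by linarith) ?_ (fun y hy => continuousOn_radialIntegrand_right m i k (hsub y hy)) ?_
  · rw [intervalIntegral.integral_const_mul] at this
    exact this
  · intro y hy t ht
    rw [uIcc_of_le zero_le_one] at ht
    have hpos := one_add_sq_sub_pos (hsub y hy) ht.1
    have h1 : HasDerivAt (fun y => 1 + t ^ 2 - 2 * y * t) (-(2 * t)) y := by
      have := (((hasDerivAt_id y).const_mul 2).mul_const t).const_sub (1 + t ^ 2)
      simpa using this
    have h2 := ((h1.pow k).fun_inv (pow_ne_zero k hpos.ne')).const_mul
      (t ^ i * (1 - t ^ 2) ^ (m - 1))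
    simp only [div_eq_mul_inv]
    refine h2.congr_deriv ?_
    rcases k with _ | k
    · simp
    · simp only [Nat.add_sub_cancel, Pi.pow_apply]
      push_cast
      generalize 1 + t ^ 2 - 2 * y * t = D at hpos
      field_simp
      ring
  · refine ContinuousOn.mul (by fun_prop) ?_
    refine (continuousOn_radialIntegrand m (i + 1) (k + 1)).mono (prod_mono (fun y hy => hsub y hy) ?_)
    rw [uIcc_of_le zero_le_one]

/-- The area of a cap over the `m`-th power of the geodesic sine of its radius, up to the area of
the unit sphere, as a function of the cosine of its angle. -/
def capProfile (m : ℕ) (x : ℝ) : ℝ := 2 * radialIntegral m 0 m x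

/-- The derivative of `capProfile`. -/
def capProfile' (m : ℕ) (x : ℝ) : ℝ := 4 * m * radialIntegral m 1 (m + 1) x

/-- The second derivative of `capProfile`. -/
def capProfile'' (m : ℕ) (x : ℝ) : ℝ := 8 * m * (m + 1) * radialIntegral m 2 (m + 2) x

theorem hasDerivAt_capProfile (m : ℕ) {x : ℝ} (hx : x < 1) :
    HasDerivAt (capProfile m) (capProfile' m x) x := by
  refine ((hasDerivAt_radialIntegral m 0 m hx).const_mul 2).congr_deriv ?_
  simp only [capProfile', zero_add]
  ring

theorem hasDerivAt_capProfile' (m : ℕ) {x : ℝ} (hx : x < 1) :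
    HasDerivAt (capProfile' m) (capProfile'' m x) x := by
  refine ((hasDerivAt_radialIntegral m 1 (m + 1) hx).const_mul (4 * m : ℝ)).congr_deriv ?_
  simp only [capProfile'']
  push_cast
  ring

theorem differentiableAt_capProfile'' (m : ℕ) {x : ℝ} (hx : x < 1) :
    DifferentiableAt ℝ (capProfile'' m) x :=
  ((hasDerivAt_radialIntegral m 2 (m + 2) hx).const_mul (8 * m * (m + 1) : ℝ)).differentiableAt

theorem capProfile_nonneg (m : ℕ) {x : ℝ} (hx : x < 1) : 0 ≤ capProfile m x := by
  refine mul_nonneg zero_le_two (intervalIntegral.integral_nonneg zero_le_one fun t ht => ?_)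
  have := one_add_sq_sub_pos hx ht.1
  have h2 : 0 ≤ 1 - t ^ 2 := by nlinarith [ht.1, ht.2]
  have := ht.1
  positivity

theorem capProfile'_nonneg (m : ℕ) {x : ℝ} (hx : x < 1) : 0 ≤ capProfile' m x := by
  refine mul_nonneg (by positivity) (intervalIntegral.integral_nonneg zero_le_one fun t ht => ?_)
  have := one_add_sq_sub_pos hx ht.1
  have h2 : 0 ≤ 1 - t ^ 2 := by nlinarith [ht.1, ht.2]
  have := ht.1
  positivity

/-- The difference of the integrands on the two sides is the `t`-derivative of `-((1 - t²) / (1 + t²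
- 2 x t)) ^ m`, which runs from `-1` to `0`; hence the constant `1`. -/
theorem capProfile_ode {m : ℕ} (hm : 1 ≤ m) {x : ℝ} (hx : x < 1) :
    (1 - x ^ 2) * capProfile' m x = 1 + m * x * capProfile m x := by
  have hint : ∀ i k, IntervalIntegrable (fun t : ℝ => t ^ i * (1 - t ^ 2) ^ (m - 1) /
      (1 + t ^ 2 - 2 * x * t) ^ k) volume 0 1 := fun i k =>
    (continuousOn_radialIntegrand_right m i k hx).intervalIntegrable
  have hftc : ∫ t in (0 : ℝ)..1, ((1 - x ^ 2) * (4 * m) *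
      (t ^ 1 * (1 - t ^ 2) ^ (m - 1) / (1 + t ^ 2 - 2 * x * t) ^ (m + 1)) - m * x * 2 *
      (t ^ 0 * (1 - t ^ 2) ^ (m - 1) / (1 + t ^ 2 - 2 * x * t) ^ m)) =
      -((1 - 1 ^ 2) / (1 + 1 ^ 2 - 2 * x * 1)) ^ m - -((1 - 0 ^ 2) / (1 + 0 ^ 2 - 2 * x * 0)) ^ m := by
    refine intervalIntegral.integral_eq_sub_of_hasDerivAt
      (f := fun t => -((1 - t ^ 2) / (1 + t ^ 2 - 2 * x * t)) ^ m) ?_ ?_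
    · intro t ht
      rw [uIcc_of_le zero_le_one] at ht
      have hpos := one_add_sq_sub_pos hx ht.1
      have h1 : HasDerivAt (fun t : ℝ => 1 - t ^ 2) (-(2 * t)) t := by
        simpa using (hasDerivAt_pow 2 t).const_sub 1
      have h2 : HasDerivAt (fun t : ℝ => 1 + t ^ 2 - 2 * x * t) (2 * t - 2 * x) t := by
        have := ((hasDerivAt_pow 2 t).const_add 1).fun_sub ((hasDerivAt_id t).const_mul (2 * x))
        simpa using this
      refine (((h1.fun_div h2 hpos.ne').fun_pow m).fun_neg).congr_deriv ?_
      obtain ⟨k, rfl⟩ : ∃ k, m = k + 1 := ⟨m - 1, by omega⟩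
      simp only [Nat.add_sub_cancel, div_pow]
      push_cast
      obtain ⟨D, hD⟩ : ∃ D, D = 1 + t ^ 2 - 2 * x * t := ⟨_, rfl⟩
      rw [← hD] at hpos ⊢
      field_simp
      rw [hD]
      ring
    · exact ((hint 1 (m + 1)).const_mul _).sub ((hint 0 m).const_mul _)
  rw [intervalIntegral.integral_sub ((hint 1 (m + 1)).const_mul _) ((hint 0 m).const_mul _),
    intervalIntegral.integral_const_mul, intervalIntegral.integral_const_mul] at hftc
  have h0 : (0 : ℝ) ^ m = 0 := zero_pow (by omega)
  norm_num [h0] at hftc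
  simp only [capProfile, capProfile', radialIntegral]
  norm_num
  linarith

/-- The derivative of `capProfile_ode`. -/
theorem capProfile_ode' {m : ℕ} (hm : 1 ≤ m) {x : ℝ} (hx : x < 1) :
    (1 - x ^ 2) * capProfile'' m x = (m + 2) * x * capProfile' m x + m * capProfile m x := by
  have h1 : HasDerivAt (fun x : ℝ => (1 - x ^ 2) * capProfile' m x)
      (-(2 * x) * capProfile' m x + (1 - x ^ 2) * capProfile'' m x) x := by
    have : HasDerivAt (fun x : ℝ => 1 - x ^ 2) (-(2 * x)) x := by
      simpa using (hasDerivAt_pow 2 x).const_sub 1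
    exact this.mul (hasDerivAt_capProfile' m hx)
  have h2 : HasDerivAt (fun x : ℝ => 1 + m * x * capProfile m x)
      (m * capProfile m x + m * x * capProfile' m x) x := by
    have : HasDerivAt (fun x : ℝ => m * x) (m : ℝ) x := by
      simpa using (hasDerivAt_id x).const_mul (m : ℝ)
    exact (this.mul (hasDerivAt_capProfile m hx)).const_add 1
  have h3 := h1.unique (h2.congr_of_eventuallyEq
    (Filter.eventually_of_mem (Iio_mem_nhds hx) fun y hy => capProfile_ode hm hy))
  linarith

/-- The weight of a cap in the first and second variation formulas. -/
def capWeight (m : ℕ) (x : ℝ) : ℝ := m * capProfile m x + x * capProfile' m x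

/-- For negative `x` the two summands have opposite signs. Over the common denominator `(1 + t² - 2
x t) ^ (m + 1)` the terms containing `x` cancel and leave `2 m (1 - t²) ^ (m - 1) (1 + t²)`. The
concavity of the area rests on this sign. -/
theorem capWeight_nonneg (m : ℕ) {x : ℝ} (hx : x < 1) : 0 ≤ capWeight m x := by
  have hint : ∀ i k, IntervalIntegrable (fun t : ℝ => t ^ i * (1 - t ^ 2) ^ (m - 1) /
      (1 + t ^ 2 - 2 * x * t) ^ k) volume 0 1 := fun i k =>
    (continuousOn_radialIntegrand_right m i k hx).intervalIntegrable
  have : capWeight m x = ∫ t in (0 : ℝ)..1, (m * 2 *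
      (t ^ 0 * (1 - t ^ 2) ^ (m - 1) / (1 + t ^ 2 - 2 * x * t) ^ m) + x * (4 * m) *
      (t ^ 1 * (1 - t ^ 2) ^ (m - 1) / (1 + t ^ 2 - 2 * x * t) ^ (m + 1))) := by
    rw [intervalIntegral.integral_add ((hint 0 m).const_mul _) ((hint 1 (m + 1)).const_mul _),
      intervalIntegral.integral_const_mul, intervalIntegral.integral_const_mul]
    simp only [capWeight, capProfile, capProfile', radialIntegral]
    ring
  rw [this]
  refine intervalIntegral.integral_nonneg zero_le_one fun t ht => ?_
  have hpos := one_add_sq_sub_pos hx ht.1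
  have h2 : 0 ≤ 1 - t ^ 2 := by nlinarith [ht.1, ht.2]
  have : m * 2 * (t ^ 0 * (1 - t ^ 2) ^ (m - 1) / (1 + t ^ 2 - 2 * x * t) ^ m) + x * (4 * m) *
      (t ^ 1 * (1 - t ^ 2) ^ (m - 1) / (1 + t ^ 2 - 2 * x * t) ^ (m + 1)) =
      2 * m * (1 - t ^ 2) ^ (m - 1) * (1 + t ^ 2) / (1 + t ^ 2 - 2 * x * t) ^ (m + 1) := by
    obtain ⟨D, hD⟩ : ∃ D, D = 1 + t ^ 2 - 2 * x * t := ⟨_, rfl⟩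
    rw [← hD] at hpos ⊢
    field_simp
    rw [hD]
    ring
  rw [this]
  positivity

theorem hasDerivAt_capWeight (m : ℕ) {x : ℝ} (hx : x < 1) :
    HasDerivAt (capWeight m) ((m + 1) * capProfile' m x + x * capProfile'' m x) x := by
  refine (((hasDerivAt_capProfile m hx).const_mul (m : ℝ)).add
    ((hasDerivAt_id x).mul (hasDerivAt_capProfile' m hx))).congr_deriv ?_
  simp only [id]
  ring

end

/-! ### Bubble parameters and first variation formulas -/

noncomputable section

namespace BubbleParam

/-- The geodesic sine of the radius of the singular sphere of the bubble with parameter `(X, Y)`,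
where `(X, Y)` has polar angle the angle of the interface and length the geodesic cotangent of that
radius. -/
def sine (κ X Y : ℝ) : ℝ := (√(κ + X ^ 2 + Y ^ 2))⁻¹

/-- The argument of the cap profile for the cap that leaves at the angle `φ` from the interface. -/
def capArg (κ φ X Y : ℝ) : ℝ := sine κ X Y * (Real.cos φ * X - Real.sin φ * Y)

/-- The area of the cap that leaves at the angle `φ` from the interface, up to the area of the unit
sphere. -/
def capArea (m : ℕ) (κ φ X Y : ℝ) : ℝ := sine κ X Y ^ m * capProfile m (capArg κ φ X Y)

/-- The volume between the caps at the angles `a` and `b` from the interface, up to the area of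
the unit sphere. -/
def sectorVol (m : ℕ) (κ a b X Y : ℝ) : ℝ :=
  (∫ φ in a..b, sine κ X Y ^ (m + 1) * capProfile' m (capArg κ φ X Y)) / m

section Line

variable {κ X Y dx dy τ : ℝ}

theorem sine_pos (h : 0 < κ + X ^ 2 + Y ^ 2) : 0 < sine κ X Y :=
  inv_pos.2 (Real.sqrt_pos.2 h)

theorem hasDerivAt_sine (h : 0 < κ + (X + τ * dx) ^ 2 + (Y + τ * dy) ^ 2) :
    HasDerivAt (fun τ => sine κ (X + τ * dx) (Y + τ * dy))
      (-(sine κ (X + τ * dx) (Y + τ * dy) ^ 3 * ((X + τ * dx) * dx + (Y + τ * dy) * dy))) τ := by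
  have hx : HasDerivAt (fun τ => X + τ * dx) dx τ := by
    simpa using ((hasDerivAt_id τ).mul_const dx).const_add X
  have hy : HasDerivAt (fun τ => Y + τ * dy) dy τ := by
    simpa using ((hasDerivAt_id τ).mul_const dy).const_add Y
  have h1 := ((((hx.fun_pow 2).const_add κ).fun_add (hy.fun_pow 2)).sqrt h.ne').fun_inv
    (Real.sqrt_pos.2 h).ne'
  refine h1.congr_deriv ?_
  have := Real.sqrt_pos.2 h
  simp only [sine]
  field_simp
  norm_num

theorem hasDerivAt_capArg {φ : ℝ} (h : 0 < κ + (X + τ * dx) ^ 2 + (Y + τ * dy) ^ 2) :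
    HasDerivAt (fun τ => capArg κ φ (X + τ * dx) (Y + τ * dy))
      (sine κ (X + τ * dx) (Y + τ * dy) * (Real.cos φ * dx - Real.sin φ * dy) -
        sine κ (X + τ * dx) (Y + τ * dy) ^ 2 * ((X + τ * dx) * dx + (Y + τ * dy) * dy) *
        capArg κ φ (X + τ * dx) (Y + τ * dy)) τ := by
  have hx : HasDerivAt (fun τ => X + τ * dx) dx τ := by
    simpa using ((hasDerivAt_id τ).mul_const dx).const_add X
  have hy : HasDerivAt (fun τ => Y + τ * dy) dy τ := by
    simpa using ((hasDerivAt_id τ).mul_const dy).const_add Y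
  refine ((hasDerivAt_sine h).fun_mul ((hx.const_mul (Real.cos φ)).fun_sub
    (hy.const_mul (Real.sin φ)))).congr_deriv ?_
  simp only [capArg]
  ring

theorem hasDerivAt_capArg_angle (φ : ℝ) :
    HasDerivAt (fun φ => capArg κ φ X Y)
      (-(sine κ X Y * (Real.sin φ * X + Real.cos φ * Y))) φ := by
  refine ((((Real.hasDerivAt_cos φ).mul_const X).fun_sub
    ((Real.hasDerivAt_sin φ).mul_const Y)).const_mul (sine κ X Y)).congr_deriv ?_
  ring

/-- Both vectors are resolved in an orthonormal frame adapted to the cap at angle `φ`. -/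
theorem inner_eq (φ : ℝ) : X * dx + Y * dy =
    (Real.cos φ * X - Real.sin φ * Y) * (Real.cos φ * dx - Real.sin φ * dy) +
      (Real.sin φ * X + Real.cos φ * Y) * (Real.sin φ * dx + Real.cos φ * dy) := by
  linear_combination -(X * dx + Y * dy) * Real.sin_sq_add_cos_sq φ

/-- First variation of the area of a cap. -/
theorem hasDerivAt_capArea {m : ℕ} (hm : 1 ≤ m) {φ : ℝ}
    (h : 0 < κ + (X + τ * dx) ^ 2 + (Y + τ * dy) ^ 2)
    (h1 : capArg κ φ (X + τ * dx) (Y + τ * dy) < 1) :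
    HasDerivAt (fun τ => capArea m κ φ (X + τ * dx) (Y + τ * dy))
      (sine κ (X + τ * dx) (Y + τ * dy) ^ (m + 1) * (Real.cos φ * dx - Real.sin φ * dy) -
        sine κ (X + τ * dx) (Y + τ * dy) ^ (m + 2) *
        (Real.sin φ * (X + τ * dx) + Real.cos φ * (Y + τ * dy)) *
        (Real.sin φ * dx + Real.cos φ * dy) *
        capWeight m (capArg κ φ (X + τ * dx) (Y + τ * dy))) τ := by
  refine (((hasDerivAt_sine h).fun_pow m).fun_mul
    ((hasDerivAt_capProfile m h1).comp τ (hasDerivAt_capArg h))).congr_deriv ?_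
  -- Write `pu, pn` and `du, dn` for the components of position and direction in the frame of `φ`.
  -- As `s * pu = x`, the coefficient of `du` is `s ^ (m + 1) * ((1 - x²) a' - m x a)`, which is `s
  -- ^ (m + 1)` by the ODE.
  rw [inner_eq φ (X := X + τ * dx) (Y := Y + τ * dy)]
  have hode := capProfile_ode hm h1
  have harg : capArg κ φ (X + τ * dx) (Y + τ * dy) = sine κ (X + τ * dx) (Y + τ * dy) *
    (Real.cos φ * (X + τ * dx) - Real.sin φ * (Y + τ * dy)) := rfl
  simp only [capWeight, Function.comp]
  generalize capArg κ φ (X + τ * dx) (Y + τ * dy) = x at *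
  generalize sine κ (X + τ * dx) (Y + τ * dy) = s at *
  generalize capProfile m x = a at *
  generalize capProfile' m x = a' at *
  generalize Real.sin φ * (X + τ * dx) + Real.cos φ * (Y + τ * dy) = pn at *
  generalize Real.cos φ * (X + τ * dx) - Real.sin φ * (Y + τ * dy) = pu at *
  generalize Real.cos φ * dx - Real.sin φ * dy = du at *
  generalize Real.sin φ * dx + Real.cos φ * dy = dn at *
  obtain ⟨k, rfl⟩ : ∃ k, m = k + 1 := ⟨m - 1, by omega⟩
  simp only [Nat.add_sub_cancel] at *
  push_cast at *
  linear_combination s ^ (k + 2) * du * hode + (s ^ (k + 2) * du * ((k + 1) * a + x * a')) * harg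

theorem continuousOn_capProfile' (m : ℕ) : ContinuousOn (capProfile' m) (Iio 1) :=
  fun _ hx => (hasDerivAt_capProfile' m hx).continuousAt.continuousWithinAt

theorem continuousOn_capProfile'' (m : ℕ) : ContinuousOn (capProfile'' m) (Iio 1) :=
  fun _ hx => (differentiableAt_capProfile'' m hx).continuousAt.continuousWithinAt

/-- First variation of the volume between two caps. -/
theorem hasDerivAt_sectorVol {m : ℕ} (hm : 1 ≤ m) {a b ε : ℝ} (hε : 0 < ε)
    (h : ∀ t ∈ Metric.closedBall τ ε, 0 < κ + (X + t * dx) ^ 2 + (Y + t * dy) ^ 2)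
    (h1 : ∀ t ∈ Metric.closedBall τ ε, ∀ φ ∈ uIcc a b,
      capArg κ φ (X + t * dx) (Y + t * dy) < 1) :
    HasDerivAt (fun τ => sectorVol m κ a b (X + τ * dx) (Y + τ * dy))
      (sine κ (X + τ * dx) (Y + τ * dy) ^ (m + 2) / m *
        ((Real.sin b * dx + Real.cos b * dy) *
          capWeight m (capArg κ b (X + τ * dx) (Y + τ * dy)) -
         (Real.sin a * dx + Real.cos a * dy) *
          capWeight m (capArg κ a (X + τ * dx) (Y + τ * dy)))) τ := by
  let f' : ℝ → ℝ → ℝ := fun τ φ =>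
    sine κ (X + τ * dx) (Y + τ * dy) ^ (m + 1) *
      (capProfile'' m (capArg κ φ (X + τ * dx) (Y + τ * dy)) *
      (sine κ (X + τ * dx) (Y + τ * dy) * (Real.cos φ * dx - Real.sin φ * dy) -
        sine κ (X + τ * dx) (Y + τ * dy) ^ 2 * ((X + τ * dx) * dx + (Y + τ * dy) * dy) *
        capArg κ φ (X + τ * dx) (Y + τ * dy))) -
    (m + 1) * sine κ (X + τ * dx) (Y + τ * dy) ^ (m + 3) *
      ((X + τ * dx) * dx + (Y + τ * dy) * dy) *
      capProfile' m (capArg κ φ (X + τ * dx) (Y + τ * dy))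
  have hτ : τ ∈ Metric.closedBall τ ε := Metric.mem_closedBall_self hε.le
  have hsc : ContinuousOn (fun p : ℝ × ℝ => sine κ (X + p.1 * dx) (Y + p.1 * dy))
      (Metric.closedBall τ ε ×ˢ uIcc a b) := by
    refine ContinuousOn.inv₀ (by fun_prop) fun p hp => (Real.sqrt_pos.2 (h p.1 hp.1)).ne'
  have hac : ContinuousOn (fun p : ℝ × ℝ => capArg κ p.2 (X + p.1 * dx) (Y + p.1 * dy))
      (Metric.closedBall τ ε ×ˢ uIcc a b) := hsc.mul (by fun_prop)
  have hc1 : ContinuousOn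
      (fun p : ℝ × ℝ => capProfile' m (capArg κ p.2 (X + p.1 * dx) (Y + p.1 * dy)))
      (Metric.closedBall τ ε ×ˢ uIcc a b) :=
    (continuousOn_capProfile' m).comp hac fun p hp => h1 p.1 hp.1 p.2 hp.2
  have hc2 : ContinuousOn
      (fun p : ℝ × ℝ => capProfile'' m (capArg κ p.2 (X + p.1 * dx) (Y + p.1 * dy)))
      (Metric.closedBall τ ε ×ˢ uIcc a b) :=
    (continuousOn_capProfile'' m).comp hac fun p hp => h1 p.1 hp.1 p.2 hp.2
  have hf'c : ContinuousOn (Function.uncurry f') (Metric.closedBall τ ε ×ˢ uIcc a b) := by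
    simp only [f', Function.uncurry_def]
    fun_prop
  have hf'c0 : ContinuousOn (f' τ) (uIcc a b) :=
    hf'c.comp (f := fun t => (τ, t)) (by fun_prop) fun t ht => ⟨hτ, ht⟩
  have hder := hasDerivAt_intervalIntegral_of_continuousOn (a := a) (b := b) (x₀ := τ)
    (f := fun τ φ => sine κ (X + τ * dx) (Y + τ * dy) ^ (m + 1) *
      capProfile' m (capArg κ φ (X + τ * dx) (Y + τ * dy))) (f' := f') hε
    (fun t ht φ hφ => by
      refine (((hasDerivAt_sine (h t ht)).fun_pow (m + 1)).fun_mul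
        ((hasDerivAt_capProfile' m (h1 t ht φ hφ)).comp t (hasDerivAt_capArg (h t ht)))).congr_deriv
          ?_
      simp only [f', Nat.add_sub_cancel, Function.comp]
      push_cast
      ring)
    (fun t ht => ((hsc.pow (m + 1)).mul hc1).comp (f := fun φ => (t, φ)) (by fun_prop)
      fun φ hφ => ⟨ht, hφ⟩) hf'c
  -- By `capProfile_ode'` the variation of the integrand is an exact derivative in the angle, so
  -- only the two bounding caps contribute to the change of volume.
  have hftc : ∫ φ in a..b, f' τ φ =
      sine κ (X + τ * dx) (Y + τ * dy) ^ (m + 2) * ((Real.sin b * dx + Real.cos b * dy) *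
          capWeight m (capArg κ b (X + τ * dx) (Y + τ * dy))) -
      sine κ (X + τ * dx) (Y + τ * dy) ^ (m + 2) * ((Real.sin a * dx + Real.cos a * dy) *
          capWeight m (capArg κ a (X + τ * dx) (Y + τ * dy))) := by
    refine intervalIntegral.integral_eq_sub_of_hasDerivAt
      (f := fun φ => sine κ (X + τ * dx) (Y + τ * dy) ^ (m + 2) *
        ((Real.sin φ * dx + Real.cos φ * dy) *
          capWeight m (capArg κ φ (X + τ * dx) (Y + τ * dy))))
      (fun φ hφ => ?_) hf'c0.intervalIntegrable
    have hx := h1 τ hτ φ hφ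
    refine (((((Real.hasDerivAt_sin φ).mul_const dx).fun_add
      ((Real.hasDerivAt_cos φ).mul_const dy)).fun_mul ((hasDerivAt_capWeight m hx).comp φ
        (hasDerivAt_capArg_angle φ))).const_mul _).congr_deriv ?_
    have hode := capProfile_ode' hm hx
    have harg : capArg κ φ (X + τ * dx) (Y + τ * dy) = sine κ (X + τ * dx) (Y + τ * dy) *
      (Real.cos φ * (X + τ * dx) - Real.sin φ * (Y + τ * dy)) := rfl
    simp only [f', capWeight, Function.comp]
    rw [inner_eq φ (X := X + τ * dx) (Y := Y + τ * dy)]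
    generalize capArg κ φ (X + τ * dx) (Y + τ * dy) = x at *
    generalize sine κ (X + τ * dx) (Y + τ * dy) = s at *
    generalize capProfile m x = a at *
    generalize capProfile' m x = a' at *
    generalize capProfile'' m x = a'' at *
    generalize Real.sin φ * (X + τ * dx) + Real.cos φ * (Y + τ * dy) = pn at *
    generalize Real.cos φ * (X + τ * dx) - Real.sin φ * (Y + τ * dy) = pu at *
    have hdu : Real.cos φ * dx + -Real.sin φ * dy = Real.cos φ * dx - Real.sin φ * dy := by ring
    rw [hdu]
    generalize Real.cos φ * dx - Real.sin φ * dy = du at *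
    generalize Real.sin φ * dx + Real.cos φ * dy = dn at *
    linear_combination (-s ^ (m + 2) * du) * hode -
      (s ^ (m + 2) * du * ((m + 1) * a' + x * a'')) * harg
  refine (hder.div_const (m : ℝ)).congr_deriv ?_
  rw [hftc]
  ring

end Line

end BubbleParam

end

/-! ### Admissible parameters and concavity of the area -/

noncomputable section

theorem Real.sin_two_pi_div_three : Real.sin (2 * Real.pi / 3) = √3 / 2 := by
  rw [show 2 * Real.pi / 3 = Real.pi - Real.pi / 3 by ring, Real.sin_pi_sub, Real.sin_pi_div_three]

theorem Real.cos_two_pi_div_three : Real.cos (2 * Real.pi / 3) = -(1 / 2) := by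
  rw [show 2 * Real.pi / 3 = Real.pi - Real.pi / 3 by ring, Real.cos_pi_sub, Real.cos_pi_div_three]

namespace BubbleParam

/-- The mean curvature of the outer cap of the first region. -/
def press₁ (X Y : ℝ) : ℝ := -(√3 / 2 * X) + Y / 2

/-- The mean curvature of the outer cap of the second region. -/
def press₂ (X Y : ℝ) : ℝ := -(√3 / 2 * X) - Y / 2

/-- The parameters of bubbles whose two regions are relatively compact. -/
def Admissible (κ X Y : ℝ) : Prop := κ ≤ 0 → √(-κ) < press₁ X Y ∧ √(-κ) < press₂ X Y

variable {κ X Y X' Y' : ℝ}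

theorem sq_sqrt_three : √3 ^ 2 = (3 : ℝ) := Real.sq_sqrt (by norm_num)

theorem Admissible.swap (h : Admissible κ X Y) : Admissible κ X (-Y) := fun hκ => by
  have h1 : press₁ X (-Y) = press₂ X Y := by simp only [press₁, press₂]; ring
  have h2 : press₂ X (-Y) = press₁ X Y := by simp only [press₁, press₂]; ring
  rw [h1, h2]
  exact ⟨(h hκ).2, (h hκ).1⟩

/-- For `κ ≤ 0`, rotate coordinates: `X² + Y² = press₁² + (X / 2 + √3 / 2 * Y)²`, and `press₁² >
-κ`. -/
theorem Admissible.pos (h : Admissible κ X Y) : 0 < κ + X ^ 2 + Y ^ 2 := by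
  rcases lt_or_ge 0 κ with hκ | hκ
  · positivity
  · have h1 := (h hκ).1
    have h2 : -κ < press₁ X Y ^ 2 := by
      rw [← Real.sqrt_lt' ((Real.sqrt_nonneg _).trans_lt h1)]
      exact h1
    simp only [press₁] at h2
    nlinarith [sq_sqrt_three, sq_nonneg (X / 2 + √3 / 2 * Y)]

/-- For `κ > 0` this is Cauchy–Schwarz. For `κ ≤ 0` the outer cap `φ = 2π/3` is the worst one: its
value exceeds that at `φ` by `2 / √3` times `press₁ * (cos (φ - π/3) - 1/2) + press₂ * (cos (φ +
π/3) + 1)`, where both coefficients are nonnegative. At the outer cap the claim amounts to `-κ <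
press₁²`. -/
theorem Admissible.capArg_lt_one_of_nonneg (h : Admissible κ X Y) {φ : ℝ} (h0 : 0 ≤ φ)
    (h1 : φ ≤ 2 * Real.pi / 3) : capArg κ φ X Y < 1 := by
  have hR := h.pos
  have key : ∀ Z : ℝ, Z ^ 2 < κ + X ^ 2 + Y ^ 2 → Z < √(κ + X ^ 2 + Y ^ 2) := fun Z hZ =>
    lt_of_le_of_lt (le_abs_self Z) (Real.lt_sqrt (abs_nonneg Z) |>.2 (by rwa [sq_abs]))
  rw [capArg, sine, inv_mul_lt_iff₀ (Real.sqrt_pos.2 hR), mul_one]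
  rcases lt_or_ge 0 κ with hκ | hκ
  · refine key _ ?_
    nlinarith [sq_nonneg (Real.sin φ * X + Real.cos φ * Y), Real.sin_sq_add_cos_sq φ]
  · obtain ⟨hp₁, hp₂⟩ := h hκ
    have hs := Real.sqrt_nonneg (-κ)
    have h2 : -κ < press₁ X Y ^ 2 := by
      rw [← Real.sqrt_lt' (hs.trans_lt hp₁)]
      exact hp₁
    have hZe : -(X / 2) - √3 / 2 * Y < √(κ + X ^ 2 + Y ^ 2) := by
      refine key _ ?_
      simp only [press₁] at h2
      nlinarith [sq_sqrt_three]
    refine lt_of_le_of_lt ?_ hZe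
    have hc : (1 : ℝ) / 2 ≤ Real.cos (φ - Real.pi / 3) := by
      rw [← Real.cos_pi_div_three, ← Real.cos_abs (φ - Real.pi / 3)]
      refine Real.cos_le_cos_of_nonneg_of_le_pi (abs_nonneg _) (by linarith [Real.pi_pos]) ?_
      rw [abs_le]
      constructor <;> linarith
    have hc' := Real.neg_one_le_cos (φ + Real.pi / 3)
    rw [Real.cos_sub, Real.cos_pi_div_three, Real.sin_pi_div_three] at hc
    rw [Real.cos_add, Real.cos_pi_div_three, Real.sin_pi_div_three] at hc'
    have e1 := mul_nonneg (hs.trans hp₁.le) (sub_nonneg.2 hc)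
    have e2 := mul_nonneg (hs.trans hp₂.le) (sub_nonneg.2 hc')
    simp only [press₁, press₂] at e1 e2
    have h3 : (0 : ℝ) < √3 := by positivity
    have : 0 ≤ √3 * (-(X / 2) - √3 / 2 * Y - (Real.cos φ * X - Real.sin φ * Y)) := by
      refine (add_nonneg (mul_nonneg zero_le_two e1) (mul_nonneg zero_le_two e2)).trans_eq ?_
      linear_combination Y / 2 * sq_sqrt_three
    linarith [nonneg_of_mul_nonneg_right this h3]

theorem capArg_neg (φ : ℝ) : capArg κ (-φ) X (-Y) = capArg κ φ X Y := by
  simp [capArg, sine]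

theorem Admissible.capArg_lt_one (h : Admissible κ X Y) {φ : ℝ} (h0 : -(2 * Real.pi / 3) ≤ φ)
    (h1 : φ ≤ 2 * Real.pi / 3) : capArg κ φ X Y < 1 := by
  rcases le_total 0 φ with hφ | hφ
  · exact h.capArg_lt_one_of_nonneg hφ h1
  · rw [← capArg_neg]
    exact h.swap.capArg_lt_one_of_nonneg (by linarith) (by linarith)

theorem press₁_line (dx dy τ : ℝ) :
    press₁ (X + τ * dx) (Y + τ * dy) = press₁ X Y + τ * press₁ dx dy := by
  simp only [press₁]; ring

theorem press₂_line (dx dy τ : ℝ) :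
    press₂ (X + τ * dx) (Y + τ * dy) = press₂ X Y + τ * press₂ dx dy := by
  simp only [press₂]; ring

theorem isOpen_admissible_line (κ X Y dx dy : ℝ) :
    IsOpen {τ : ℝ | Admissible κ (X + τ * dx) (Y + τ * dy)} := by
  rcases lt_or_ge 0 κ with hκ | hκ
  · have : {τ : ℝ | Admissible κ (X + τ * dx) (Y + τ * dy)} = univ :=
      eq_univ_of_forall fun τ h => absurd h (not_le.2 hκ)
    rw [this]
    exact isOpen_univ
  · have : {τ : ℝ | Admissible κ (X + τ * dx) (Y + τ * dy)} =
        {τ | √(-κ) < press₁ X Y + τ * press₁ dx dy} ∩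
        {τ | √(-κ) < press₂ X Y + τ * press₂ dx dy} := by
      ext τ
      simp only [Admissible, press₁_line, press₂_line, mem_ofPred_eq, mem_inter_iff]
      exact ⟨fun h => h hκ, fun h _ => h⟩
    rw [this]
    exact (isOpen_lt (by fun_prop) (by fun_prop)).inter (isOpen_lt (by fun_prop) (by fun_prop))

/-- For `κ ≤ 0` admissibility is a pair of strict linear inequalities, hence convex. This is what
allows two arbitrary bubbles to be joined by a segment of parameters. -/
theorem Admissible.line (h : Admissible κ X Y) (h' : Admissible κ X' Y') {τ : ℝ}
    (hτ : τ ∈ Icc (0 : ℝ) 1) :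
    Admissible κ (X + τ * (X' - X)) (Y + τ * (Y' - Y)) := fun hκ => by
  have e1 : press₁ (X + τ * (X' - X)) (Y + τ * (Y' - Y)) =
      (1 - τ) * press₁ X Y + τ * press₁ X' Y' := by simp only [press₁]; ring
  have e2 : press₂ (X + τ * (X' - X)) (Y + τ * (Y' - Y)) =
      (1 - τ) * press₂ X Y + τ * press₂ X' Y' := by simp only [press₂]; ring
  have key : ∀ a b c : ℝ, c < a → c < b → c < (1 - τ) * a + τ * b := fun a b c ha hb => by
    rcases hτ.1.eq_or_lt with rfl | h0
    · simpa using ha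
    · nlinarith [hτ.2, mul_pos h0 (sub_pos.2 hb), mul_nonneg (sub_nonneg.2 hτ.2) (sub_pos.2 ha).le]
  rw [e1, e2]
  exact ⟨key _ _ _ (h hκ).1 (h' hκ).1, key _ _ _ (h hκ).2 (h' hκ).2⟩

/-- The area of the bubble, up to the area of the unit sphere. -/
def totalArea (m : ℕ) (κ X Y : ℝ) : ℝ :=
  capArea m κ 0 X Y + capArea m κ (2 * Real.pi / 3) X Y + capArea m κ (-(2 * Real.pi / 3)) X Y

/-- The volume of the first region, up to the area of the unit sphere. -/
def vol₁ (m : ℕ) (κ X Y : ℝ) : ℝ := sectorVol m κ 0 (2 * Real.pi / 3) X Y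

/-- The volume of the second region, up to the area of the unit sphere. -/
def vol₂ (m : ℕ) (κ X Y : ℝ) : ℝ := sectorVol m κ (-(2 * Real.pi / 3)) 0 X Y

theorem hasDerivAt_sectorVol_of_admissible {m : ℕ} (hm : 1 ≤ m) {a b dx dy τ : ℝ}
    (h : Admissible κ (X + τ * dx) (Y + τ * dy))
    (ha : a ∈ Icc (-(2 * Real.pi / 3)) (2 * Real.pi / 3))
    (hb : b ∈ Icc (-(2 * Real.pi / 3)) (2 * Real.pi / 3)) :
    HasDerivAt (fun τ => sectorVol m κ a b (X + τ * dx) (Y + τ * dy))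
      (sine κ (X + τ * dx) (Y + τ * dy) ^ (m + 2) / m *
        ((Real.sin b * dx + Real.cos b * dy) *
          capWeight m (capArg κ b (X + τ * dx) (Y + τ * dy)) -
         (Real.sin a * dx + Real.cos a * dy) *
          capWeight m (capArg κ a (X + τ * dx) (Y + τ * dy)))) τ := by
  obtain ⟨ε, hε, hsub⟩ := Metric.nhds_basis_closedBall.mem_iff.1
    ((isOpen_admissible_line κ X Y dx dy).mem_nhds h)
  refine hasDerivAt_sectorVol hm hε (fun t ht => (hsub ht).pos) fun t ht φ hφ => ?_
  have := uIcc_subset_Icc ha hb hφ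
  exact (hsub ht).capArg_lt_one this.1 this.2

/-- Concavity of the area of bubbles as a function of the enclosed volumes, with the mean
curvatures of the outer caps as derivatives. -/
theorem totalArea_sub_le {m : ℕ} (hm : 1 ≤ m) (h : Admissible κ X Y) (h' : Admissible κ X' Y') :
    totalArea m κ X' Y' - m * (press₁ X Y * vol₁ m κ X' Y' + press₂ X Y * vol₂ m κ X' Y') ≤
    totalArea m κ X Y - m * (press₁ X Y * vol₁ m κ X Y + press₂ X Y * vol₂ m κ X Y) := by
  set dx := X' - X with hdx
  set dy := Y' - Y with hdy
  have hpi := Real.pi_pos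
  let s : ℝ → ℝ := fun τ => sine κ (X + τ * dx) (Y + τ * dy)
  let w : ℝ → ℝ → ℝ := fun φ τ => capWeight m (capArg κ φ (X + τ * dx) (Y + τ * dy))
  -- The pressures are frozen at the starting point `(X, Y)`, so the derivative of `G` vanishes at
  -- `τ = 0` and afterwards sees only the increments of the pressures.
  let G : ℝ → ℝ := fun τ => totalArea m κ (X + τ * dx) (Y + τ * dy) -
    m * (press₁ X Y * vol₁ m κ (X + τ * dx) (Y + τ * dy) +
      press₂ X Y * vol₂ m κ (X + τ * dx) (Y + τ * dy))
  have hm0 : (m : ℝ) ≠ 0 := by positivity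
  -- The `sine ^ (m + 1)` terms of the three caps cancel, since their directions sum to zero. The
  -- rest of the area variation is `m` times the running pressures paired with the volume
  -- variations. Subtracting the frozen pressures leaves `τ` times the increments `press₁ dx dy` and
  -- `press₂ dx dy`; their difference is `dy`, which completes the squares.
  have hder : ∀ τ ∈ Icc (0 : ℝ) 1, HasDerivAt G (-(τ * s τ ^ (m + 2) * (dy ^ 2 * w 0 τ +
      press₁ dx dy ^ 2 * w (2 * Real.pi / 3) τ +
      press₂ dx dy ^ 2 * w (-(2 * Real.pi / 3)) τ))) τ := by
    intro τ hτ
    have hA := h.line h' hτ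
    have hcap : ∀ φ ∈ Icc (-(2 * Real.pi / 3)) (2 * Real.pi / 3),
        capArg κ φ (X + τ * dx) (Y + τ * dy) < 1 := fun φ hφ => hA.capArg_lt_one hφ.1 hφ.2
    have m0 : (0 : ℝ) ∈ Icc (-(2 * Real.pi / 3)) (2 * Real.pi / 3) := by constructor <;> linarith
    have m1 : 2 * Real.pi / 3 ∈ Icc (-(2 * Real.pi / 3)) (2 * Real.pi / 3) := by
      constructor <;> linarith
    have m2 : -(2 * Real.pi / 3) ∈ Icc (-(2 * Real.pi / 3)) (2 * Real.pi / 3) := by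
      constructor <;> linarith
    have d0 := hasDerivAt_capArea hm hA.pos (hcap _ m0)
    have d1 := hasDerivAt_capArea hm hA.pos (hcap _ m1)
    have d2 := hasDerivAt_capArea hm hA.pos (hcap _ m2)
    have v1 := hasDerivAt_sectorVol_of_admissible hm hA m0 m1
    have v2 := hasDerivAt_sectorVol_of_admissible hm hA m2 m0
    refine (((d0.fun_add d1).fun_add d2).fun_sub (((v1.const_mul (press₁ X Y)).fun_add
      (v2.const_mul (press₂ X Y))).const_mul (m : ℝ))).congr_deriv ?_
    simp only [Real.sin_neg, Real.cos_neg, Real.sin_zero, Real.cos_zero,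
      Real.sin_two_pi_div_three, Real.cos_two_pi_div_three, press₁, press₂, s, w]
    field_simp
    ring
  have hanti : AntitoneOn G (Icc 0 1) := by
    refine antitoneOn_of_deriv_nonpos (convex_Icc 0 1)
      (fun τ hτ => (hder τ hτ).continuousAt.continuousWithinAt)
      (fun τ hτ => (hder τ (interior_subset hτ)).differentiableAt.differentiableWithinAt) ?_
    intro τ hτ
    have hτ' := interior_subset hτ
    rw [(hder τ hτ').deriv]
    have hA := h.line h' hτ'
    have hw : ∀ φ, -(2 * Real.pi / 3) ≤ φ → φ ≤ 2 * Real.pi / 3 → 0 ≤ w φ τ := fun φ h1 h2 =>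
      capWeight_nonneg m (hA.capArg_lt_one h1 h2)
    have hs : 0 < s τ := sine_pos hA.pos
    have w0 := hw 0 (by linarith) (by linarith)
    have w1 := hw (2 * Real.pi / 3) (by linarith) (by linarith)
    have w2 := hw (-(2 * Real.pi / 3)) (by linarith) (by linarith)
    have := hτ'.1
    rw [Left.neg_nonpos_iff]
    positivity
  have := hanti (left_mem_Icc.2 zero_le_one) (right_mem_Icc.2 zero_le_one) zero_le_one
  simpa [G, hdx, hdy] using this

end BubbleParam

end

/-! ### Conformal parametrization of spherical caps by flat discs -/

noncomputable section

open scoped ENNReal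

/-- The point of `ℝ × ℝᵐ` with components `a` and `y`. -/
def joinCoord {m : ℕ} (a : ℝ) (y : EuclideanSpace ℝ (Fin m)) : EuclideanSpace ℝ (Fin (m + 1)) :=
  WithLp.toLp 2 (Fin.cons a y)

section JoinCoord

variable {m : ℕ}

theorem joinCoord_apply_zero [NeZero (m + 1)] (a : ℝ) (y : EuclideanSpace ℝ (Fin m)) :
    joinCoord a y 0 = a := rfl

theorem norm_joinCoord_sq (a : ℝ) (y : EuclideanSpace ℝ (Fin m)) :
    ‖joinCoord a y‖ ^ 2 = a ^ 2 + ‖y‖ ^ 2 := by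
  rw [EuclideanSpace.real_norm_sq_eq, EuclideanSpace.real_norm_sq_eq, Fin.sum_univ_succ]
  rfl

theorem joinCoord_sub (a a' : ℝ) (y y' : EuclideanSpace ℝ (Fin m)) :
    joinCoord a y - joinCoord a' y' = joinCoord (a - a') (y - y') := by
  ext i
  refine Fin.cases ?_ (fun j => ?_) i <;> rfl

theorem dist_joinCoord_sq (a a' : ℝ) (y y' : EuclideanSpace ℝ (Fin m)) :
    dist (joinCoord a y) (joinCoord a' y') ^ 2 = (a - a') ^ 2 + dist y y' ^ 2 := by
  rw [dist_eq_norm, joinCoord_sub, norm_joinCoord_sq, dist_eq_norm]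

theorem exists_eq_joinCoord [NeZero (m + 1)] (x : EuclideanSpace ℝ (Fin (m + 1))) :
    ∃ y, x = joinCoord (x 0) y := by
  refine ⟨WithLp.toLp 2 fun i => x i.succ, ?_⟩
  ext i
  refine Fin.cases ?_ (fun j => ?_) i <;> rfl

theorem measurable_joinCoord :
    Measurable fun p : ℝ × EuclideanSpace ℝ (Fin m) => joinCoord p.1 p.2 := by
  refine (WithLp.measurable_toLp 2 _).comp (measurable_pi_lambda _ fun i => ?_)
  refine Fin.cases ?_ (fun j => ?_) i
  · exact measurable_fst
  · exact (measurable_pi_apply j).comp ((WithLp.measurable_ofLp 2 _).comp measurable_snd)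

/-- The splitting of the zeroth coordinate preserves volume. -/
theorem measurePreserving_joinCoord :
    MeasurePreserving fun p : ℝ × EuclideanSpace ℝ (Fin m) => joinCoord p.1 p.2 := by
  have h1 := (PiLp.volume_preserving_toLp (Fin (m + 1))).comp
    (volume_preserving_piFinSuccAbove (fun _ : Fin (m + 1) => ℝ) 0).symm
  have h2 := h1.comp ((MeasurePreserving.id (volume : Measure ℝ)).prod
    (PiLp.volume_preserving_ofLp (Fin m)))
  convert h2 using 1
  · ext p i
    refine Fin.cases ?_ (fun j => ?_) i <;> rfl
  · exact Measure.volume_eq_prod _ _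

end JoinCoord

section Cap

variable {m : ℕ}

theorem bipolar_eq_iff [NeZero (m + 1)] {s r β : ℝ} {x : EuclideanSpace ℝ (Fin (m + 1))} :
    bipolar s x = r * Complex.exp (β * Complex.I) ↔
      ‖x‖ ^ 2 - s ^ 2 = r * Real.cos β ∧ 2 * s * x 0 = r * Real.sin β := by
  rw [Complex.ext_iff, Complex.re_ofReal_mul, Complex.im_ofReal_mul, Complex.exp_ofReal_mul_I_re,
    Complex.exp_ofReal_mul_I_im]
  rfl

/-- The spherical cap without its boundary sphere. -/
def openCap [NeZero (m + 1)] (s β : ℝ) : Set (EuclideanSpace ℝ (Fin (m + 1))) :=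
  {x | ∃ r : ℝ, 0 < r ∧ bipolar s x = r * Complex.exp (β * Complex.I)}

/-- The inverse of the conformal factor of `capMap`. -/
def capFactor (s β : ℝ) (y : EuclideanSpace ℝ (Fin m)) : ℝ :=
  ((1 - Real.cos β) + (1 + Real.cos β) * (‖y‖ ^ 2 / s ^ 2)) / 2

/-- The conformal parametrization of a spherical cap by a flat disc. -/
def capMap (s β : ℝ) (y : EuclideanSpace ℝ (Fin m)) : EuclideanSpace ℝ (Fin (m + 1)) :=
  joinCoord (s * Real.sin β / 2 * (1 - ‖y‖ ^ 2 / s ^ 2) / capFactor s β y) ((capFactor s β y)⁻¹ • y)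

/-- The domain of `capMap`: the disc, without its center if the cap is the complement of a disc. -/
def capDisc (s β : ℝ) : Set (EuclideanSpace ℝ (Fin m)) :=
  Metric.ball 0 s ∩ {y | 0 < capFactor s β y}

theorem continuous_capFactor (s β : ℝ) : Continuous (capFactor (m := m) s β) := by
  unfold capFactor
  fun_prop

theorem measurable_capMap (s β : ℝ) : Measurable (capMap (m := m) s β) := by
  have h := (continuous_capFactor (m := m) s β).measurable
  exact measurable_joinCoord.comp (f := fun y : EuclideanSpace ℝ (Fin m) =>
    (s * Real.sin β / 2 * (1 - ‖y‖ ^ 2 / s ^ 2) / capFactor s β y, (capFactor s β y)⁻¹ • y))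
    (by fun_prop)

/-- `capMap` is the restriction to a hyperplane of a Möbius transformation fixing the boundary
sphere pointwise, and Möbius maps scale a distance by the geometric mean of the conformal factors at
its endpoints. -/
theorem dist_capMap_sq {s : ℝ} (hs : 0 < s) (β : ℝ) {y y' : EuclideanSpace ℝ (Fin m)}
    (hy : 0 < capFactor s β y) (hy' : 0 < capFactor s β y') :
    dist (capMap s β y) (capMap s β y') ^ 2 =
      (capFactor s β y)⁻¹ * (capFactor s β y')⁻¹ * dist y y' ^ 2 := by
  rw [capMap, capMap, dist_joinCoord_sq]
  simp only [dist_eq_norm, @norm_sub_sq_real, norm_smul, inner_smul_left, inner_smul_right,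
    mul_pow, Real.norm_eq_abs, sq_abs]
  have e1 : ‖y‖ ^ 2 = s ^ 2 * (‖y‖ ^ 2 / s ^ 2) := by field_simp
  have e2 : ‖y'‖ ^ 2 = s ^ 2 * (‖y'‖ ^ 2 / s ^ 2) := by field_simp
  have hL : capFactor s β y = ((1 - Real.cos β) + (1 + Real.cos β) * (‖y‖ ^ 2 / s ^ 2)) / 2 := rfl
  have hL' : capFactor s β y' =
    ((1 - Real.cos β) + (1 + Real.cos β) * (‖y'‖ ^ 2 / s ^ 2)) / 2 := rfl
  have hsc := Real.sin_sq_add_cos_sq β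
  generalize capFactor s β y = L at *
  generalize capFactor s β y' = L' at *
  generalize ‖y‖ ^ 2 / s ^ 2 = η at *
  generalize ‖y'‖ ^ 2 / s ^ 2 = η' at *
  rw [e1, e2]
  generalize inner ℝ y y' = p
  generalize Real.sin β = sn at *
  generalize Real.cos β = cs at *
  simp only [conj_trivial]
  have hsn : sn ^ 2 = 1 - cs ^ 2 := by linarith
  field_simp
  have : (1 - η) * L' - L * (1 - η') = η' - η := by rw [hL, hL']; ring
  rw [this, hsn, hL, hL']
  ring

theorem norm_capMap_sq {s : ℝ} (hs : 0 < s) (β : ℝ) {y : EuclideanSpace ℝ (Fin m)}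
    (hy : 0 < capFactor s β y) :
    ‖capMap s β y‖ ^ 2 = s ^ 2 * (((1 + Real.cos β) + (1 - Real.cos β) * (‖y‖ ^ 2 / s ^ 2)) / 2) /
      capFactor s β y := by
  rw [capMap, norm_joinCoord_sq]
  simp only [norm_smul, mul_pow, Real.norm_eq_abs, sq_abs]
  have e1 : ‖y‖ ^ 2 = s ^ 2 * (‖y‖ ^ 2 / s ^ 2) := by field_simp
  have hL : capFactor s β y = ((1 - Real.cos β) + (1 + Real.cos β) * (‖y‖ ^ 2 / s ^ 2)) / 2 := rfl
  have hsc := Real.sin_sq_add_cos_sq β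
  generalize capFactor s β y = L at *
  generalize ‖y‖ ^ 2 / s ^ 2 = η at *
  rw [e1]
  generalize Real.sin β = sn at *
  generalize Real.cos β = cs at *
  have hsn : sn ^ 2 = 1 - cs ^ 2 := by linarith
  field_simp
  rw [hsn, hL]
  ring

theorem bipolar_capMap [NeZero (m + 1)] {s : ℝ} (hs : 0 < s) (β : ℝ) {y : EuclideanSpace ℝ (Fin m)}
    (hy : 0 < capFactor s β y) :
    bipolar s (capMap s β y) = (s ^ 2 * (1 - ‖y‖ ^ 2 / s ^ 2) / capFactor s β y : ℝ) *
      Complex.exp (β * Complex.I) := by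
  rw [bipolar_eq_iff, norm_capMap_sq hs β hy]
  constructor
  · have hL : capFactor s β y = ((1 - Real.cos β) + (1 + Real.cos β) * (‖y‖ ^ 2 / s ^ 2)) / 2 := rfl
    generalize capFactor s β y = L at *
    generalize ‖y‖ ^ 2 / s ^ 2 = η at *
    field_simp
    rw [hL]
    ring
  · rw [capMap, joinCoord_apply_zero]
    ring

theorem image_capMap [NeZero (m + 1)] {s : ℝ} (hs : 0 < s) (β : ℝ) :
    capMap s β '' capDisc (m := m) s β = openCap s β := by
  ext x
  constructor
  · rintro ⟨y, ⟨hy, hL⟩, rfl⟩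
    refine ⟨_, ?_, bipolar_capMap hs β hL⟩
    have hy' : ‖y‖ < s := by simpa using hy
    have : 0 < 1 - ‖y‖ ^ 2 / s ^ 2 := by
      rw [sub_pos, div_lt_one (by positivity)]
      exact pow_lt_pow_left₀ hy' (norm_nonneg y) two_ne_zero
    have hL' : 0 < capFactor s β y := hL
    positivity
  · rintro ⟨r, hr, hx⟩
    rw [bipolar_eq_iff] at hx
    obtain ⟨z, hz⟩ := exists_eq_joinCoord x
    obtain ⟨h1, h2⟩ := hx
    generalize x 0 = a at *
    subst hz
    rw [norm_joinCoord_sq] at h1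
    have hC : -1 ≤ Real.cos β := Real.neg_one_le_cos β
    -- Solving `r = s² (1 - η) / L` together with the formula for the factor `L` in terms of `η =
    -- ‖y‖² / s²` gives `L = s² / D` and `η = (D - r) / D`; the preimage is then `L • z`.
    obtain ⟨D, hD⟩ : ∃ D, D = s ^ 2 + r * ((1 + Real.cos β) / 2) := ⟨_, rfl⟩
    have hden : 0 < D := by
      have : 0 ≤ r * ((1 + Real.cos β) / 2) := mul_nonneg hr.le (by linarith)
      rw [hD]
      positivity
    have ha : a = r * Real.sin β / (2 * s) := by field_simp; linarith
    have hsc := Real.sin_sq_add_cos_sq β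
    have hsn : Real.sin β ^ 2 = 1 - Real.cos β ^ 2 := by linarith
    have hz2 : ‖z‖ ^ 2 * s ^ 2 = (D - r) * D := by
      have : ‖z‖ ^ 2 = s ^ 2 + r * Real.cos β - a ^ 2 := by linarith
      rw [this, ha, div_pow, mul_pow, hsn, hD]
      field_simp
      ring
    have hη : ‖(s ^ 2 / D) • z‖ ^ 2 / s ^ 2 = (D - r) / D := by
      rw [norm_smul, mul_pow, Real.norm_eq_abs, sq_abs, div_pow]
      field_simp
      linear_combination hz2
    have hF : capFactor s β ((s ^ 2 / D) • z) = s ^ 2 / D := by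
      rw [capFactor, hη]
      field_simp
      linear_combination 2 * hD
    have hLpos : 0 < s ^ 2 / D := by positivity
    refine ⟨(s ^ 2 / D) • z, ⟨?_, ?_⟩, ?_⟩
    · have : ‖(s ^ 2 / D) • z‖ ^ 2 / s ^ 2 < 1 := by
        rw [hη, div_lt_one hden]
        linarith
      rw [div_lt_one (by positivity)] at this
      simpa using lt_of_pow_lt_pow_left₀ 2 hs.le this
    · change 0 < capFactor s β ((s ^ 2 / D) • z)
      rw [hF]
      exact hLpos
    · rw [capMap, hF, hη, smul_smul, inv_mul_cancel₀ hLpos.ne', one_smul, ha]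
      congr 1
      field_simp
      ring

end Cap

end

/-! ### Areas of caps and of the bubble surface -/

noncomputable section

open scoped ENNReal

/-- The area of the unit sphere of `ℝᵐ`. -/
def sphereConst (m : ℕ) : ℝ :=
  m * (volume (Metric.ball (0 : EuclideanSpace ℝ (Fin m)) 1)).toReal

theorem sphereConst_pos {m : ℕ} (hm : 1 ≤ m) : 0 < sphereConst m := by
  have : 0 < (volume (Metric.ball (0 : EuclideanSpace ℝ (Fin m)) 1)).toReal :=
    ENNReal.toReal_pos (Metric.measure_ball_pos _ _ one_pos).ne' measure_ball_lt_top.ne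
  unfold sphereConst
  positivity

theorem ofReal_sphereConst (m : ℕ) : ENNReal.ofReal (sphereConst m) =
    m * volume (Metric.ball (0 : EuclideanSpace ℝ (Fin m)) 1) := by
  rw [sphereConst, ENNReal.ofReal_mul (by positivity), ENNReal.ofReal_natCast,
    ENNReal.ofReal_toReal measure_ball_lt_top.ne]

/-- Polar coordinates for the integral of a radial function over a ball of `ℝᵐ`. -/
theorem setLIntegral_ball_fun_norm {m : ℕ} (hm : 1 ≤ m) {s : ℝ} (hs : 0 ≤ s) {g : ℝ → ℝ}
    (hg : Measurable g) (hg0 : ∀ r ∈ Ioo 0 s, 0 ≤ g r)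
    (hgi : IntervalIntegrable (fun r => r ^ (m - 1) * g r) volume 0 s) :
    ∫⁻ y in Metric.ball (0 : EuclideanSpace ℝ (Fin m)) s, ENNReal.ofReal (g ‖y‖) =
      ENNReal.ofReal (sphereConst m * ∫ r in (0 : ℝ)..s, r ^ (m - 1) * g r) := by
  have : Nonempty (Fin m) := ⟨⟨0, hm⟩⟩
  have h1 : ∫⁻ y in Metric.ball (0 : EuclideanSpace ℝ (Fin m)) s, ENNReal.ofReal (g ‖y‖) =
      ∫⁻ y : EuclideanSpace ℝ (Fin m),
        (Iio s).indicator (fun r => ENNReal.ofReal (g r)) ‖y‖ := by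
    rw [← lintegral_indicator measurableSet_ball]
    congr 1 with y
    simp [indicator]
  have h2 : ∫⁻ r in Ioi (0 : ℝ), ENNReal.ofReal (r ^ (m - 1)) *
      (Iio s).indicator (fun r => ENNReal.ofReal (g r)) r =
      ∫⁻ r in Ioo 0 s, ENNReal.ofReal (r ^ (m - 1) * g r) := by
    rw [← Ioi_inter_Iio, inter_comm, ← Measure.restrict_restrict measurableSet_Iio,
      ← lintegral_indicator measurableSet_Iio]
    refine setLIntegral_congr_fun measurableSet_Ioi fun r hr => ?_
    by_cases hrs : r ∈ Iio s
    · simp only [indicator_of_mem hrs]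
      rw [ENNReal.ofReal_mul (pow_nonneg (mem_Ioi.1 hr).le _)]
    · simp [indicator_of_notMem hrs]
  rw [h1, lintegral_fun_norm_addHaar volume
    (hg.ennreal_ofReal.indicator measurableSet_Iio), finrank_euclideanSpace_fin, h2,
    ENNReal.ofReal_mul (by unfold sphereConst; positivity), ofReal_sphereConst,
    intervalIntegral.integral_of_le hs, integral_Ioc_eq_integral_Ioo,
    ofReal_integral_eq_lintegral_ofReal]
  · rw [intervalIntegrable_iff_integrableOn_Ioo_of_le hs] at hgi
    exact hgi
  · refine (ae_restrict_iff' measurableSet_Ioo).2 (Filter.Eventually.of_forall fun r hr => ?_)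
    exact mul_nonneg (pow_nonneg hr.1.le _) (hg0 r hr)

namespace SpaceForm

/-- The geodesic cosine of the radius of the singular sphere `{x₀ = 0, ‖x‖ = s}`. -/
def cosine (X : SpaceForm) (s : ℝ) : ℝ :=
  (1 - X.curvature * s ^ 2 / 4) / (1 + X.curvature * s ^ 2 / 4)

/-- The geodesic sine of the radius of the singular sphere `{x₀ = 0, ‖x‖ = s}`. -/
def sine (X : SpaceForm) (s : ℝ) : ℝ := s / (1 + X.curvature * s ^ 2 / 4)

end SpaceForm

theorem disc_denom_pos {x η : ℝ} (hx : x < 1) (h0 : 0 ≤ η) (h1 : η < 1) :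
    0 < (1 + η) - x * (1 - η) := by
  nlinarith [mul_pos (sub_pos.2 hx) (sub_pos.2 h1)]

/-- The substitution `r = s (1 - t) / (1 + t)` turns the bracket in the denominator into `2 (1 + t²
- 2 x t) / (1 + t)²`, the denominator of the cap profile. -/
theorem integral_disc {m : ℕ} (hm : 1 ≤ m) {s k x : ℝ} (hs : 0 < s) (hk : 0 < k) (hx : x < 1) :
    ∫ r in (0 : ℝ)..s, r ^ (m - 1) *
      (2 / (k * ((1 + r ^ 2 / s ^ 2) - x * (1 - r ^ 2 / s ^ 2)))) ^ m =
    (s / k) ^ m * capProfile m x := by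
  have hcov := intervalIntegral.integral_comp_mul_deriv' (a := 0) (b := 1)
    (f := fun t : ℝ => s * (1 - t) / (1 + t)) (f' := fun t => -(2 * s) / (1 + t) ^ 2)
    (g := fun r : ℝ => r ^ (m - 1) *
      (2 / (k * ((1 + r ^ 2 / s ^ 2) - x * (1 - r ^ 2 / s ^ 2)))) ^ m) ?_ ?_ ?_
  · simp only [sub_zero, mul_one, add_zero, div_one, sub_self, mul_zero, zero_div,
      Function.comp] at hcov
    rw [intervalIntegral.integral_symm, ← hcov, ← intervalIntegral.integral_neg, capProfile,
      radialIntegral, ← intervalIntegral.integral_const_mul, ← intervalIntegral.integral_const_mul]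
    refine intervalIntegral.integral_congr fun t ht => ?_
    rw [uIcc_of_le zero_le_one] at ht
    obtain ⟨D, hD⟩ : ∃ D, D = 1 + t ^ 2 - 2 * x * t := ⟨_, rfl⟩
    have hDpos : 0 < D := hD ▸ one_add_sq_sub_pos hx ht.1
    have h1t : 0 < 1 + t := by linarith [ht.1]
    have e1 : (1 + (s * (1 - t) / (1 + t)) ^ 2 / s ^ 2) -
        x * (1 - (s * (1 - t) / (1 + t)) ^ 2 / s ^ 2) = 2 * D / (1 + t) ^ 2 := by
      field_simp
      rw [hD]
      ring
    have e2 : (1 - t ^ 2) = (1 - t) * (1 + t) := by ring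
    simp only [e1, e2, ← hD]
    obtain ⟨j, rfl⟩ : ∃ j, m = j + 1 := ⟨m - 1, by omega⟩
    generalize 1 + t = u at *
    generalize 1 - t = v
    simp only [Nat.add_sub_cancel, div_pow, mul_pow]
    field_simp
    ring
  · intro t ht
    rw [uIcc_of_le zero_le_one] at ht
    have h1t : 1 + t ≠ 0 := by linarith [ht.1]
    refine (((((hasDerivAt_id t).const_sub 1).const_mul s).fun_div
      ((hasDerivAt_id t).const_add 1) h1t)).congr_deriv ?_
    simp only [id]
    field_simp
    ring
  · refine ContinuousOn.div (by fun_prop) (by fun_prop) fun t ht => ?_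
    rw [uIcc_of_le zero_le_one] at ht
    have h1t : 0 < 1 + t := by linarith [ht.1]
    positivity
  · refine ContinuousOn.mul (by fun_prop) (ContinuousOn.pow
      (ContinuousOn.div (by fun_prop) (by fun_prop) ?_) m)
    rintro _ ⟨t, ht, rfl⟩
    rw [uIcc_of_le zero_le_one] at ht
    have h1t : 0 < 1 + t := by linarith [ht.1]
    have e1 : (1 + (s * (1 - t) / (1 + t)) ^ 2 / s ^ 2) -
        x * (1 - (s * (1 - t) / (1 + t)) ^ 2 / s ^ 2) =
        2 * (1 + t ^ 2 - 2 * x * t) / (1 + t) ^ 2 := by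
      field_simp
      ring
    rw [e1]
    have := one_add_sq_sub_pos hx ht.1
    positivity

section OpenCap

variable {m : ℕ} {X : SpaceForm} {s β : ℝ}

/-- The factor `capFactor` here cancels against the conformal factor of `capMap`. The metric pulled
back to the disc thus depends on `β` only through `X.cosine s * Real.cos β`, the argument of the cap
profile. -/
theorem one_add_capMap (hs : 0 < s) {y : EuclideanSpace ℝ (Fin m)}
    (hk : 0 < 1 + X.curvature * s ^ 2 / 4) (hL : 0 < capFactor s β y) :
    1 + X.curvature * ‖capMap s β y‖ ^ 2 / 4 = (1 + X.curvature * s ^ 2 / 4) *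
      ((1 + ‖y‖ ^ 2 / s ^ 2) - X.cosine s * Real.cos β * (1 - ‖y‖ ^ 2 / s ^ 2)) /
        (2 * capFactor s β y) := by
  rw [norm_capMap_sq hs β hL]
  have hF : capFactor s β y = ((1 - Real.cos β) + (1 + Real.cos β) * (‖y‖ ^ 2 / s ^ 2)) / 2 := rfl
  generalize capFactor s β y = L at *
  generalize ‖y‖ ^ 2 / s ^ 2 = η at *
  rw [SpaceForm.cosine]
  generalize Real.cos β = cs at *
  obtain ⟨k, hk'⟩ : ∃ k, k = 1 + X.curvature * s ^ 2 / 4 := ⟨_, rfl⟩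
  have hκ : X.curvature = 4 * (k - 1) / s ^ 2 := by
    rw [hk']
    field_simp
    ring
  rw [← hk'] at hk ⊢
  rw [hκ]
  field_simp
  rw [hF]
  ring

theorem openCap_subset_domain [NeZero (m + 1)] (hs : 0 < s) (hk : 0 < 1 + X.curvature * s ^ 2 / 4)
    (hx : X.cosine s * Real.cos β < 1) : openCap s β ⊆ X.domain (m + 1) := by
  rw [← image_capMap hs]
  rintro _ ⟨y, ⟨hy, hL⟩, rfl⟩
  have hL' : 0 < capFactor s β y := hL
  have hy' : ‖y‖ < s := by simpa using hy
  have hη : ‖y‖ ^ 2 / s ^ 2 < 1 := by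
    rw [div_lt_one (by positivity)]
    exact pow_lt_pow_left₀ hy' (norm_nonneg y) two_ne_zero
  change 0 < 1 + X.curvature * ‖capMap s β y‖ ^ 2 / 4
  rw [one_add_capMap hs hk hL']
  have := disc_denom_pos hx (by positivity) hη
  positivity

theorem measurable_density_pow (X : SpaceForm) (n j : ℕ) :
    Measurable fun x : EuclideanSpace ℝ (Fin n) => ENNReal.ofReal (X.density x ^ j) := by
  unfold SpaceForm.density
  fun_prop

theorem measurableSet_capDisc (s β : ℝ) : MeasurableSet (capDisc (m := m) s β) :=
  measurableSet_ball.inter (measurableSet_lt measurable_const (continuous_capFactor s β).measurable)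

theorem capDisc_ae_eq (hm : 1 ≤ m) (hs : 0 < s) :
    capDisc (m := m) s β =ᵐ[volume] Metric.ball (0 : EuclideanSpace ℝ (Fin m)) s := by
  have : Nonempty (Fin m) := ⟨⟨0, hm⟩⟩
  filter_upwards [compl_mem_ae_iff.2 (measure_singleton (0 : EuclideanSpace ℝ (Fin m)))] with y hy
  refine propext (and_iff_left ?_)
  have hy0 : 0 < ‖y‖ := norm_pos_iff.2 hy
  have hη : 0 < ‖y‖ ^ 2 / s ^ 2 := by positivity
  change 0 < capFactor s β y
  rw [capFactor]
  rcases (Real.cos_le_one β).eq_or_lt with h | h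
  · rw [h]
    linarith
  · have := mul_nonneg (neg_le_iff_add_nonneg'.1 (Real.neg_one_le_cos β)) hη.le
    linarith

/-- The area of a spherical cap in a space form. -/
theorem setLIntegral_openCap [NeZero (m + 1)] (hm : 1 ≤ m) (hs : 0 < s)
    (hk : 0 < 1 + X.curvature * s ^ 2 / 4)
    (hx : X.cosine s * Real.cos β < 1) :
    ∫⁻ x in openCap (m := m) s β, ENNReal.ofReal (X.density x ^ m) ∂μHE[m] =
      ENNReal.ofReal (sphereConst m * (X.sine s ^ m * capProfile m (X.cosine s * Real.cos β))) := by
  rw [← image_capMap hs, setLIntegral_image_of_conformal (lam := fun y => (capFactor s β y)⁻¹)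
    (measurable_capMap s β) (continuous_capFactor s β).measurable.inv (measurableSet_capDisc s β)
    (fun y hy => inv_pos.2 hy.2) (fun y hy y' hy' => dist_capMap_sq hs β hy.2 hy'.2)
    (measurable_density_pow X _ m)]
  have h1 : ∫⁻ y in capDisc (m := m) s β, ENNReal.ofReal ((capFactor s β y)⁻¹ ^ m) *
      ENNReal.ofReal (X.density (capMap s β y) ^ m) =
      ∫⁻ y in capDisc (m := m) s β, ENNReal.ofReal ((fun r => (2 / ((1 + X.curvature * s ^ 2 / 4) *
        ((1 + r ^ 2 / s ^ 2) - X.cosine s * Real.cos β * (1 - r ^ 2 / s ^ 2)))) ^ m) ‖y‖) := by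
    refine setLIntegral_congr_fun (measurableSet_capDisc s β) fun y hy => ?_
    have hL : 0 < capFactor s β y := hy.2
    simp only
    rw [← ENNReal.ofReal_mul (by positivity), ← mul_pow, SpaceForm.density,
      one_add_capMap hs hk hL]
    congr 2
    rw [inv_div]
    field_simp
  rw [h1, setLIntegral_congr (capDisc_ae_eq hm hs), setLIntegral_ball_fun_norm hm hs.le
    (g := fun r => (2 / ((1 + X.curvature * s ^ 2 / 4) *
      ((1 + r ^ 2 / s ^ 2) - X.cosine s * Real.cos β * (1 - r ^ 2 / s ^ 2)))) ^ m),
    integral_disc hm hs hk hx, SpaceForm.sine]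
  · fun_prop
  · intro r hr
    have hη : r ^ 2 / s ^ 2 < 1 := by
      rw [div_lt_one (by positivity)]
      exact pow_lt_pow_left₀ hr.2 hr.1.le two_ne_zero
    have := disc_denom_pos hx (by positivity) hη
    positivity
  · refine ContinuousOn.intervalIntegrable (ContinuousOn.mul (by fun_prop) (ContinuousOn.pow
      (ContinuousOn.div (by fun_prop) (by fun_prop) ?_) m))
    intro r hr
    rw [uIcc_of_le hs.le] at hr
    have hη : r ^ 2 / s ^ 2 ≤ 1 := by
      rw [div_le_one (by positivity)]
      exact pow_le_pow_left₀ hr.1 hr.2 2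
    have : 0 < (1 + r ^ 2 / s ^ 2) - X.cosine s * Real.cos β * (1 - r ^ 2 / s ^ 2) := by
      have : 0 ≤ r ^ 2 / s ^ 2 := by positivity
      nlinarith [mul_nonneg (sub_pos.2 hx).le (sub_nonneg.2 hη)]
    positivity

theorem mem_openCap_iff [NeZero (m + 1)] {x : EuclideanSpace ℝ (Fin (m + 1))} :
    x ∈ openCap s β ↔ bipolar s x ≠ 0 ∧
      bipolar s x = ‖bipolar s x‖ * Complex.exp (β * Complex.I) := by
  constructor
  · rintro ⟨r, hr, hx⟩
    rw [hx]
    simp [hr.ne', Complex.norm_exp_ofReal_mul_I, abs_of_pos hr]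
  · rintro ⟨h0, hx⟩
    exact ⟨_, norm_pos_iff.2 h0, hx⟩

theorem continuous_bipolar [NeZero (m + 1)] (s : ℝ) :
    Continuous (bipolar s : EuclideanSpace ℝ (Fin (m + 1)) → ℂ) := by
  have : (bipolar s : EuclideanSpace ℝ (Fin (m + 1)) → ℂ) =
      fun x => ((‖x‖ ^ 2 - s ^ 2 : ℝ) : ℂ) + ((2 * s * x 0 : ℝ) : ℂ) * Complex.I := by
    ext x
    exact Complex.mk_eq_add_mul_I _ _
  rw [this]
  refine Continuous.add (Complex.continuous_ofReal.comp (by fun_prop))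
    (Continuous.mul (Complex.continuous_ofReal.comp ?_) continuous_const)
  exact continuous_const.mul (EuclideanSpace.proj (𝕜 := ℝ) (0 : Fin (m + 1))).continuous

theorem measurableSet_openCap [NeZero (m + 1)] (s β : ℝ) :
    MeasurableSet (openCap (m := m) s β) := by
  have h : openCap (m := m) s β = {x | bipolar s x ≠ 0} ∩
      {x | bipolar s x = ‖bipolar s x‖ * Complex.exp (β * Complex.I)} := by
    ext x
    exact mem_openCap_iff
  have hb := continuous_bipolar (m := m) s
  rw [h]
  refine (isOpen_ne_fun hb continuous_const).measurableSet.inter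
    (isClosed_eq hb (by fun_prop)).measurableSet

theorem disjoint_openCap [NeZero (m + 1)] {β' : ℝ} (h : Real.cos (β - β') ≠ 1) :
    Disjoint (openCap (m := m) s β) (openCap s β') := by
  refine Set.disjoint_left.2 ?_
  rintro x ⟨r, hr, hx⟩ ⟨r', hr', hx'⟩
  have h2 : r = r' := by
    have := congrArg norm (hx.symm.trans hx')
    simpa [Complex.norm_exp_ofReal_mul_I, abs_of_pos hr, abs_of_pos hr'] using this
  subst h2
  rw [bipolar_eq_iff] at hx hx'
  have hc : Real.cos β = Real.cos β' := mul_left_cancel₀ hr.ne' (hx.1.symm.trans hx'.1)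
  have hsn : Real.sin β = Real.sin β' := mul_left_cancel₀ hr.ne' (hx.2.symm.trans hx'.2)
  exact h (by rw [Real.cos_sub, hc, hsn]; nlinarith [Real.sin_sq_add_cos_sq β'])

theorem sphericalCap_eq [NeZero (m + 1)] :
    (sphericalCap s β : Set (EuclideanSpace ℝ (Fin (m + 1)))) =
      openCap s β ∪ {x | bipolar s x = 0} := by
  ext x
  constructor
  · rintro ⟨r, hr, hx⟩
    rcases hr.eq_or_lt with rfl | hr
    · right
      simpa using hx
    · exact Or.inl ⟨r, hr, hx⟩
  · rintro (⟨r, hr, hx⟩ | hx)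
    · exact ⟨r, hr.le, hx⟩
    · exact ⟨0, le_rfl, by simpa using hx⟩

/-- The singular set lies in a sphere of an isometric copy of `ℝᵐ`, where the Hausdorff measure is
Lebesgue measure. -/
theorem measure_bipolar_eq_zero [NeZero (m + 1)] (hs : 0 < s) :
    μHE[m] {x : EuclideanSpace ℝ (Fin (m + 1)) | bipolar s x = 0} = 0 := by
  have h : {x : EuclideanSpace ℝ (Fin (m + 1)) | bipolar s x = 0} ⊆
      joinCoord 0 '' Metric.sphere 0 s := by
    intro x hx
    have h1 : ‖x‖ ^ 2 - s ^ 2 = 0 := congrArg Complex.re hx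
    have h2 : 2 * s * x 0 = 0 := congrArg Complex.im hx
    have h3 : x 0 = 0 := by
      rcases mul_eq_zero.1 h2 with h | h
      · linarith
      · exact h
    obtain ⟨y, hy⟩ := exists_eq_joinCoord x
    rw [h3] at hy
    refine ⟨y, ?_, hy.symm⟩
    rw [hy, norm_joinCoord_sq] at h1
    rw [mem_sphere_zero_iff_norm]
    exact (pow_left_inj₀ (norm_nonneg y) hs.le two_ne_zero).1 (by linarith)
  refine measure_mono_null h ?_
  have hiso : Isometry (joinCoord (m := m) 0) := Isometry.of_dist_eq fun y y' => by
    refine (pow_left_inj₀ dist_nonneg dist_nonneg two_ne_zero).1 ?_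
    rw [dist_joinCoord_sq]
    simp
  rw [hiso.euclideanHausdorffMeasure_image, EuclideanSpace.euclideanHausdorffMeasure_eq_volume]
  exact Measure.addHaar_sphere_of_ne_zero _ _ hs.ne'

end OpenCap

/-- The area of three spherical caps with a common boundary that meet at `120°`. -/
theorem area_surface {m : ℕ} [NeZero (m + 1)] (hm : 1 ≤ m) {X : SpaceForm}
    (B : StandardDoubleBubble X (m + 1)) (hk : 0 < 1 + X.curvature * B.s ^ 2 / 4)
    (hx : ∀ φ ∈ Icc (-(2 * Real.pi / 3)) (2 * Real.pi / 3),
      X.cosine B.s * Real.cos (B.α + φ) < 1) :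
    X.area B.surface = sphereConst m * (X.sine B.s ^ m *
      (capProfile m (X.cosine B.s * Real.cos B.α) +
        capProfile m (X.cosine B.s * Real.cos (B.α + 2 * Real.pi / 3)) +
        capProfile m (X.cosine B.s * Real.cos (B.α - 2 * Real.pi / 3)))) := by
  have hpi := Real.pi_pos
  have hs := B.s_pos
  have x0 : X.cosine B.s * Real.cos B.α < 1 := by
    simpa using hx 0 (by constructor <;> linarith)
  have x1 : X.cosine B.s * Real.cos (B.α + 2 * Real.pi / 3) < 1 := by
    have := hx (2 * Real.pi / 3) (by constructor <;> linarith)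
    exact this
  have x2 : X.cosine B.s * Real.cos (B.α - 2 * Real.pi / 3) < 1 :=
    hx (-(2 * Real.pi / 3)) (by constructor <;> linarith)
  set O₀ := openCap (m := m) B.s B.α
  set O₁ := openCap (m := m) B.s (B.α + 2 * Real.pi / 3)
  set O₂ := openCap (m := m) B.s (B.α - 2 * Real.pi / 3)
  have hd01 : Disjoint O₀ O₁ := disjoint_openCap (by
    rw [show B.α - (B.α + 2 * Real.pi / 3) = -(2 * Real.pi / 3) by ring, Real.cos_neg,
      Real.cos_two_pi_div_three]
    norm_num)
  have hd02 : Disjoint O₀ O₂ := disjoint_openCap (by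
    rw [show B.α - (B.α - 2 * Real.pi / 3) = 2 * Real.pi / 3 by ring, Real.cos_two_pi_div_three]
    norm_num)
  have hd12 : Disjoint O₁ O₂ := disjoint_openCap (by
    rw [show B.α + 2 * Real.pi / 3 - (B.α - 2 * Real.pi / 3) =
      Real.pi / 3 + Real.pi by ring, Real.cos_add_pi, Real.cos_pi_div_three]
    norm_num)
  have hsub : O₀ ∪ O₁ ∪ O₂ ⊆ X.domain (m + 1) :=
    union_subset (union_subset (openCap_subset_domain hs hk x0) (openCap_subset_domain hs hk x1))
      (openCap_subset_domain hs hk x2)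
  have hae : (B.surface ∩ X.domain (m + 1) : Set (EuclideanSpace ℝ (Fin (m + 1)))) =ᵐ[μHE[m]]
      (O₀ ∪ O₁ ∪ O₂ : Set (EuclideanSpace ℝ (Fin (m + 1)))) := by
    filter_upwards [compl_mem_ae_iff.2 (measure_bipolar_eq_zero (m := m) hs)] with x hx0
    refine propext ⟨fun h => ?_, fun h => ⟨?_, hsub h⟩⟩
    · have h1 := h.1
      rw [StandardDoubleBubble.surface, sphericalCap_eq, sphericalCap_eq, sphericalCap_eq] at h1
      rcases h1 with ((h1 | h1) | (h1 | h1)) | (h1 | h1)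
      exacts [Or.inl (Or.inl h1), absurd h1 hx0, Or.inl (Or.inr h1), absurd h1 hx0, Or.inr h1,
        absurd h1 hx0]
    · rw [StandardDoubleBubble.surface, sphericalCap_eq, sphericalCap_eq, sphericalCap_eq]
      rcases h with (h | h) | h
      exacts [Or.inl (Or.inl (Or.inl h)), Or.inl (Or.inr (Or.inl h)), Or.inr (Or.inl h)]
  have hS : 0 < X.sine B.s := div_pos hs hk
  have hc := (sphereConst_pos hm).le
  have n0 := capProfile_nonneg m x0
  have n1 := capProfile_nonneg m x1
  have n2 := capProfile_nonneg m x2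
  rw [SpaceForm.area]
  change (∫⁻ x in B.surface ∩ X.domain (m + 1), ENNReal.ofReal (X.density x ^ m) ∂μHE[m]).toReal = _
  rw [setLIntegral_congr hae,
    lintegral_union (measurableSet_openCap _ _) (disjoint_union_left.2 ⟨hd02, hd12⟩),
    lintegral_union (measurableSet_openCap _ _) hd01, setLIntegral_openCap hm hs hk x0,
    setLIntegral_openCap hm hs hk x1, setLIntegral_openCap hm hs hk x2,
    ← ENNReal.ofReal_add (by positivity) (by positivity),
    ← ENNReal.ofReal_add (by positivity) (by positivity), ENNReal.toReal_ofReal (by positivity)]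
  ring

end

/-! ### Volumes between caps -/

noncomputable section

open scoped ENNReal

/-- The position of a point of `ℝ × ℝᵐ` relative to the axis, as a point of the right half plane. -/
def axialCoord {m : ℕ} [NeZero (m + 1)] (x : EuclideanSpace ℝ (Fin (m + 1))) : ℂ :=
  ⟨√(‖x‖ ^ 2 - x 0 ^ 2), x 0⟩

theorem axialCoord_joinCoord {m : ℕ} [NeZero (m + 1)] (a : ℝ) (y : EuclideanSpace ℝ (Fin m)) :
    axialCoord (joinCoord a y) = ⟨‖y‖, a⟩ := by
  rw [axialCoord, norm_joinCoord_sq, joinCoord_apply_zero, add_sub_cancel_left,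
    Real.sqrt_sq (norm_nonneg y)]

theorem normSq_axialCoord {m : ℕ} [NeZero (m + 1)] (x : EuclideanSpace ℝ (Fin (m + 1))) :
    Complex.normSq (axialCoord x) = ‖x‖ ^ 2 := by
  obtain ⟨y, hy⟩ := exists_eq_joinCoord x
  generalize x 0 = a at hy
  subst hy
  rw [axialCoord_joinCoord, norm_joinCoord_sq, Complex.normSq_mk]
  ring

/-- Cylindrical coordinates for the integral of a rotationally symmetric function. -/
theorem lintegral_axialCoord {m : ℕ} [NeZero (m + 1)] (hm : 1 ≤ m) {Φ : ℂ → ℝ≥0∞}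
    (hΦ : Measurable Φ) :
    ∫⁻ x : EuclideanSpace ℝ (Fin (m + 1)), Φ (axialCoord x) = ENNReal.ofReal (sphereConst m) *
      ∫⁻ z in {z : ℂ | 0 < z.re}, ENNReal.ofReal (z.re ^ (m - 1)) * Φ z := by
  have : Nonempty (Fin m) := ⟨⟨0, hm⟩⟩
  have hmk : Measurable fun p : ℝ × ℝ => (⟨p.1, p.2⟩ : ℂ) :=
    Complex.measurableEquivRealProd.symm.measurable
  have hax : Measurable (axialCoord (m := m)) := by
    refine hmk.comp (f := fun x : EuclideanSpace ℝ (Fin (m + 1)) => (√(‖x‖ ^ 2 - x 0 ^ 2), x 0)) ?_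
    have := (EuclideanSpace.proj (𝕜 := ℝ) (0 : Fin (m + 1))).continuous.measurable
    exact Measurable.prodMk ((measurable_norm.pow_const 2).sub (this.pow_const 2)).sqrt this
  have hset : MeasurableSet {z : ℂ | 0 < z.re} :=
    measurableSet_lt measurable_const Complex.measurable_re
  calc ∫⁻ x : EuclideanSpace ℝ (Fin (m + 1)), Φ (axialCoord x)
      = ∫⁻ p : ℝ × EuclideanSpace ℝ (Fin m), Φ ⟨‖p.2‖, p.1⟩ := by
        rw [← measurePreserving_joinCoord.lintegral_comp
          (show Measurable fun x => Φ (axialCoord x) from hΦ.comp hax)]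
        simp only [axialCoord_joinCoord]
    _ = ∫⁻ a : ℝ, ∫⁻ y : EuclideanSpace ℝ (Fin m), Φ ⟨‖y‖, a⟩ := by
        rw [Measure.volume_eq_prod]
        exact lintegral_prod _ (hΦ.comp (hmk.comp (f := fun p : ℝ × EuclideanSpace ℝ (Fin m) =>
          (‖p.2‖, p.1)) (by fun_prop))).aemeasurable
    _ = ∫⁻ a : ℝ, ENNReal.ofReal (sphereConst m) *
          ∫⁻ r : ℝ, (Ioi (0 : ℝ)).indicator
            (fun r => ENNReal.ofReal (r ^ (m - 1)) * Φ ⟨r, a⟩) r := by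
        congr 1 with a
        rw [lintegral_fun_norm_addHaar volume (f := fun r => Φ ⟨r, a⟩)
          (hΦ.comp (hmk.comp (f := fun r : ℝ => (r, a)) (by fun_prop))), finrank_euclideanSpace_fin, ofReal_sphereConst,
          lintegral_indicator measurableSet_Ioi]
    _ = ENNReal.ofReal (sphereConst m) * ∫⁻ a : ℝ, ∫⁻ r : ℝ,
          ({z : ℂ | 0 < z.re}.indicator
            fun z => ENNReal.ofReal (z.re ^ (m - 1)) * Φ z) ⟨r, a⟩ := by
        rw [lintegral_const_mul' _ _ ENNReal.ofReal_ne_top]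
        rfl
    _ = ENNReal.ofReal (sphereConst m) * ∫⁻ p : ℝ × ℝ,
          ({z : ℂ | 0 < z.re}.indicator
            fun z => ENNReal.ofReal (z.re ^ (m - 1)) * Φ z) ⟨p.1, p.2⟩ := by
        rw [Measure.volume_eq_prod, lintegral_prod_symm]
        have hmeas : Measurable fun z : ℂ => ENNReal.ofReal (z.re ^ (m - 1)) * Φ z :=
          (Complex.measurable_re.pow_const _).ennreal_ofReal.mul hΦ
        exact ((hmeas.indicator hset).comp hmk).aemeasurable
    _ = _ := by
        rw [← lintegral_indicator hset]
        congr 1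
        exact Complex.volume_preserving_equiv_real_prod.symm.lintegral_comp_emb
          Complex.measurableEquivRealProd.symm.measurableEmbedding _

/-- The bipolar coordinate on the half plane. -/
def planarBipolar (s : ℝ) (z : ℂ) : ℂ := ⟨Complex.normSq z - s ^ 2, 2 * s * z.im⟩

theorem planarBipolar_axialCoord {m : ℕ} [NeZero (m + 1)] (s : ℝ)
    (x : EuclideanSpace ℝ (Fin (m + 1))) : planarBipolar s (axialCoord x) = bipolar s x := by
  rw [planarBipolar, normSq_axialCoord]
  rfl

/-- The open sector of half opening `h` around the direction `μ`. -/
def openSector (μ h : ℝ) : Set ℂ :=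
  {v | v ≠ 0 ∧ |Complex.arg (v * Complex.exp (-(μ * Complex.I)))| < h}

/-- Since `h ≤ π`, the principal argument after rotation by `-μ` is exactly `θ - μ`. -/
theorem mem_openSector_iff {μ h : ℝ} (hh : h ≤ Real.pi) {v : ℂ} :
    v ∈ openSector μ h ↔ ∃ r θ : ℝ, 0 < r ∧ μ - h < θ ∧ θ < μ + h ∧
      v = r * Complex.exp (θ * Complex.I) := by
  constructor
  · rintro ⟨h0, h1⟩
    rw [abs_lt] at h1
    refine ⟨‖v‖, μ + Complex.arg (v * Complex.exp (-(μ * Complex.I))), norm_pos_iff.2 h0,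
      by linarith, by linarith, ?_⟩
    have h2 := Complex.norm_mul_exp_arg_mul_I (v * Complex.exp (-(μ * Complex.I)))
    have h3 : ‖v * Complex.exp (-(μ * Complex.I))‖ = ‖v‖ := by
      rw [norm_mul, ← neg_mul, ← Complex.ofReal_neg, Complex.norm_exp_ofReal_mul_I, mul_one]
    rw [h3] at h2
    push_cast
    rw [add_mul, Complex.exp_add, mul_left_comm, h2, mul_left_comm, ← Complex.exp_add,
      add_neg_cancel, Complex.exp_zero, mul_one]
  · rintro ⟨r, θ, hr, h1, h2, rfl⟩
    refine ⟨by simp [hr.ne'], ?_⟩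
    have : (r : ℂ) * Complex.exp (θ * Complex.I) * Complex.exp (-(μ * Complex.I)) =
        r * Complex.exp ((θ - μ : ℝ) * Complex.I) := by
      rw [mul_assoc, ← Complex.exp_add]
      congr 2
      push_cast
      ring
    rw [this, Complex.exp_mul_I, Complex.arg_mul_cos_add_sin_mul_I hr
      ⟨by linarith, by linarith⟩, abs_lt]
    constructor <;> linarith

theorem measurableSet_openSector (μ h : ℝ) : MeasurableSet (openSector μ h) := by
  refine MeasurableSet.inter (measurableSet_singleton (0 : ℂ)).compl ?_
  refine measurableSet_lt (Measurable.abs (Complex.measurable_arg.comp ?_)) measurable_const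
  fun_prop

theorem mul_mem_openSector_iff {μ h R : ℝ} (hR : 0 < R) {v : ℂ} :
    (R : ℂ) * v ∈ openSector μ h ↔ v ∈ openSector μ h := by
  simp only [openSector, mem_ofPred_eq, mul_assoc, Complex.arg_real_mul _ hR]
  simp [hR.ne']

theorem betweenCaps_eq {m : ℕ} [NeZero (m + 1)] {s μ h : ℝ} (hh : h ≤ Real.pi) :
    (betweenCaps s (μ - h) (μ + h) : Set (EuclideanSpace ℝ (Fin (m + 1)))) =
      {x | bipolar s x ∈ openSector μ h} := by
  ext x
  simp only [mem_ofPred_eq, mem_openSector_iff hh, betweenCaps]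

/-- The conformal map from the unit disc to the right half plane, rotated by `μ`. -/
def discMap (s μ : ℝ) (ξ : ℂ) : ℂ :=
  s * (1 + Complex.exp (μ * Complex.I) * ξ) / (1 - Complex.exp (μ * Complex.I) * ξ)

/-- A sector of the unit disc. -/
def discSector (h : ℝ) : Set ℂ := {ξ | ‖ξ‖ < 1 ∧ ξ ≠ 0 ∧ |Complex.arg ξ| < h}

theorem measurableSet_discSector (h : ℝ) : MeasurableSet (discSector h) := by
  refine (measurableSet_lt measurable_norm measurable_const).inter
    ((measurableSet_singleton (0 : ℂ)).compl.inter ?_)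
  exact measurableSet_lt (Measurable.abs Complex.measurable_arg) measurable_const

theorem one_sub_ne_zero_of_norm_lt {w : ℂ} (hw : ‖w‖ < 1) : 1 - w ≠ 0 := fun h => by
  rw [← sub_eq_zero.1 h, norm_one] at hw
  exact lt_irrefl _ hw

theorem norm_exp_mul (μ : ℝ) (ξ : ℂ) : ‖Complex.exp (μ * Complex.I) * ξ‖ = ‖ξ‖ := by
  rw [norm_mul, Complex.norm_exp_ofReal_mul_I, one_mul]

/-- The second factor is the conjugate of `z + s`, so the bipolar angle is the argument of `(z - s)
/ (z + s)`. The inverse of this Möbius map, up to the rotation by `μ`, is `discMap`; it therefore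
carries sectors of the disc to regions between caps. -/
theorem planarBipolar_eq (s : ℝ) (z : ℂ) :
    planarBipolar s z = (z - s) * ((starRingEnd ℂ) z + s) := by
  apply Complex.ext
  · simp [planarBipolar, Complex.normSq_apply]
    ring
  · simp [planarBipolar]
    ring

theorem planarBipolar_discMap (s μ : ℝ) {ξ : ℂ} (hξ : ‖ξ‖ < 1) :
    planarBipolar s (discMap s μ ξ) =
      (4 * s ^ 2 / Complex.normSq (1 - Complex.exp (μ * Complex.I) * ξ) : ℝ) *
        (Complex.exp (μ * Complex.I) * ξ) := by
  have hw := one_sub_ne_zero_of_norm_lt ((norm_exp_mul μ ξ).trans_lt hξ)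
  rw [planarBipolar_eq, discMap]
  generalize Complex.exp (μ * Complex.I) * ξ = w at *
  have hw' : (starRingEnd ℂ) (1 - w) ≠ 0 := (map_ne_zero _).2 hw
  push_cast
  rw [Complex.normSq_eq_conj_mul_self, map_div₀, map_mul, Complex.conj_ofReal]
  have e1 : (starRingEnd ℂ) (1 + w) = 2 - (starRingEnd ℂ) (1 - w) := by
    simp only [map_add, map_sub, map_one]
    ring
  rw [e1]
  generalize (starRingEnd ℂ) (1 - w) = v at *
  field_simp
  ring

theorem re_discMap (s μ : ℝ) (ξ : ℂ) :
    (discMap s μ ξ).re = s * (1 - ‖ξ‖ ^ 2) /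
      Complex.normSq (1 - Complex.exp (μ * Complex.I) * ξ) := by
  rw [← norm_exp_mul μ ξ, discMap]
  generalize Complex.exp (μ * Complex.I) * ξ = w
  rw [← Complex.normSq_eq_norm_sq, Complex.div_re]
  simp [Complex.normSq_apply]
  ring

theorem normSq_discMap (s μ : ℝ) (ξ : ℂ) :
    Complex.normSq (discMap s μ ξ) = s ^ 2 *
      Complex.normSq (1 + Complex.exp (μ * Complex.I) * ξ) /
      Complex.normSq (1 - Complex.exp (μ * Complex.I) * ξ) := by
  rw [discMap, map_div₀, map_mul, Complex.normSq_ofReal]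
  ring

theorem discMap_injOn {s : ℝ} (hs : 0 < s) (μ : ℝ) : InjOn (discMap s μ) {ξ | ‖ξ‖ < 1} := by
  intro ξ hξ ξ' hξ' h
  have hw := one_sub_ne_zero_of_norm_lt ((norm_exp_mul μ ξ).trans_lt hξ)
  have hw' := one_sub_ne_zero_of_norm_lt ((norm_exp_mul μ ξ').trans_lt hξ')
  rw [discMap, discMap] at h
  have he := Complex.exp_ne_zero (μ * Complex.I)
  refine mul_left_cancel₀ he ?_
  generalize Complex.exp (μ * Complex.I) * ξ = w at *
  generalize Complex.exp (μ * Complex.I) * ξ' = w' at *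
  have hs' : (s : ℂ) ≠ 0 := by exact_mod_cast hs.ne'
  rw [div_eq_div_iff hw hw'] at h
  have h2 : (2 * s : ℂ) * (w - w') = 0 := by linear_combination h
  rcases mul_eq_zero.1 h2 with h3 | h3
  · exact absurd h3 (mul_ne_zero two_ne_zero hs')
  · exact sub_eq_zero.1 h3

theorem exp_mul_mem_openSector_iff {μ h : ℝ} {ξ : ℂ} :
    Complex.exp (μ * Complex.I) * ξ ∈ openSector μ h ↔ ξ ≠ 0 ∧ |Complex.arg ξ| < h := by
  have : Complex.exp (μ * Complex.I) * ξ * Complex.exp (-(μ * Complex.I)) = ξ := by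
    rw [mul_right_comm, ← Complex.exp_add, add_neg_cancel, Complex.exp_zero, one_mul]
  simp only [openSector, mem_ofPred_eq, this]
  simp [Complex.exp_ne_zero]

theorem image_discMap {s : ℝ} (hs : 0 < s) (μ h : ℝ) :
    discMap s μ '' discSector h = {z : ℂ | 0 < z.re} ∩ {z | planarBipolar s z ∈ openSector μ h} := by
  have hpos : ∀ w : ℂ, w ≠ 0 → 0 < 4 * s ^ 2 / Complex.normSq w := fun w hw => by
    have := Complex.normSq_pos.2 hw
    positivity
  ext z
  constructor
  · rintro ⟨ξ, ⟨hξ, h0, h1⟩, rfl⟩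
    have hw := one_sub_ne_zero_of_norm_lt ((norm_exp_mul μ ξ).trans_lt hξ)
    refine ⟨?_, ?_⟩
    · change 0 < (discMap s μ ξ).re
      rw [re_discMap]
      have := Complex.normSq_pos.2 hw
      have : 0 < 1 - ‖ξ‖ ^ 2 := by nlinarith [norm_nonneg ξ]
      positivity
    · change planarBipolar s (discMap s μ ξ) ∈ openSector μ h
      rw [planarBipolar_discMap s μ hξ, mul_mem_openSector_iff (hpos _ hw)]
      exact exp_mul_mem_openSector_iff.2 ⟨h0, h1⟩
  · rintro ⟨hz, hb⟩
    have hz' : 0 < z.re := hz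
    have hzs : z + s ≠ 0 := fun h => by
      have := congrArg Complex.re h
      simp at this
      linarith
    have hs' : (s : ℂ) ≠ 0 := by exact_mod_cast hs.ne'
    have he := Complex.exp_ne_zero (μ * Complex.I)
    set ξ := (z - s) / (z + s) / Complex.exp (μ * Complex.I) with hξ
    have hw : Complex.exp (μ * Complex.I) * ξ = (z - s) / (z + s) := by
      rw [hξ]
      field_simp
    have hlt : ‖ξ‖ < 1 := by
      rw [← norm_exp_mul μ ξ, hw, norm_div, div_lt_one (norm_pos_iff.2 hzs)]
      refine lt_of_pow_lt_pow_left₀ 2 (norm_nonneg _) ?_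
      rw [← Complex.normSq_eq_norm_sq, ← Complex.normSq_eq_norm_sq]
      simp [Complex.normSq_apply]
      nlinarith [mul_pos hs hz']
    have hzeq : discMap s μ ξ = z := by
      rw [discMap, hw]
      have h2 : 1 - (z - s) / (z + s) ≠ 0 := hw ▸
        one_sub_ne_zero_of_norm_lt ((norm_exp_mul μ ξ).trans_lt hlt)
      rw [div_eq_iff h2]
      field_simp
      ring
    refine ⟨ξ, ⟨hlt, ?_⟩, hzeq⟩
    have hw1 := one_sub_ne_zero_of_norm_lt ((norm_exp_mul μ ξ).trans_lt hlt)
    have hb' : planarBipolar s z ∈ openSector μ h := hb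
    rw [← hzeq, planarBipolar_discMap s μ hlt, mul_mem_openSector_iff (hpos _ hw1)] at hb'
    exact exp_mul_mem_openSector_iff.1 hb'

theorem hasDerivAt_discMap (s μ : ℝ) {ξ : ℂ} (hξ : ‖ξ‖ < 1) :
    HasDerivAt (discMap s μ) (2 * s * Complex.exp (μ * Complex.I) /
      (1 - Complex.exp (μ * Complex.I) * ξ) ^ 2) ξ := by
  have hw := one_sub_ne_zero_of_norm_lt ((norm_exp_mul μ ξ).trans_lt hξ)
  have h1 := ((hasDerivAt_id ξ).const_mul (Complex.exp (μ * Complex.I)))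
  refine (((h1.const_add 1).const_mul (s : ℂ)).fun_div (h1.const_sub 1) hw).congr_deriv ?_
  simp only [id]
  congr 1
  ring

theorem abs_det_restrictScalars (w : ℂ) :
    |((ContinuousLinearMap.toSpanSingleton ℂ w).restrictScalars ℝ : ℂ →L[ℝ] ℂ).det| =
      ‖w‖ ^ 2 := by
  rw [ContinuousLinearMap.det, ContinuousLinearMap.coe_restrictScalars,
    LinearMap.det_restrictScalars, ← Complex.normSq_eq_norm_sq]
  simp [Algebra.norm_complex_apply, abs_of_nonneg (Complex.normSq_nonneg w)]


theorem normSq_one_sub_polar (t θ : ℝ) :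
    Complex.normSq (1 - t * Complex.exp (θ * Complex.I)) = 1 + t ^ 2 - 2 * t * Real.cos θ := by
  rw [Complex.exp_mul_I, ← Complex.ofReal_cos, ← Complex.ofReal_sin, Complex.normSq_apply]
  simp only [Complex.sub_re, Complex.sub_im, Complex.mul_re, Complex.mul_im, Complex.add_re,
    Complex.add_im, Complex.ofReal_re, Complex.ofReal_im, Complex.I_re, Complex.I_im,
    Complex.one_re, Complex.one_im]
  linear_combination t ^ 2 * Real.sin_sq_add_cos_sq θ

theorem normSq_one_add_polar (t θ : ℝ) :
    Complex.normSq (1 + t * Complex.exp (θ * Complex.I)) = 1 + t ^ 2 + 2 * t * Real.cos θ := by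
  have := normSq_one_sub_polar (-t) θ
  simp only [Complex.ofReal_neg, neg_mul, sub_neg_eq_add] at this
  rw [this]
  ring

theorem polar_eq_exp (p : ℝ × ℝ) :
    Complex.polarCoord.symm p = p.1 * Complex.exp (p.2 * Complex.I) := by
  rw [Complex.polarCoord_symm_apply, Complex.exp_mul_I, Complex.ofReal_cos, Complex.ofReal_sin]

/-- Polar coordinates on a sector of the unit disc. -/
theorem setLIntegral_discSector {h : ℝ} (hh : h ≤ Real.pi) {f : ℂ → ℝ≥0∞} :
    ∫⁻ ξ in discSector h, f ξ = ∫⁻ p in Ioo (0 : ℝ) 1 ×ˢ Ioo (-h) h,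
      ENNReal.ofReal p.1 * f (Complex.polarCoord.symm p) := by
  rw [← lintegral_indicator (measurableSet_discSector h), ← Complex.lintegral_comp_polarCoord_symm,
    ← lintegral_indicator (measurableSet_Ioo.prod measurableSet_Ioo),
    ← lintegral_indicator polarCoord.open_target.measurableSet]
  congr 1 with p
  by_cases hp : p ∈ polarCoord.target
  · rw [indicator_of_mem hp, smul_eq_mul]
    rw [polarCoord_target] at hp
    have hp1 : 0 < p.1 := hp.1
    have hmem : Complex.polarCoord.symm p ∈ discSector h ↔ p ∈ Ioo (0 : ℝ) 1 ×ˢ Ioo (-h) h := by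
      have harg : Complex.arg (Complex.polarCoord.symm p) = p.2 := by
        rw [polar_eq_exp, Complex.exp_mul_I, Complex.arg_mul_cos_add_sin_mul_I hp1
          ⟨hp.2.1, hp.2.2.le⟩]
      have hnorm : ‖Complex.polarCoord.symm p‖ = p.1 := by
        rw [Complex.norm_polarCoord_symm, abs_of_pos hp1]
      have hne : Complex.polarCoord.symm p ≠ 0 := by
        rw [← norm_pos_iff, hnorm]
        exact hp1
      simp only [discSector, mem_ofPred_eq, harg, hnorm, abs_lt, mem_prod, mem_Ioo]
      tauto
    by_cases hm : Complex.polarCoord.symm p ∈ discSector h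
    · rw [indicator_of_mem hm, indicator_of_mem (hmem.1 hm)]
    · rw [indicator_of_notMem hm, indicator_of_notMem (fun h' => hm (hmem.2 h')), mul_zero]
  · have hp' : p ∉ Ioo (0 : ℝ) 1 ×ˢ Ioo (-h) h := fun h' => hp (by
      rw [polarCoord_target]
      exact ⟨h'.1.1, ⟨by linarith [h'.2.1], by linarith [h'.2.2]⟩⟩)
    rw [indicator_of_notMem hp, indicator_of_notMem hp']

/-- The volume between two spherical caps with a common boundary. -/
theorem vol_betweenCaps {m : ℕ} [NeZero (m + 1)] (hm : 1 ≤ m) {X : SpaceForm} {s a b : ℝ}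
    (hs : 0 < s) (hk : 0 < 1 + X.curvature * s ^ 2 / 4) (hab : a ≤ b) (hb : b - a ≤ 2 * Real.pi)
    (hx : ∀ θ ∈ Icc a b, X.cosine s * Real.cos θ < 1) :
    X.vol (betweenCaps s a b : Set (EuclideanSpace ℝ (Fin (m + 1)))) =
      ENNReal.ofReal (sphereConst m * ((∫ θ in a..b,
        X.sine s ^ (m + 1) * capProfile' m (X.cosine s * Real.cos θ)) / m)) := by
  -- Angles are measured from the bisector, so that they stay in the range of the principal
  -- argument.
  obtain ⟨μ, h, rfl, rfl⟩ : ∃ μ h, a = μ - h ∧ b = μ + h :=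
    ⟨(a + b) / 2, (b - a) / 2, by ring, by ring⟩
  have hh : h ≤ Real.pi := by linarith
  have hh0 : 0 ≤ h := by linarith
  set k := 1 + X.curvature * s ^ 2 / 4 with hkdef
  have hmeas0 : MeasurableSet {z : ℂ | 0 < z.re} :=
    measurableSet_lt measurable_const Complex.measurable_re
  have hmeas1 : Measurable fun z : ℂ => 1 + X.curvature * Complex.normSq z / 4 := by
    have := Complex.continuous_normSq.measurable
    fun_prop
  have hbip : Measurable (planarBipolar s) := by
    refine Complex.measurableEquivRealProd.symm.measurable.comp
      (f := fun z : ℂ => (Complex.normSq z - s ^ 2, 2 * s * z.im)) ?_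
    have := Complex.continuous_normSq.measurable
    exact (this.sub_const _).prodMk (Complex.measurable_im.const_mul _)
  have hW : MeasurableSet {z : ℂ | planarBipolar s z ∈ openSector μ h} :=
    hbip (measurableSet_openSector μ h)
  have hV : MeasurableSet {z : ℂ | 0 < 1 + X.curvature * Complex.normSq z / 4} :=
    measurableSet_lt measurable_const hmeas1
  let Φ : ℂ → ℝ≥0∞ := ({z : ℂ | planarBipolar s z ∈ openSector μ h} ∩
    {z : ℂ | 0 < 1 + X.curvature * Complex.normSq z / 4}).indicator
    fun z => ENNReal.ofReal ((1 + X.curvature * Complex.normSq z / 4)⁻¹ ^ (m + 1))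
  have hΦ : Measurable Φ :=
    ((hmeas1.inv.pow_const (m + 1)).ennreal_ofReal).indicator (hW.inter hV)
  have hstep1 : X.vol (betweenCaps s (μ - h) (μ + h) : Set (EuclideanSpace ℝ (Fin (m + 1)))) =
      ∫⁻ x : EuclideanSpace ℝ (Fin (m + 1)), Φ (axialCoord x) := by
    have hset : (betweenCaps s (μ - h) (μ + h) ∩ X.domain (m + 1) :
        Set (EuclideanSpace ℝ (Fin (m + 1)))) =
        axialCoord ⁻¹' ({z : ℂ | planarBipolar s z ∈ openSector μ h} ∩
          {z : ℂ | 0 < 1 + X.curvature * Complex.normSq z / 4}) := by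
      ext x
      simp only [betweenCaps_eq hh, SpaceForm.domain, mem_inter_iff, mem_ofPred_eq, mem_preimage,
        planarBipolar_axialCoord, normSq_axialCoord]
    have hmS : MeasurableSet (betweenCaps s (μ - h) (μ + h) ∩ X.domain (m + 1) :
        Set (EuclideanSpace ℝ (Fin (m + 1)))) := by
      rw [betweenCaps_eq hh]
      refine ((continuous_bipolar s).measurable (measurableSet_openSector μ h)).inter ?_
      exact measurableSet_lt measurable_const (by fun_prop)
    rw [SpaceForm.vol, ← lintegral_indicator hmS, hset]
    congr 1 with x
    simp only [Φ, indicator, SpaceForm.density, normSq_axialCoord]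
    rfl
  have hone : ∀ {ξ : ℂ}, ξ ∈ discSector h → ∃ t θ : ℝ, t ∈ Ioo (0 : ℝ) 1 ∧ θ ∈ Icc (μ - h) (μ + h) ∧
      ‖ξ‖ = t ∧ Complex.exp (μ * Complex.I) * ξ = t * Complex.exp (θ * Complex.I) ∧
      θ = μ + Complex.arg ξ := by
    rintro ξ ⟨h1, h2, h3⟩
    rw [abs_lt] at h3
    refine ⟨‖ξ‖, μ + Complex.arg ξ, ⟨norm_pos_iff.2 h2, h1⟩, ⟨by linarith, by linarith⟩, rfl, ?_, rfl⟩
    conv_lhs => rw [← Complex.norm_mul_exp_arg_mul_I ξ]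
    rw [mul_left_comm, ← Complex.exp_add]
    push_cast
    ring_nf
  -- In disc coordinates the conformal factor produces the denominator of the radial integrals at `x
  -- = X.cosine s * cos θ`.
  have hdens : ∀ t θ : ℝ, t ∈ Ioo (0 : ℝ) 1 → ∀ ξ : ℂ,
      Complex.exp (μ * Complex.I) * ξ = t * Complex.exp (θ * Complex.I) → ‖ξ‖ = t →
      1 + X.curvature * Complex.normSq (discMap s μ ξ) / 4 =
        k * (1 + t ^ 2 - 2 * (X.cosine s * Real.cos θ) * t) /
        Complex.normSq (1 - Complex.exp (μ * Complex.I) * ξ) := by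
    intro t θ ht ξ hξ hn
    have hw := one_sub_ne_zero_of_norm_lt ((norm_exp_mul μ ξ).trans_lt (hn.trans_lt ht.2))
    have hN := Complex.normSq_pos.2 hw
    rw [normSq_discMap, hξ, normSq_one_add_polar]
    rw [hξ] at hN
    have hN' := normSq_one_sub_polar t θ
    generalize Complex.normSq (1 - t * Complex.exp (θ * Complex.I)) = N at *
    rw [SpaceForm.cosine, ← hkdef]
    have hκ : X.curvature = 4 * (k - 1) / s ^ 2 := by
      rw [hkdef]
      field_simp
      ring
    rw [hκ]
    field_simp
    rw [hN']
    ring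
  have himage : discMap s μ '' discSector h ⊆
      {z : ℂ | 0 < 1 + X.curvature * Complex.normSq z / 4} := by
    rintro _ ⟨ξ, hξ, rfl⟩
    obtain ⟨t, θ, ht, hθ, hn, he, -⟩ := hone hξ
    change 0 < 1 + X.curvature * Complex.normSq (discMap s μ ξ) / 4
    rw [hdens t θ ht ξ he hn]
    have := one_add_sq_sub_pos (hx θ hθ) ht.1.le
    have hw := one_sub_ne_zero_of_norm_lt ((norm_exp_mul μ ξ).trans_lt (hn.trans_lt ht.2))
    have := Complex.normSq_pos.2 hw
    positivity
  have hstep2 : ∫⁻ z in {z : ℂ | 0 < z.re}, ENNReal.ofReal (z.re ^ (m - 1)) * Φ z =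
      ∫⁻ z in discMap s μ '' discSector h, ENNReal.ofReal (z.re ^ (m - 1)) *
        ENNReal.ofReal ((1 + X.curvature * Complex.normSq z / 4)⁻¹ ^ (m + 1)) := by
    have hset : discMap s μ '' discSector h = {z : ℂ | 0 < z.re} ∩
        ({z | planarBipolar s z ∈ openSector μ h} ∩
          {z : ℂ | 0 < 1 + X.curvature * Complex.normSq z / 4}) := by
      rw [← inter_assoc, ← image_discMap hs μ h, inter_eq_left.2 himage]
    rw [hset, inter_comm, ← Measure.restrict_restrict (hW.inter hV),
      ← lintegral_indicator (hW.inter hV)]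
    congr 1 with z
    by_cases hz : z ∈ {z | planarBipolar s z ∈ openSector μ h} ∩
          {z : ℂ | 0 < 1 + X.curvature * Complex.normSq z / 4}
    · simp only [Φ, indicator_of_mem hz]
    · simp only [Φ, indicator_of_notMem hz, mul_zero]
  -- Jacobian, power of the distance to the axis and density contain `normSq (1 - w)`, `w` being the
  -- rotated disc variable, to the exponents `-2`, `-(m - 1)` and `m + 1`, which cancel. What
  -- remains is the integrand of `capProfile'`, once the polar Jacobian has absorbed the factor
  -- `‖ξ‖⁻¹` in `hstep3`.
  let g : ℝ → ℝ → ℝ := fun θ t => 4 * X.sine s ^ (m + 1) *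
    (t ^ 1 * (1 - t ^ 2) ^ (m - 1) / (1 + t ^ 2 - 2 * (X.cosine s * Real.cos θ) * t) ^ (m + 1))
  have hcov := lintegral_image_eq_lintegral_abs_det_fderiv_mul volume (measurableSet_discSector h)
    (fun ξ hξ => ((hasDerivAt_discMap s μ hξ.1).hasFDerivAt.restrictScalars ℝ).hasFDerivWithinAt)
    ((discMap_injOn hs μ).mono fun ξ hξ => hξ.1)
    (fun z => ENNReal.ofReal (z.re ^ (m - 1)) *
        ENNReal.ofReal ((1 + X.curvature * Complex.normSq z / 4)⁻¹ ^ (m + 1)))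
  have hS : 0 < X.sine s := div_pos hs hk
  have hstep3 : ∫⁻ z in discMap s μ '' discSector h, ENNReal.ofReal (z.re ^ (m - 1)) *
        ENNReal.ofReal ((1 + X.curvature * Complex.normSq z / 4)⁻¹ ^ (m + 1)) =
      ∫⁻ ξ in discSector h, ENNReal.ofReal (‖ξ‖⁻¹ * g (μ + Complex.arg ξ) ‖ξ‖) := by
    rw [hcov]
    refine setLIntegral_congr_fun (measurableSet_discSector h) fun ξ hξ => ?_
    obtain ⟨t, θ, ht, hθ, hn, he, hθ'⟩ := hone hξ
    have hw := one_sub_ne_zero_of_norm_lt ((norm_exp_mul μ ξ).trans_lt (hn.trans_lt ht.2))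
    have hN := Complex.normSq_pos.2 hw
    have hD := one_add_sq_sub_pos (hx θ hθ) ht.1.le
    have h1t : 0 < 1 - t ^ 2 := by nlinarith [ht.1, ht.2]
    rw [abs_det_restrictScalars, hdens t θ ht ξ he hn, re_discMap, hn, ← hθ']
    rw [norm_div, norm_mul, norm_mul, Complex.norm_exp_ofReal_mul_I, norm_pow, div_pow, ← pow_mul,
      mul_comm 2 2, pow_mul, ← Complex.normSq_eq_norm_sq, Complex.norm_ofNat,
      Complex.norm_of_nonneg hs.le]
    generalize Complex.normSq (1 - Complex.exp (μ * Complex.I) * ξ) = N at *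
    have h1 : 0 < t := ht.1
    rw [← ENNReal.ofReal_mul (by positivity), ← ENNReal.ofReal_mul (by positivity)]
    congr 1
    simp only [g, SpaceForm.sine, ← hkdef]
    generalize 1 + t ^ 2 - 2 * (X.cosine s * Real.cos θ) * t = D at *
    obtain ⟨j, rfl⟩ : ∃ j, m = j + 1 := ⟨m - 1, by omega⟩
    simp only [Nat.add_sub_cancel, div_pow, inv_div, mul_pow]
    generalize 1 - t ^ 2 = v at *
    field_simp
    ring
  have hg0 : ∀ θ ∈ Icc (μ - h) (μ + h), ∀ t ∈ Icc (0 : ℝ) 1, 0 ≤ g θ t := by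
    intro θ hθ t ht
    have := one_add_sq_sub_pos (hx θ hθ) ht.1
    have h1t : 0 ≤ 1 - t ^ 2 := by nlinarith [ht.1, ht.2]
    have := ht.1
    simp only [g]
    positivity
  have hgm : Measurable fun p : ℝ × ℝ => ENNReal.ofReal (g (μ + p.2) p.1) := by
    simp only [g]
    fun_prop
  have hinner : ∀ φ ∈ Ioo (-h) h, ∫⁻ t in Ioo (0 : ℝ) 1, ENNReal.ofReal (g (μ + φ) t) =
      ENNReal.ofReal (X.sine s ^ (m + 1) *
        capProfile' m (X.cosine s * Real.cos (μ + φ)) / m) := by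
    intro φ hφ
    have hφ' : μ + φ ∈ Icc (μ - h) (μ + h) := ⟨by linarith [hφ.1], by linarith [hφ.2]⟩
    have hc : IntervalIntegrable (g (μ + φ)) volume 0 1 :=
      ((continuousOn_radialIntegrand_right m 1 (m + 1) (hx _ hφ')).const_mul _).intervalIntegrable
    rw [← ofReal_integral_eq_lintegral_ofReal, ← integral_Ioc_eq_integral_Ioo,
      ← intervalIntegral.integral_of_le zero_le_one]
    · congr 1
      simp only [g, intervalIntegral.integral_const_mul, capProfile']
      change _ * radialIntegral m 1 (m + 1) (X.cosine s * Real.cos (μ + φ)) = _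
      field_simp
    · rw [intervalIntegrable_iff_integrableOn_Ioo_of_le zero_le_one] at hc
      exact hc
    · exact (ae_restrict_iff' measurableSet_Ioo).2 (Filter.Eventually.of_forall fun t ht =>
        hg0 _ hφ' t (Ioo_subset_Icc_self ht))
  have hcp : ContinuousOn (fun θ => X.sine s ^ (m + 1) *
      capProfile' m (X.cosine s * Real.cos θ) / m) (Icc (μ - h) (μ + h)) := by
    refine ContinuousOn.div_const (ContinuousOn.mul continuousOn_const ?_) _
    exact (BubbleParam.continuousOn_capProfile' m).comp (by fun_prop) hx
  have hcp' : IntervalIntegrable (fun φ => X.sine s ^ (m + 1) *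
      capProfile' m (X.cosine s * Real.cos (μ + φ)) / m) volume (-h) h := by
    refine ContinuousOn.intervalIntegrable ?_
    rw [uIcc_of_le (by linarith)]
    exact hcp.comp (by fun_prop) fun φ hφ => ⟨by linarith [hφ.1], by linarith [hφ.2]⟩
  have hstep4 : ∫⁻ ξ in discSector h, ENNReal.ofReal (‖ξ‖⁻¹ * g (μ + Complex.arg ξ) ‖ξ‖) =
      ENNReal.ofReal (∫ θ in (μ - h)..(μ + h), X.sine s ^ (m + 1) *
        capProfile' m (X.cosine s * Real.cos θ) / m) := by
    rw [setLIntegral_discSector hh]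
    calc ∫⁻ p in Ioo (0 : ℝ) 1 ×ˢ Ioo (-h) h, ENNReal.ofReal p.1 *
          ENNReal.ofReal (‖Complex.polarCoord.symm p‖⁻¹ *
            g (μ + Complex.arg (Complex.polarCoord.symm p)) ‖Complex.polarCoord.symm p‖)
        = ∫⁻ p in Ioo (0 : ℝ) 1 ×ˢ Ioo (-h) h, ENNReal.ofReal (g (μ + p.2) p.1) := by
          refine setLIntegral_congr_fun (measurableSet_Ioo.prod measurableSet_Ioo) fun p hp => ?_
          have hp1 : 0 < p.1 := hp.1.1
          have harg : Complex.arg (Complex.polarCoord.symm p) = p.2 := by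
            rw [polar_eq_exp, Complex.exp_mul_I, Complex.arg_mul_cos_add_sin_mul_I hp1
              ⟨by linarith [hp.2.1], by linarith [hp.2.2]⟩]
          have hnorm : ‖Complex.polarCoord.symm p‖ = p.1 := by
            rw [Complex.norm_polarCoord_symm, abs_of_pos hp1]
          simp only [harg, hnorm]
          rw [← ENNReal.ofReal_mul hp1.le, mul_inv_cancel_left₀ hp1.ne']
      _ = ∫⁻ φ in Ioo (-h) h, ∫⁻ t in Ioo (0 : ℝ) 1, ENNReal.ofReal (g (μ + φ) t) := by
          rw [Measure.volume_eq_prod, ← Measure.prod_restrict, lintegral_prod_symm _ hgm.aemeasurable]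
      _ = ∫⁻ φ in Ioo (-h) h, ENNReal.ofReal (X.sine s ^ (m + 1) *
            capProfile' m (X.cosine s * Real.cos (μ + φ)) / m) :=
          setLIntegral_congr_fun measurableSet_Ioo hinner
      _ = _ := by
          rw [← ofReal_integral_eq_lintegral_ofReal, ← integral_Ioc_eq_integral_Ioo,
            ← intervalIntegral.integral_of_le (by linarith)]
          · congr 1
            have := intervalIntegral.integral_comp_add_left (a := -h) (b := h) (fun θ =>
              X.sine s ^ (m + 1) * capProfile' m (X.cosine s * Real.cos θ) / m) μ
            rw [this, sub_eq_add_neg]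
          · rw [intervalIntegrable_iff_integrableOn_Ioo_of_le (by linarith)] at hcp'
            exact hcp'
          · refine (ae_restrict_iff' measurableSet_Ioo).2 (Filter.Eventually.of_forall fun φ hφ => ?_)
            have := capProfile'_nonneg m (hx (μ + φ) ⟨by linarith [hφ.1], by linarith [hφ.2]⟩)
            change 0 ≤ X.sine s ^ (m + 1) * capProfile' m (X.cosine s * Real.cos (μ + φ)) / m
            positivity
  rw [hstep1, lintegral_axialCoord hm hΦ, hstep2, hstep3, hstep4,
    ← ENNReal.ofReal_mul (sphereConst_pos hm).le, intervalIntegral.integral_div]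

end

/-! ### From bubbles to admissible parameters -/

noncomputable section

namespace SpaceForm

theorem sine_pos {X : SpaceForm} {s : ℝ} (hs : 0 < s) (hk : 0 < 1 + X.curvature * s ^ 2 / 4) :
    0 < X.sine s := div_pos hs hk

theorem cosine_sq_add {X : SpaceForm} {s : ℝ} (hk : 0 < 1 + X.curvature * s ^ 2 / 4) :
    X.cosine s ^ 2 + X.curvature * X.sine s ^ 2 = 1 := by
  have h : X.curvature * (s / (1 + X.curvature * s ^ 2 / 4)) ^ 2 =
      4 * (X.curvature * s ^ 2 / 4) / (1 + X.curvature * s ^ 2 / 4) ^ 2 := by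
    rw [div_pow]
    ring
  rw [cosine, sine, h]
  generalize X.curvature * s ^ 2 / 4 = k at *
  field_simp
  ring

/-- The first component of the parameter of a bubble. -/
def paramX (X : SpaceForm) (s α : ℝ) : ℝ := X.cosine s / X.sine s * Real.cos α

/-- The second component of the parameter of a bubble. -/
def paramY (X : SpaceForm) (s α : ℝ) : ℝ := X.cosine s / X.sine s * Real.sin α

/-- Since `C² + κ S² = 1`, the sum `κ + (C / S)²` equals `S⁻²`. -/
theorem sine_param {X : SpaceForm} {s : ℝ} (hs : 0 < s)
    (hk : 0 < 1 + X.curvature * s ^ 2 / 4) (α : ℝ) :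
    BubbleParam.sine X.curvature (X.paramX s α) (X.paramY s α) = X.sine s := by
  have hS := X.sine_pos hs hk
  have h : X.curvature + X.paramX s α ^ 2 + X.paramY s α ^ 2 = (X.sine s)⁻¹ ^ 2 := by
    have h1 := X.cosine_sq_add (s := s) hk
    have h2 : X.cosine s ^ 2 = 1 - X.curvature * X.sine s ^ 2 := by linarith
    rw [paramX, paramY]
    calc _ = X.curvature + X.cosine s ^ 2 / X.sine s ^ 2 *
          (Real.sin α ^ 2 + Real.cos α ^ 2) := by ring
      _ = _ := by
        rw [Real.sin_sq_add_cos_sq, h2]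
        field_simp
        ring
  rw [BubbleParam.sine, h, Real.sqrt_sq (by positivity), inv_inv]

theorem capArg_param {X : SpaceForm} {s : ℝ} (hs : 0 < s)
    (hk : 0 < 1 + X.curvature * s ^ 2 / 4) (α φ : ℝ) :
    BubbleParam.capArg X.curvature φ (X.paramX s α) (X.paramY s α) =
      X.cosine s * Real.cos (α + φ) := by
  have hS := X.sine_pos hs hk
  rw [BubbleParam.capArg, X.sine_param hs hk, paramX, paramY, Real.cos_add]
  field_simp

theorem press₁_param (X : SpaceForm) (s α : ℝ) :
    BubbleParam.press₁ (X.paramX s α) (X.paramY s α) =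
      X.cosine s / X.sine s * -Real.sin (α + 2 * Real.pi / 3) := by
  rw [BubbleParam.press₁, paramX, paramY, Real.sin_add, Real.cos_two_pi_div_three,
    Real.sin_two_pi_div_three]
  ring

theorem press₂_param (X : SpaceForm) (s α : ℝ) :
    BubbleParam.press₂ (X.paramX s α) (X.paramY s α) =
      X.cosine s / X.sine s * Real.sin (α - 2 * Real.pi / 3) := by
  rw [BubbleParam.press₂, paramX, paramY, Real.sin_sub, Real.cos_two_pi_div_three,
    Real.sin_two_pi_div_three]
  ring

end SpaceForm

/-- `(q t)² = q² - (q c)² > q² - 1 = (k₀ S)²`. It is used with `c` the cosine and `t` the absolute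
value of the sine of the angle of an outer cap; nonnegativity of `c` turns the one-sided bound `q c
< 1` into one for the square. -/
theorem lt_mul_of_sq {q S k₀ c t : ℝ} (hS : 0 < S) (hq : 0 < q) (hqS : q ^ 2 = 1 + k₀ ^ 2 * S ^ 2)
    (hc : 0 ≤ c) (hqc : q * c < 1) (ht : 0 < t) (hct : c ^ 2 + t ^ 2 = 1) : k₀ < q / S * t := by
  rw [div_mul_eq_mul_div, lt_div_iff₀ hS]
  have h1 : (q * c) ^ 2 < 1 := by
    have := mul_nonneg hq.le hc
    nlinarith
  refine lt_of_pow_lt_pow_left₀ 2 (by positivity) ?_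
  have h2 : (q * t) ^ 2 = q ^ 2 - (q * c) ^ 2 := by
    linear_combination q ^ 2 * hct
  rw [h2, mul_pow]
  linarith

/-- If the caps at angles up to `120°` from the interface are compact, the outer caps have mean
curvature greater than that of a horosphere. -/
theorem lt_press_of_cap_lt {q S k₀ α : ℝ} (hS : 0 < S) (hq : 0 < q)
    (hqS : q ^ 2 = 1 + k₀ ^ 2 * S ^ 2)
    (h : ∀ φ ∈ Icc (-(2 * Real.pi / 3)) (2 * Real.pi / 3),
      Real.cos (α + φ) ≠ 1 ∧ q * Real.cos (α + φ) < 1) :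
    k₀ < q / S * -Real.sin (α + 2 * Real.pi / 3) ∧ k₀ < q / S * Real.sin (α - 2 * Real.pi / 3) := by
  have hpi := Real.pi_pos
  obtain ⟨n, hn⟩ := (existsUnique_sub_zsmul_mem_Ico Real.two_pi_pos α 0).exists
  set α₀ := α - n • (2 * Real.pi) with hα₀
  have hcos : ∀ φ, Real.cos (α + φ) = Real.cos (α₀ + φ) := fun φ => by
    rw [hα₀, zsmul_eq_mul, sub_add_eq_add_sub, Real.cos_sub_int_mul_two_pi]
  have hsin : ∀ φ, Real.sin (α + φ) = Real.sin (α₀ + φ) := fun φ => by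
    rw [hα₀, zsmul_eq_mul, sub_add_eq_add_sub, Real.sin_sub_int_mul_two_pi]
  simp only [hcos] at h
  rw [sub_eq_add_neg, hsin, hsin, ← sub_eq_add_neg]
  rw [zero_add] at hn
  -- The cap at an angle in `2π ℤ` passes through infinity, so no such angle may lie within `2π/3`
  -- of the interface. This confines `α₀` to `(2π/3, 4π/3)` and fixes the signs of the sines of the
  -- outer angles.
  have hlow : 2 * Real.pi / 3 < α₀ := by
    by_contra hle
    exact (h (-α₀) ⟨by linarith, by linarith [hn.1]⟩).1 (by simp)
  have hhigh : α₀ < 4 * Real.pi / 3 := by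
    by_contra hle
    refine (h (2 * Real.pi - α₀) ⟨by linarith [hn.2], by linarith⟩).1 ?_
    rw [add_sub_cancel, Real.cos_two_pi]
  have h1 := (h (2 * Real.pi / 3) ⟨by linarith, le_rfl⟩).2
  have h2 := (h (-(2 * Real.pi / 3)) ⟨le_rfl, by linarith⟩).2
  rw [← sub_eq_add_neg] at h2
  have hs2 : 0 < Real.sin (α₀ - 2 * Real.pi / 3) :=
    Real.sin_pos_of_pos_of_lt_pi (by linarith) (by linarith)
  have hs1 : 0 < -Real.sin (α₀ + 2 * Real.pi / 3) := by
    have : Real.sin (α₀ + 2 * Real.pi / 3) = -Real.sin (α₀ + 2 * Real.pi / 3 - Real.pi) := by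
      rw [Real.sin_sub_pi, neg_neg]
    rw [this, neg_neg]
    exact Real.sin_pos_of_pos_of_lt_pi (by linarith) (by linarith)
  have p1 := Real.sin_sq_add_cos_sq (α₀ + 2 * Real.pi / 3)
  have p2 := Real.sin_sq_add_cos_sq (α₀ - 2 * Real.pi / 3)
  have e3 : α₀ - 2 * Real.pi / 3 = α₀ + 2 * Real.pi / 3 - (Real.pi + Real.pi / 3) := by ring
  have ec : Real.cos (α₀ - 2 * Real.pi / 3) = -(Real.cos (α₀ + 2 * Real.pi / 3) / 2) +
      √3 / 2 * -Real.sin (α₀ + 2 * Real.pi / 3) := by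
    rw [e3, Real.cos_sub, add_comm Real.pi, Real.cos_add_pi, Real.sin_add_pi,
      Real.cos_pi_div_three, Real.sin_pi_div_three]
    ring
  have es : Real.sin (α₀ - 2 * Real.pi / 3) = -Real.sin (α₀ + 2 * Real.pi / 3) / 2 +
      √3 / 2 * Real.cos (α₀ + 2 * Real.pi / 3) := by
    rw [e3, Real.sin_sub, add_comm Real.pi, Real.cos_add_pi, Real.sin_add_pi,
      Real.cos_pi_div_three, Real.sin_pi_div_three]
    ring
  generalize Real.cos (α₀ - 2 * Real.pi / 3) = c₂ at *
  generalize Real.sin (α₀ - 2 * Real.pi / 3) = t₂ at *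
  generalize Real.cos (α₀ + 2 * Real.pi / 3) = c₁ at *
  generalize Real.sin (α₀ + 2 * Real.pi / 3) = t₁ at *
  have h3 := BubbleParam.sq_sqrt_three
  have h3' : 1 < √3 := by
    rw [Real.lt_sqrt zero_le_one]
    norm_num
  have hρ : 0 < q / S := by positivity
  have ec1 : c₁ = -(c₂ / 2) + √3 / 2 * t₂ := by
    rw [ec, es]
    linear_combination -(c₁ / 4) * h3
  have et1 : -t₁ = t₂ / 2 + √3 / 2 * c₂ := by
    rw [ec, es]
    linear_combination (t₁ / 4) * h3
  constructor
  -- If `c₁ < 0`, the previous lemma does not apply to this cap. But then `c₂ > √3 t₂ > 0`, so it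
  -- applies to the other one, whose curvature is the smaller: `-t₁ = t₂ / 2 + √3 / 2 * c₂ ≥ t₂`.
  -- The second half is symmetric.
  · rcases le_or_gt 0 c₁ with hc | hc
    · exact lt_mul_of_sq hS hq hqS hc h1 hs1 (by linarith [neg_sq t₁])
    · have hc2 : √3 * t₂ < c₂ := by linarith
      have hc2' : t₂ < c₂ := by nlinarith
      have := lt_mul_of_sq hS hq hqS (hs2.trans hc2').le h2 hs2 (by linarith)
      refine this.trans_le (mul_le_mul_of_nonneg_left ?_ hρ.le)
      rw [et1]
      nlinarith
  · rcases le_or_gt 0 c₂ with hc | hc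
    · exact lt_mul_of_sq hS hq hqS hc h2 hs2 (by linarith)
    · have hc1 : √3 * -t₁ < c₁ := by linarith
      have hc1' : -t₁ < c₁ := by nlinarith
      have := lt_mul_of_sq hS hq hqS (hs1.trans hc1').le h1 hs1 (by linarith [neg_sq t₁])
      refine this.trans_le (mul_le_mul_of_nonneg_left ?_ hρ.le)
      rw [es]
      nlinarith

/-- The excluded angles are those of the caps through infinity and of the interface, which belongs
to neither open region; inequalities reach them by continuity. -/
theorem Real.dense_cos_ne_one_and_ne (α : ℝ) : Dense {θ : ℝ | Real.cos θ ≠ 1 ∧ θ ≠ α} := by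
  have hcount : ({θ : ℝ | Real.cos θ = 1} ∪ {α}).Countable := by
    refine Countable.union ?_ (countable_singleton α)
    refine (countable_range fun n : ℤ => (n : ℝ) * (2 * Real.pi)).mono fun θ hθ => ?_
    obtain ⟨n, hn⟩ := (Real.cos_eq_one_iff θ).1 hθ
    exact ⟨n, hn⟩
  convert hcount.dense_compl ℝ using 1
  ext θ
  simp [and_comm]

namespace StandardDoubleBubble

variable {m : ℕ} [NeZero (m + 1)] {X : SpaceForm}

/-- A relatively compact double bubble meets the axis within a compact subset of the model. -/
theorem exists_axis_bound (hX : X ≠ SpaceForm.spherical) (B : StandardDoubleBubble X (m + 1)) :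
    ∃ R ε : ℝ, 0 < ε ∧ ∀ φ ∈ Icc (-(2 * Real.pi / 3)) (2 * Real.pi / 3),
      B.s ^ 2 * (1 + Real.cos (B.α + φ)) ≤ R ^ 2 * (1 - Real.cos (B.α + φ)) ∧
      ε * (1 - Real.cos (B.α + φ)) ≤ (1 - Real.cos (B.α + φ)) +
        X.curvature * B.s ^ 2 / 4 * (1 + Real.cos (B.α + φ)) := by
  have hpi := Real.pi_pos
  have hs := B.s_pos
  obtain ⟨K, hK, hKd, hsub⟩ := B.enclosed hX
  obtain ⟨R, hR⟩ := hK.exists_bound_of_continuousOn (f := fun x => x) continuousOn_id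
  obtain ⟨ε, hε, hεK⟩ : ∃ ε : ℝ, 0 < ε ∧ ∀ x ∈ K, ε ≤ 1 + X.curvature * ‖x‖ ^ 2 / 4 := by
    rcases K.eq_empty_or_nonempty with rfl | hne
    · exact ⟨1, one_pos, fun x hx => absurd hx (notMem_empty x)⟩
    · obtain ⟨x, hx, hmin⟩ := hK.exists_isMinOn hne
        (f := fun x => 1 + X.curvature * ‖x‖ ^ 2 / 4) (by fun_prop)
      exact ⟨_, hKd hx, fun y hy => hmin hy⟩
  refine ⟨R, ε, hε, ?_⟩
  -- The bounds are multiplied by `1 - cos θ`, which makes them closed conditions that still make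
  -- sense at `cos θ = 1`. There the first one is false, and this later rules out caps through
  -- infinity.
  let F : Set ℝ := {θ | B.s ^ 2 * (1 + Real.cos θ) ≤ R ^ 2 * (1 - Real.cos θ) ∧
      ε * (1 - Real.cos θ) ≤ (1 - Real.cos θ) + X.curvature * B.s ^ 2 / 4 * (1 + Real.cos θ)}
  have hF : IsClosed F := by
    have h1 : IsClosed {θ : ℝ | B.s ^ 2 * (1 + Real.cos θ) ≤ R ^ 2 * (1 - Real.cos θ)} :=
      isClosed_le (by fun_prop) (by fun_prop)
    have h2 : IsClosed {θ : ℝ | ε * (1 - Real.cos θ) ≤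
        (1 - Real.cos θ) + X.curvature * B.s ^ 2 / 4 * (1 + Real.cos θ)} :=
      isClosed_le (by fun_prop) (by fun_prop)
    exact h1.inter h2
  have hin : Ioo (B.α - 2 * Real.pi / 3) (B.α + 2 * Real.pi / 3) ∩
      {θ : ℝ | Real.cos θ ≠ 1 ∧ θ ≠ B.α} ⊆ F := by
    rintro θ ⟨⟨h1, h2⟩, h3, h4⟩
    have hc : 0 < 1 - Real.cos θ := sub_pos.2 (lt_of_le_of_ne (Real.cos_le_one θ) h3)
    -- The point where the cap at angle `θ` meets the axis.
    set a := B.s * Real.sin θ / (1 - Real.cos θ) with ha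
    have ha2 : a ^ 2 * (1 - Real.cos θ) = B.s ^ 2 * (1 + Real.cos θ) := by
      have := Real.sin_sq_add_cos_sq θ
      have hsn : Real.sin θ ^ 2 = (1 - Real.cos θ) * (1 + Real.cos θ) := by linarith
      rw [ha, div_pow, mul_pow, hsn]
      field_simp
    have hn : ‖joinCoord a (0 : EuclideanSpace ℝ (Fin m))‖ ^ 2 = a ^ 2 := by
      rw [norm_joinCoord_sq]
      simp
    have hb : bipolar B.s (joinCoord a (0 : EuclideanSpace ℝ (Fin m))) =
        (2 * B.s ^ 2 / (1 - Real.cos θ) : ℝ) * Complex.exp (θ * Complex.I) := by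
      rw [bipolar_eq_iff, hn, joinCoord_apply_zero]
      constructor
      · field_simp
        linear_combination ha2
      · rw [ha]
        ring
    have hxK : joinCoord a (0 : EuclideanSpace ℝ (Fin m)) ∈ K := by
      refine hsub ?_
      have hr : 0 < 2 * B.s ^ 2 / (1 - Real.cos θ) := by positivity
      rcases lt_or_gt_of_ne h4 with h | h
      · exact Or.inr ⟨_, θ, hr, h1, h, hb⟩
      · exact Or.inl ⟨_, θ, hr, h, h2, hb⟩
    have hR1 := hR _ hxK
    have hε1 := hεK _ hxK
    rw [hn] at hε1
    have hR2 : a ^ 2 ≤ R ^ 2 := by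
      rw [← hn]
      exact pow_le_pow_left₀ (norm_nonneg _) hR1 2
    constructor
    · rw [← ha2]
      exact mul_le_mul_of_nonneg_right hR2 hc.le
    · have := mul_le_mul_of_nonneg_right hε1 hc.le
      refine this.trans_eq ?_
      linear_combination X.curvature / 4 * ha2
  have hcl := (closure_minimal hin hF)
  have hIcc : Icc (B.α - 2 * Real.pi / 3) (B.α + 2 * Real.pi / 3) ⊆ F := by
    rw [← closure_Ioo (by linarith)]
    refine closure_minimal ?_ hF
    exact ((Real.dense_cos_ne_one_and_ne B.α).open_subset_closure_inter isOpen_Ioo).trans hcl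
  intro φ hφ
  exact hIcc ⟨by linarith [hφ.1], by linarith [hφ.2]⟩

/-- For the sphere both claims are immediate. Otherwise the axis bound excludes `cos (α + φ) = 1`
and gives `(1 - k) cos (α + φ) < 1 + k`, that is, `X.cosine s * cos (α + φ) < 1` once `1 + k > 0`;
then `lt_press_of_cap_lt` applies. -/
theorem curvature_factor_pos_and_admissible (B : StandardDoubleBubble X (m + 1)) :
    0 < 1 + X.curvature * B.s ^ 2 / 4 ∧
      BubbleParam.Admissible X.curvature (X.paramX B.s B.α) (X.paramY B.s B.α) := by
  have hpi := Real.pi_pos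
  have hs := B.s_pos
  by_cases hX : X = SpaceForm.spherical
  · subst hX
    simp only [SpaceForm.curvature]
    exact ⟨by positivity, fun h => absurd h (by norm_num)⟩
  have hκ : X.curvature ≤ 0 := by
    cases X
    · exact le_rfl
    · simp [SpaceForm.curvature]
    · exact absurd rfl hX
  obtain ⟨R, ε, hε, hb⟩ := B.exists_axis_bound hX
  set k := X.curvature * B.s ^ 2 / 4 with hk
  have hk0 : k ≤ 0 := by
    have := mul_nonneg (neg_nonneg.2 hκ) (sq_nonneg B.s)
    linarith
  have hcone : ∀ φ ∈ Icc (-(2 * Real.pi / 3)) (2 * Real.pi / 3),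
      Real.cos (B.α + φ) ≠ 1 ∧ 0 < (1 + k) - (1 - k) * Real.cos (B.α + φ) := by
    intro φ hφ
    obtain ⟨h1, h2⟩ := hb φ hφ
    have hne : Real.cos (B.α + φ) ≠ 1 := fun h => by
      rw [h] at h1
      nlinarith
    have := mul_pos hε (sub_pos.2 (lt_of_le_of_ne (Real.cos_le_one (B.α + φ)) hne))
    exact ⟨hne, by linarith⟩
  -- One of the caps perpendicular to the interface has an angle with nonnegative cosine, and there
  -- the inequality forces `1 + k > 0`.
  have hkpos : 0 < 1 + k := by
    rcases le_total 0 (Real.sin B.α) with h | h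
    · have := (hcone (-(Real.pi / 2)) ⟨by linarith, by linarith⟩).2
      rw [← sub_eq_add_neg, Real.cos_sub_pi_div_two] at this
      nlinarith [mul_nonneg (show 0 ≤ 1 - k by linarith) h]
    · have := (hcone (Real.pi / 2) ⟨by linarith, by linarith⟩).2
      rw [Real.cos_add_pi_div_two] at this
      nlinarith [mul_nonneg (show 0 ≤ 1 - k by linarith) (neg_nonneg.2 h)]
  refine ⟨hkpos, fun _ => ?_⟩
  rw [SpaceForm.press₁_param, SpaceForm.press₂_param]
  have hqdef : X.cosine B.s = (1 - k) / (1 + k) := rfl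
  refine lt_press_of_cap_lt (X.sine_pos hs hkpos) ?_ ?_ fun φ hφ => ?_
  · rw [hqdef]
    exact div_pos (by linarith) hkpos
  · rw [Real.sq_sqrt (neg_nonneg.2 hκ)]
    linarith [X.cosine_sq_add hkpos]
  · obtain ⟨h1, h2⟩ := hcone φ hφ
    refine ⟨h1, ?_⟩
    rw [hqdef, div_mul_eq_mul_div, div_lt_one hkpos]
    linarith

theorem curvature_factor_pos (B : StandardDoubleBubble X (m + 1)) :
    0 < 1 + X.curvature * B.s ^ 2 / 4 := B.curvature_factor_pos_and_admissible.1

theorem admissible (B : StandardDoubleBubble X (m + 1)) :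
    BubbleParam.Admissible X.curvature (X.paramX B.s B.α) (X.paramY B.s B.α) :=
  B.curvature_factor_pos_and_admissible.2

theorem cosine_mul_lt (B : StandardDoubleBubble X (m + 1)) :
    ∀ φ ∈ Icc (-(2 * Real.pi / 3)) (2 * Real.pi / 3),
      X.cosine B.s * Real.cos (B.α + φ) < 1 := fun φ hφ => by
  rw [← X.capArg_param B.s_pos B.curvature_factor_pos]
  exact B.admissible.capArg_lt_one hφ.1 hφ.2

/-- The area of a standard double bubble in terms of its parameter. -/
theorem area_eq (hm : 1 ≤ m) (B : StandardDoubleBubble X (m + 1)) :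
    X.area B.surface = sphereConst m *
      BubbleParam.totalArea m X.curvature (X.paramX B.s B.α) (X.paramY B.s B.α) := by
  rw [area_surface hm B B.curvature_factor_pos B.cosine_mul_lt, BubbleParam.totalArea,
    BubbleParam.capArea, BubbleParam.capArea, BubbleParam.capArea,
    X.sine_param B.s_pos B.curvature_factor_pos, X.capArg_param B.s_pos B.curvature_factor_pos,
    X.capArg_param B.s_pos B.curvature_factor_pos, X.capArg_param B.s_pos B.curvature_factor_pos,
    add_zero, ← sub_eq_add_neg]
  ring

theorem vol_sector (hm : 1 ≤ m) (B : StandardDoubleBubble X (m + 1)) {a b : ℝ}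
    (ha : -(2 * Real.pi / 3) ≤ a) (hab : a ≤ b) (hb : b ≤ 2 * Real.pi / 3) :
    X.vol (betweenCaps B.s (B.α + a) (B.α + b) : Set (EuclideanSpace ℝ (Fin (m + 1)))) =
      ENNReal.ofReal (sphereConst m *
        BubbleParam.sectorVol m X.curvature a b (X.paramX B.s B.α) (X.paramY B.s B.α)) := by
  have hpi := Real.pi_pos
  rw [vol_betweenCaps hm B.s_pos B.curvature_factor_pos (by linarith) (by linarith)
    fun θ hθ => by
      have := B.cosine_mul_lt (θ - B.α) ⟨by linarith [hθ.1], by linarith [hθ.2]⟩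
      rwa [add_sub_cancel] at this]
  rw [← intervalIntegral.integral_comp_add_left (fun θ =>
    X.sine B.s ^ (m + 1) * capProfile' m (X.cosine B.s * Real.cos θ)) B.α]
  simp only [BubbleParam.sectorVol, X.sine_param B.s_pos B.curvature_factor_pos,
    X.capArg_param B.s_pos B.curvature_factor_pos]

theorem vol_region₁ (hm : 1 ≤ m) (B : StandardDoubleBubble X (m + 1)) :
    X.vol B.region₁ = ENNReal.ofReal (sphereConst m *
      BubbleParam.vol₁ m X.curvature (X.paramX B.s B.α) (X.paramY B.s B.α)) := by
  have := B.vol_sector hm (a := 0) (b := 2 * Real.pi / 3) (by linarith [Real.pi_pos])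
    (by linarith [Real.pi_pos]) le_rfl
  rwa [add_zero] at this

theorem vol_region₂ (hm : 1 ≤ m) (B : StandardDoubleBubble X (m + 1)) :
    X.vol B.region₂ = ENNReal.ofReal (sphereConst m *
      BubbleParam.vol₂ m X.curvature (X.paramX B.s B.α) (X.paramY B.s B.α)) := by
  have := B.vol_sector hm (a := -(2 * Real.pi / 3)) (b := 0) le_rfl
    (by linarith [Real.pi_pos]) (by linarith [Real.pi_pos])
  rwa [add_zero, ← sub_eq_add_neg] at this

end StandardDoubleBubble

end

/-! ### Balls and the isoperimetric profile -/

noncomputable section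

open scoped ENNReal Pointwise

theorem one_add_mul_sq_pos {κ r t : ℝ} (hr : 0 ≤ r) (hrt : r ≤ t) (ht : 0 < 1 + κ * t ^ 2 / 4) :
    0 < 1 + κ * r ^ 2 / 4 := by
  rcases le_or_gt 0 κ with h | h
  · positivity
  · have := mul_le_mul_of_nonpos_left (pow_le_pow_left₀ hr hrt 2) h.le
    linarith

/-- The volume of the ball of radius `t` in the conformal model. -/
def ballVol (n : ℕ) (κ t : ℝ) : ℝ :=
  sphereConst n * ∫ r in (0 : ℝ)..t, r ^ (n - 1) * (1 + κ * r ^ 2 / 4)⁻¹ ^ n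

section Ball

variable {n : ℕ} {X : SpaceForm} {κ t t' : ℝ}

theorem ballVol_zero (n : ℕ) (κ : ℝ) : ballVol n κ 0 = 0 := by simp [ballVol]

theorem continuousOn_ballVol_integrand (ht : 0 < 1 + κ * t ^ 2 / 4) :
    ContinuousOn (fun r : ℝ => r ^ (n - 1) * (1 + κ * r ^ 2 / 4)⁻¹ ^ n) (Icc 0 t) := by
  refine ContinuousOn.mul (by fun_prop) (ContinuousOn.pow (ContinuousOn.inv₀ (by fun_prop)
    fun r hr => (one_add_mul_sq_pos hr.1 hr.2 ht).ne') n)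

theorem vol_ball (hn : 1 ≤ n) (ht0 : 0 ≤ t) (ht : 0 < 1 + X.curvature * t ^ 2 / 4) :
    X.vol (Metric.ball (0 : EuclideanSpace ℝ (Fin n)) t) =
      ENNReal.ofReal (ballVol n X.curvature t) := by
  have hsub : Metric.ball (0 : EuclideanSpace ℝ (Fin n)) t ⊆ X.domain n := fun x hx =>
    one_add_mul_sq_pos (norm_nonneg x) (by simpa using (mem_ball_zero_iff.1 hx).le) ht
  rw [SpaceForm.vol, inter_eq_left.2 hsub, ballVol]
  refine setLIntegral_ball_fun_norm hn ht0 (g := fun r => (1 + X.curvature * r ^ 2 / 4)⁻¹ ^ n)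
    (by fun_prop) (fun r hr => ?_) ?_
  · have := one_add_mul_sq_pos hr.1.le hr.2.le ht
    positivity
  · refine ContinuousOn.intervalIntegrable ?_
    rw [uIcc_of_le ht0]
    exact continuousOn_ballVol_integrand ht

theorem hasDerivAt_ballVol (ht0 : 0 < t) (ht : 0 < 1 + κ * t ^ 2 / 4) :
    HasDerivAt (ballVol n κ) (sphereConst n * (t ^ (n - 1) * (1 + κ * t ^ 2 / 4)⁻¹ ^ n)) t := by
  have hm : StronglyMeasurable fun r : ℝ => r ^ (n - 1) * (1 + κ * r ^ 2 / 4)⁻¹ ^ n :=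
    Measurable.stronglyMeasurable (by fun_prop)
  refine (intervalIntegral.integral_hasDerivAt_right ?_
    (hm.stronglyMeasurableAtFilter) ?_).const_mul (sphereConst n)
  · refine ContinuousOn.intervalIntegrable ?_
    rw [uIcc_of_le ht0.le]
    exact continuousOn_ballVol_integrand ht
  · have hc : ContinuousAt (fun r : ℝ => 1 + κ * r ^ 2 / 4) t := by fun_prop
    exact (continuousAt_id.pow (n - 1)).mul ((hc.inv₀ ht.ne').pow n)

theorem continuousOn_ballVol (ht0 : 0 ≤ t) (ht : 0 < 1 + κ * t ^ 2 / 4) :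
    ContinuousOn (ballVol n κ) (Icc 0 t) := by
  refine ContinuousOn.mul continuousOn_const ?_
  have := intervalIntegral.continuousOn_primitive_interval (μ := volume)
    (f := fun r : ℝ => r ^ (n - 1) * (1 + κ * r ^ 2 / 4)⁻¹ ^ n) (a := 0) (b := t) ?_
  · rwa [uIcc_of_le ht0] at this
  · rw [uIcc_of_le ht0]
    exact (continuousOn_ballVol_integrand ht).integrableOn_Icc

theorem strictMonoOn_ballVol (hn : 1 ≤ n) (ht0 : 0 ≤ t) (ht : 0 < 1 + κ * t ^ 2 / 4) :
    StrictMonoOn (ballVol n κ) (Icc 0 t) := by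
  refine strictMonoOn_of_deriv_pos (convex_Icc 0 t) (continuousOn_ballVol ht0 ht) fun r hr => ?_
  rw [interior_Icc] at hr
  have h := one_add_mul_sq_pos hr.1.le hr.2.le ht
  rw [(hasDerivAt_ballVol hr.1 h).deriv]
  have := sphereConst_pos hn
  have := hr.1
  positivity

theorem ballVol_lt_iff (hn : 1 ≤ n) (h0 : 0 ≤ t) (h0' : 0 ≤ t') (ht : 0 < 1 + κ * t ^ 2 / 4)
    (ht' : 0 < 1 + κ * t' ^ 2 / 4) : ballVol n κ t < ballVol n κ t' ↔ t < t' := by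
  have key : ∀ u, 0 ≤ u → 0 < 1 + κ * u ^ 2 / 4 → t ≤ u → t' ≤ u →
      (ballVol n κ t < ballVol n κ t' ↔ t < t') := fun u hu0 hu h h' =>
    (strictMonoOn_ballVol hn hu0 hu).lt_iff_lt ⟨h0, h⟩ ⟨h0', h'⟩
  rcases le_total t t' with h | h
  · exact key t' h0' ht' h le_rfl
  · exact key t h0 ht le_rfl h

/-- The boundary area of the ball of radius `t` in the conformal model. -/
theorem area_sphere (ht0 : 0 < t) (ht : 0 < 1 + X.curvature * t ^ 2 / 4) :
    X.area (Metric.sphere (0 : EuclideanSpace ℝ (Fin n)) t) =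
      (μHE[n - 1] (Metric.sphere (0 : EuclideanSpace ℝ (Fin n)) 1)).toReal *
        (t / (1 + X.curvature * t ^ 2 / 4)) ^ (n - 1) := by
  have hsub : Metric.sphere (0 : EuclideanSpace ℝ (Fin n)) t ⊆ X.domain n := fun x hx =>
    one_add_mul_sq_pos (norm_nonneg x) (by simpa using (mem_sphere_zero_iff_norm.1 hx).le) ht
  have hsm : Metric.sphere (0 : EuclideanSpace ℝ (Fin n)) t = 
      t • Metric.sphere (0 : EuclideanSpace ℝ (Fin n)) 1 := by
    rw [smul_sphere' ht0.ne', smul_zero, mul_one, Real.norm_of_nonneg ht0.le]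
  unfold SpaceForm.area
  rw [inter_eq_left.2 hsub]
  have hc : ∫⁻ x in Metric.sphere (0 : EuclideanSpace ℝ (Fin n)) t,
      ENNReal.ofReal (X.density x ^ (n - 1)) ∂μHE[n - 1] =
      ∫⁻ x in Metric.sphere (0 : EuclideanSpace ℝ (Fin n)) t,
        ENNReal.ofReal ((1 + X.curvature * t ^ 2 / 4)⁻¹ ^ (n - 1)) ∂μHE[n - 1] := by
    refine setLIntegral_congr_fun Metric.isClosed_sphere.measurableSet fun x hx => ?_
    rw [SpaceForm.density, mem_sphere_zero_iff_norm.1 hx]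
  rw [hc, setLIntegral_const, hsm, Measure.euclideanHausdorffMeasure_smul₀ _ ht0.ne',
    ENNReal.toReal_mul, ENNReal.toReal_ofReal (by positivity), ENNReal.smul_def, smul_eq_mul,
    ENNReal.toReal_mul, ENNReal.coe_toReal, NNReal.coe_pow, coe_nnnorm,
    Real.norm_of_nonneg ht0.le, div_eq_mul_inv t, mul_pow]
  ring

theorem closedBall_subset_domain_iff (hn : 1 ≤ n) (ht0 : 0 < t) :
    Metric.closedBall (0 : EuclideanSpace ℝ (Fin n)) t ⊆ X.domain n ↔
      0 < 1 + X.curvature * t ^ 2 / 4 := by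
  constructor
  · intro h
    have hx : EuclideanSpace.single (⟨0, hn⟩ : Fin n) t ∈
        Metric.closedBall (0 : EuclideanSpace ℝ (Fin n)) t := by
      simp [abs_of_pos ht0]
    have h2 := h hx
    simp only [SpaceForm.domain, mem_ofPred_eq, PiLp.norm_single, Real.norm_eq_abs,
      sq_abs] at h2
    exact h2
  · intro ht x hx
    exact one_add_mul_sq_pos (norm_nonneg x) (by simpa using hx) ht

theorem eq_of_ofReal_eq_ofReal {a b : ℝ} (hb : 0 < b) (h : ENNReal.ofReal a = ENNReal.ofReal b) :
    a = b := by
  have ha : 0 < a := ENNReal.ofReal_pos.1 (h ▸ ENNReal.ofReal_pos.2 hb)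
  exact (ENNReal.ofReal_eq_ofReal_iff ha.le hb.le).1 h

/-- The isoperimetric profile in terms of the radius of the ball. -/
theorem ballArea_ballVol (hn : 1 ≤ n) (ht0 : 0 < t) (ht : 0 < 1 + X.curvature * t ^ 2 / 4) :
    X.ballArea n (ballVol n X.curvature t) =
      (μHE[n - 1] (Metric.sphere (0 : EuclideanSpace ℝ (Fin n)) 1)).toReal *
        (t / (1 + X.curvature * t ^ 2 / 4)) ^ (n - 1) := by
  have hpos : 0 < ballVol n X.curvature t := by
    have := (ballVol_lt_iff hn le_rfl ht0.le (κ := X.curvature) (by simp) ht).2 ht0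
    rwa [ballVol_zero] at this
  rw [← area_sphere ht0 ht, SpaceForm.ballArea]
  have hset : {a : ℝ | ∃ t' : ℝ, 0 < t' ∧
      Metric.closedBall (0 : EuclideanSpace ℝ (Fin n)) t' ⊆ X.domain n ∧
      X.vol (Metric.ball (0 : EuclideanSpace ℝ (Fin n)) t') =
        ENNReal.ofReal (ballVol n X.curvature t) ∧
      a = X.area (Metric.sphere (0 : EuclideanSpace ℝ (Fin n)) t')} =
      {X.area (Metric.sphere (0 : EuclideanSpace ℝ (Fin n)) t)} := by
    ext a
    simp only [mem_ofPred_eq, mem_singleton_iff]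
    constructor
    · rintro ⟨t', ht0', hsub, hvol, rfl⟩
      rw [closedBall_subset_domain_iff hn ht0'] at hsub
      rw [vol_ball hn ht0'.le hsub] at hvol
      have heq := eq_of_ofReal_eq_ofReal hpos hvol
      rcases lt_trichotomy t' t with h | h | h
      · exact absurd heq ((ballVol_lt_iff hn ht0'.le ht0.le hsub ht).2 h).ne
      · rw [h]
      · exact absurd heq ((ballVol_lt_iff hn ht0.le ht0'.le ht hsub).2 h).ne'
    · rintro rfl
      exact ⟨t, ht0, (closedBall_subset_domain_iff hn ht0).2 ht, vol_ball hn ht0.le ht, rfl⟩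
  rw [hset, csInf_singleton]

/-- The boundary area as a function of the radius increases at the rate of the mean curvature times
the rate of the volume. -/
theorem exists_slope_eq (hn : 2 ≤ n) {c a b : ℝ} (ha : 0 < a) (hab : a < b)
    (hb : 0 < 1 + κ * b ^ 2 / 4) :
    ∃ ξ ∈ Ioo a b, c * (b / (1 + κ * b ^ 2 / 4)) ^ (n - 1) -
      c * (a / (1 + κ * a ^ 2 / 4)) ^ (n - 1) =
      c * (n - 1 : ℕ) / sphereConst n * ((1 - κ * ξ ^ 2 / 4) / ξ) *
        (ballVol n κ b - ballVol n κ a) := by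
  have hpos : ∀ r ∈ Icc a b, 0 < 1 + κ * r ^ 2 / 4 := fun r hr =>
    one_add_mul_sq_pos (ha.le.trans hr.1) hr.2 hb
  have hσ := sphereConst_pos (m := n) (by omega)
  have hder : ∀ r ∈ Icc a b, HasDerivAt (fun r => c * (r / (1 + κ * r ^ 2 / 4)) ^ (n - 1))
      (c * (n - 1 : ℕ) / sphereConst n * ((1 - κ * r ^ 2 / 4) / r) *
        (sphereConst n * (r ^ (n - 1) * (1 + κ * r ^ 2 / 4)⁻¹ ^ n))) r := by
    intro r hr
    have hr0 : 0 < r := ha.trans_le hr.1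
    have hD := hpos r hr
    have h1 : HasDerivAt (fun r : ℝ => 1 + κ * r ^ 2 / 4) (κ * (2 * r) / 4) r := by
      simpa using (((hasDerivAt_pow 2 r).const_mul κ).div_const 4).const_add 1
    refine ((((hasDerivAt_id r).fun_div h1 hD.ne').fun_pow (n - 1)).const_mul c).congr_deriv ?_
    obtain ⟨j, rfl⟩ : ∃ j, n = j + 2 := ⟨n - 2, by omega⟩
    simp only [id, show j + 2 - 1 = j + 1 by omega, Nat.add_sub_cancel, div_pow, inv_pow]
    have e : 1 * (1 + κ * r ^ 2 / 4) - r * (κ * (2 * r) / 4) = 1 - κ * r ^ 2 / 4 := by ring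
    rw [e]
    generalize 1 + κ * r ^ 2 / 4 = D at *
    generalize 1 - κ * r ^ 2 / 4 = E at *
    field_simp
    ring
  -- Cauchy's mean value theorem for area against volume. The ratio of the derivatives is a multiple
  -- of `(1 - κ ξ² / 4) / ξ`, the geodesic cotangent of the radius. The value of `c` is immaterial:
  -- only its sign matters later, so the Hausdorff area of the unit sphere need not be computed.
  obtain ⟨ξ, hξ, h⟩ := exists_ratio_hasDerivAt_eq_ratio_slope (ballVol n κ) _ hab
    (fun r hr => (hasDerivAt_ballVol (ha.trans_le hr.1) (hpos r hr)).continuousAt.continuousWithinAt)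
    (fun r hr => hasDerivAt_ballVol (ha.trans hr.1) (hpos r (Ioo_subset_Icc_self hr)))
    (fun r => c * (r / (1 + κ * r ^ 2 / 4)) ^ (n - 1)) _
    (fun r hr => (hder r hr).continuousAt.continuousWithinAt)
    (fun r hr => hder r (Ioo_subset_Icc_self hr))
  refine ⟨ξ, hξ, ?_⟩
  have hξ0 : 0 < ξ := ha.trans hξ.1
  have hD := hpos ξ (Ioo_subset_Icc_self hξ)
  have hV : 0 < sphereConst n * (ξ ^ (n - 1) * (1 + κ * ξ ^ 2 / 4)⁻¹ ^ n) := by positivity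
  refine mul_right_cancel₀ hV.ne' ?_
  linear_combination h

/-- Concavity of the isoperimetric profile, for two intervals of volumes. -/
theorem slope_le (hn : 2 ≤ n) {c r₁ r₂ r₃ r₄ δ : ℝ} (hc : 0 ≤ c) (h0 : 0 < r₁) (h12 : r₁ < r₂)
    (h23 : r₂ ≤ r₃) (h34 : r₃ < r₄) (h4 : 0 < 1 + κ * r₄ ^ 2 / 4) (hδ : 0 < δ)
    (hv1 : ballVol n κ r₂ - ballVol n κ r₁ = δ / 2) (hv2 : ballVol n κ r₄ - ballVol n κ r₃ = δ) :
    c * (r₄ / (1 + κ * r₄ ^ 2 / 4)) ^ (n - 1) - c * (r₃ / (1 + κ * r₃ ^ 2 / 4)) ^ (n - 1) ≤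
    2 * (c * (r₂ / (1 + κ * r₂ ^ 2 / 4)) ^ (n - 1) -
      c * (r₁ / (1 + κ * r₁ ^ 2 / 4)) ^ (n - 1)) := by
  have h2 := one_add_mul_sq_pos (h0.trans h12).le (h23.trans h34.le) h4
  obtain ⟨ξ, hξ, e1⟩ := exists_slope_eq hn (c := c) h0 h12 h2
  obtain ⟨η, hη, e2⟩ := exists_slope_eq hn (c := c) (h0.trans (h12.trans_le h23)) h34 h4
  rw [e1, e2, hv1, hv2]
  have hξ0 : 0 < ξ := h0.trans hξ.1
  have hξη : ξ < η := (hξ.2.trans_le h23).trans hη.1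
  have hη0 : 0 < η := hξ0.trans hξη
  have hηκ := one_add_mul_sq_pos hη0.le hη.2.le h4
  -- Mean curvature decreases with the radius: after cross-multiplication the difference is `(η - ξ)
  -- (1 + κ ξ η / 4)`.
  have hH : (1 - κ * η ^ 2 / 4) / η ≤ (1 - κ * ξ ^ 2 / 4) / ξ := by
    rw [div_le_div_iff₀ hη0 hξ0]
    have : 0 < 1 + κ * (ξ * η) / 4 := by
      rcases le_or_gt 0 κ with h | h
      · positivity
      · nlinarith [mul_pos hη0 (sub_pos.2 hξη)]
    nlinarith [mul_pos (sub_pos.2 hξη) this]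
  have hK : 0 ≤ c * (n - 1 : ℕ) / sphereConst n :=
    div_nonneg (by positivity) (sphereConst_pos (by omega)).le
  have := mul_le_mul_of_nonneg_left hH hK
  nlinarith

end Ball

end

/-! ### Existence of balls and symmetric bubbles of prescribed volume -/

noncomputable section

open scoped ENNReal

namespace SpaceForm

variable {n : ℕ} {X : SpaceForm}

theorem vol_mono {E F : Set (EuclideanSpace ℝ (Fin n))} (h : E ⊆ F) : X.vol E ≤ X.vol F :=
  lintegral_mono_set (inter_subset_inter_left _ h)

theorem vol_union_le (E F : Set (EuclideanSpace ℝ (Fin n))) :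
    X.vol (E ∪ F) ≤ X.vol E + X.vol F := by
  rw [vol, union_inter_distrib_right]
  exact lintegral_union_le _ _ _

theorem vol_eq_zero {E : Set (EuclideanSpace ℝ (Fin n))} (h : volume E = 0) : X.vol E = 0 :=
  setLIntegral_measure_zero _ _ (measure_mono_null inter_subset_left h)

theorem vol_eq_withDensity {E : Set (EuclideanSpace ℝ (Fin n))} (hE : MeasurableSet E) :
    X.vol E = (volume.restrict (X.domain n)).withDensity
      (fun x => ENNReal.ofReal (X.density x ^ n)) E := by
  rw [withDensity_apply _ hE, Measure.restrict_restrict hE, vol]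

theorem exists_lt_vol_ball {c : ℝ≥0∞}
    (h : c < X.vol (univ : Set (EuclideanSpace ℝ (Fin n)))) :
    ∃ t : ℝ, 0 < t ∧ c < X.vol (Metric.ball (0 : EuclideanSpace ℝ (Fin n)) t) := by
  rw [vol_eq_withDensity MeasurableSet.univ, ← Metric.iUnion_ball_nat 0] at h
  have hmono : Monotone fun k : ℕ => Metric.ball (0 : EuclideanSpace ℝ (Fin n)) k :=
    fun i j hij => Metric.ball_subset_ball (by exact_mod_cast hij)
  obtain ⟨k, hk, hk0⟩ := (((tendsto_measure_iUnion_atTop hmono).eventually_const_lt h).and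
    (Filter.eventually_gt_atTop 0)).exists
  refine ⟨k, by exact_mod_cast hk0, ?_⟩
  rwa [vol_eq_withDensity Metric.isOpen_ball.measurableSet]

theorem vol_univ_euclidean (hn : 1 ≤ n) :
    euclidean.vol (univ : Set (EuclideanSpace ℝ (Fin n))) = ∞ := by
  have : Nonempty (Fin n) := ⟨⟨0, hn⟩⟩
  have h : (univ : Set (EuclideanSpace ℝ (Fin n))) ∩ euclidean.domain n = univ := by
    ext x
    simp [domain, curvature]
  rw [vol, h]
  simp [density, curvature, measure_univ_of_isAddLeftInvariant]

theorem curvature_nonneg (hX : X ≠ hyperbolic) : 0 ≤ X.curvature := by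
  cases X
  · exact le_rfl
  · exact absurd rfl hX
  · exact zero_le_one

end SpaceForm

theorem volume_apply_zero_eq_zero {m : ℕ} :
    volume {x : EuclideanSpace ℝ (Fin (m + 1)) | x 0 = 0} = 0 := by
  refine Measure.addHaar_submodule volume
    (LinearMap.ker (EuclideanSpace.proj (0 : Fin (m + 1)) :
      EuclideanSpace ℝ (Fin (m + 1)) →L[ℝ] ℝ).toLinearMap) fun h => ?_
  have : EuclideanSpace.single (0 : Fin (m + 1)) (1 : ℝ) ∈ LinearMap.ker
      (EuclideanSpace.proj (0 : Fin (m + 1)) :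
        EuclideanSpace ℝ (Fin (m + 1)) →L[ℝ] ℝ).toLinearMap := by
    rw [h]
    trivial
  simp at this

section Symmetric

variable {m : ℕ} {X : SpaceForm} {s M : ℝ}

/-- Angles within `2π/3` of `π` have cosine at most `1/2`, and the modulus of `bipolar s x` is at
most `‖x‖² + s²`. Hence `‖x‖² - s² ≤ (‖x‖² + s²) / 2`. -/
theorem norm_le_of_mem_betweenCaps_pi (hs : 0 < s) {x : EuclideanSpace ℝ (Fin (m + 1))}
    (hx : x ∈ betweenCaps s Real.pi (Real.pi + 2 * Real.pi / 3) ∪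
      betweenCaps s (Real.pi - 2 * Real.pi / 3) Real.pi) : ‖x‖ ≤ √3 * s := by
  have hpi := Real.pi_pos
  obtain ⟨r, θ, hr, h1, h2, hb⟩ : ∃ r θ : ℝ, 0 < r ∧ Real.pi - 2 * Real.pi / 3 < θ ∧
      θ < Real.pi + 2 * Real.pi / 3 ∧ bipolar s x = r * Complex.exp (θ * Complex.I) := by
    rcases hx with ⟨r, θ, hr, h1, h2, hb⟩ | ⟨r, θ, hr, h1, h2, hb⟩
    · exact ⟨r, θ, hr, by linarith, h2, hb⟩
    · exact ⟨r, θ, hr, h1, by linarith, hb⟩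
  rw [bipolar_eq_iff] at hb
  have hcos : Real.cos θ ≤ 1 / 2 := by
    have h3 : -(1 / 2) ≤ Real.cos (θ - Real.pi) := by
      rw [← Real.cos_two_pi_div_three, ← Real.cos_abs (θ - Real.pi)]
      exact Real.cos_le_cos_of_nonneg_of_le_pi (abs_nonneg _) (by linarith)
        (abs_le.2 ⟨by linarith, by linarith⟩)
    rw [Real.cos_sub_pi] at h3
    linarith
  have hx0 : x 0 ^ 2 ≤ ‖x‖ ^ 2 := by
    rw [EuclideanSpace.real_norm_sq_eq]
    exact Finset.single_le_sum (f := fun i => x i ^ 2) (fun i _ => sq_nonneg _) (Finset.mem_univ 0)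
  have hr2 : r ≤ ‖x‖ ^ 2 + s ^ 2 := by
    refine le_of_sq_le_sq ?_ (by positivity)
    have : r ^ 2 = (‖x‖ ^ 2 - s ^ 2) ^ 2 + (2 * s * x 0) ^ 2 := by
      rw [hb.1, hb.2]
      linear_combination -r ^ 2 * Real.sin_sq_add_cos_sq θ
    nlinarith [mul_le_mul_of_nonneg_left hx0 (sq_nonneg s)]
  have h4 : ‖x‖ ^ 2 - s ^ 2 ≤ r / 2 := by
    rw [hb.1]
    nlinarith
  refine le_of_sq_le_sq ?_ (by positivity)
  rw [mul_pow, BubbleParam.sq_sqrt_three]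
  linarith

/-- The double bubble with a totally geodesic interface. -/
def symmetricBubble (X : SpaceForm) (hs : 0 < s) (h : 0 < 1 + X.curvature * (√3 * s) ^ 2 / 4) :
    StandardDoubleBubble X (m + 1) where
  s := s
  α := Real.pi
  s_pos := hs
  enclosed _ := ⟨Metric.closedBall 0 (√3 * s), isCompact_closedBall _ _,
    fun _ hx => one_add_mul_sq_pos (norm_nonneg _) (by simpa using hx) h,
    fun _ hx => by simpa using norm_le_of_mem_betweenCaps_pi hs hx⟩

/-- The volume of each region of the double bubble with a totally geodesic interface. -/
def symmetricVol (m : ℕ) (X : SpaceForm) (s : ℝ) : ℝ :=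
  sphereConst m * BubbleParam.vol₁ m X.curvature (X.paramX s Real.pi) 0

theorem SpaceForm.paramY_pi (X : SpaceForm) (s : ℝ) : X.paramY s Real.pi = 0 := by
  simp [SpaceForm.paramY]

/-- Reflection in `{x₀ = 0}` exchanges the two regions. -/
theorem BubbleParam.vol₂_neg (m : ℕ) (κ A B : ℝ) : vol₂ m κ A (-B) = vol₁ m κ A B := by
  have h := intervalIntegral.integral_comp_neg (a := 0) (b := 2 * Real.pi / 3)
    (fun φ => sine κ A (-B) ^ (m + 1) * capProfile' m (capArg κ φ A (-B)))
  rw [neg_zero] at h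
  rw [vol₂, vol₁, sectorVol, sectorVol, ← h]
  simp only [capArg_neg, sine, neg_sq]

theorem vol_region₁_symmetricBubble (hm : 1 ≤ m) (hs : 0 < s)
    (h : 0 < 1 + X.curvature * (√3 * s) ^ 2 / 4) :
    X.vol (symmetricBubble (m := m) X hs h).region₁ = ENNReal.ofReal (symmetricVol m X s) := by
  rw [StandardDoubleBubble.vol_region₁ hm, symmetricVol]
  simp only [symmetricBubble, X.paramY_pi]

theorem vol_region₂_symmetricBubble (hm : 1 ≤ m) (hs : 0 < s)
    (h : 0 < 1 + X.curvature * (√3 * s) ^ 2 / 4) :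
    X.vol (symmetricBubble (m := m) X hs h).region₂ = ENNReal.ofReal (symmetricVol m X s) := by
  rw [StandardDoubleBubble.vol_region₂ hm, symmetricVol, ← BubbleParam.vol₂_neg, neg_zero]
  simp only [symmetricBubble, X.paramY_pi]

theorem symmetric_regions_subset (hs : 0 < s) (h : 0 < 1 + X.curvature * (√3 * s) ^ 2 / 4) :
    (symmetricBubble (m := m) X hs h).region₁ ⊆ Metric.closedBall 0 (√3 * s) := fun _ hx => by
  simpa using norm_le_of_mem_betweenCaps_pi hs (Or.inl hx)

theorem admissible_symmetric (hs : 0 < s) (h : 0 < 1 + X.curvature * (√3 * s) ^ 2 / 4) :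
    BubbleParam.Admissible X.curvature (X.paramX s Real.pi) 0 := by
  have := (symmetricBubble (m := 0) X hs h).admissible
  simpa only [symmetricBubble, X.paramY_pi] using this

theorem le_sqrt_three_mul (hs : 0 ≤ s) : s ≤ √3 * s :=
  le_mul_of_one_le_left hs (Real.one_le_sqrt.2 (by norm_num))

theorem continuousAt_symmetricVol (hm : 1 ≤ m) (hs : 0 < s)
    (h : 0 < 1 + X.curvature * (√3 * s) ^ 2 / 4) : ContinuousAt (symmetricVol m X) s := by
  have hpi := Real.pi_pos
  have hk := one_add_mul_sq_pos hs.le (le_sqrt_three_mul hs.le) h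
  have hX : ContinuousAt (fun u => X.paramX u Real.pi) s := by
    have hc : ContinuousAt (fun u : ℝ => 1 + X.curvature * u ^ 2 / 4) s := by fun_prop
    refine ContinuousAt.mul (ContinuousAt.div (ContinuousAt.div (by fun_prop) hc hk.ne')
      (continuousAt_id.div hc hk.ne') (X.sine_pos hs hk).ne') continuousAt_const
  -- Symmetric bubbles have parameters on the line `Y = 0`, so continuity follows from
  -- differentiability in the direction `(1, 0)`.
  have hd := BubbleParam.hasDerivAt_sectorVol_of_admissible hm (κ := X.curvature)
    (X := X.paramX s Real.pi) (Y := 0) (dx := 1) (dy := 0) (τ := 0) (a := 0)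
    (b := 2 * Real.pi / 3) (by simpa using admissible_symmetric hs h)
    ⟨by linarith, by linarith⟩ ⟨by linarith, le_rfl⟩
  have h0 : X.paramX s Real.pi - X.paramX s Real.pi = 0 := sub_self _
  have hc := ContinuousAt.comp_of_eq hd.continuousAt
    (hX.sub (continuousAt_const (y := X.paramX s Real.pi))) h0
  have heq : symmetricVol m X = fun u => sphereConst m * ((fun τ => BubbleParam.sectorVol m
      X.curvature 0 (2 * Real.pi / 3) (X.paramX s Real.pi + τ * 1) (0 + τ * 0)) ∘
        fun u => X.paramX u Real.pi - X.paramX s Real.pi) u := by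
    funext u
    simp [symmetricVol, BubbleParam.vol₁]
  rw [heq]
  exact continuousAt_const.mul hc

/-- Inside this ball `bipolar s x` has negative real part, so its angle is within `π/2` of `π`;
points with angle exactly `π` lie in the hyperplane of the interface. -/
theorem ball_subset_symmetric (hs : 0 < s) (h : 0 < 1 + X.curvature * (√3 * s) ^ 2 / 4) :
    Metric.ball 0 s ⊆ ((symmetricBubble (m := m) X hs h).region₁ ∪
      (symmetricBubble (m := m) X hs h).region₂) ∪ {x | x 0 = 0} := by
  have hpi := Real.pi_pos
  intro x hx
  by_cases hx0 : x 0 = 0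
  · exact Or.inr hx0
  left
  rw [mem_ball_zero_iff] at hx
  set b := bipolar s x with hb
  have hre : 0 < (-b).re := by
    have : ‖x‖ ^ 2 < s ^ 2 := pow_lt_pow_left₀ hx (norm_nonneg _) two_ne_zero
    change 0 < -(‖x‖ ^ 2 - s ^ 2)
    linarith
  have him : (-b).im ≠ 0 := by
    change -(2 * s * x 0) ≠ 0
    simp [hs.ne', hx0]
  have harg := abs_lt.1 (Complex.abs_arg_lt_pi_div_two_iff.2 (Or.inl hre))
  have hargne : Complex.arg (-b) ≠ 0 := fun h0 => him (Complex.arg_eq_zero_iff.1 h0).2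
  have hn : 0 < ‖-b‖ := norm_pos_iff.2 fun h0 => hre.ne' (by rw [h0]; rfl)
  have heq : b = (‖-b‖ : ℝ) * Complex.exp ((Real.pi + Complex.arg (-b) : ℝ) * Complex.I) := by
    push_cast
    rw [add_mul, Complex.exp_add, Complex.exp_pi_mul_I, mul_left_comm,
      Complex.norm_mul_exp_arg_mul_I, neg_one_mul, neg_neg]
  rcases lt_or_gt_of_ne hargne with h1 | h1
  · exact Or.inr ⟨_, _, hn, by simp only [symmetricBubble]; linarith [harg.1],
      by simp only [symmetricBubble]; linarith, heq⟩
  · exact Or.inl ⟨_, _, hn, by simp only [symmetricBubble]; linarith,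
      by simp only [symmetricBubble]; linarith [harg.2], heq⟩

theorem ballVol_le_symmetricVol (hm : 1 ≤ m) (hs : 0 < s)
    (h : 0 < 1 + X.curvature * (√3 * s) ^ 2 / 4) :
    ENNReal.ofReal (ballVol (m + 1) X.curvature s) ≤ 2 * ENNReal.ofReal (symmetricVol m X s) := by
  have hk := one_add_mul_sq_pos hs.le (le_sqrt_three_mul hs.le) h
  rw [← vol_ball (X := X) (by omega) hs.le hk]
  refine (SpaceForm.vol_mono (ball_subset_symmetric hs h)).trans ?_
  refine (SpaceForm.vol_union_le _ _).trans ?_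
  rw [SpaceForm.vol_eq_zero volume_apply_zero_eq_zero, add_zero, two_mul]
  refine (SpaceForm.vol_union_le _ _).trans ?_
  rw [vol_region₁_symmetricBubble hm, vol_region₂_symmetricBubble hm]

theorem symmetricVol_le_ballVol (hm : 1 ≤ m) (hs : 0 < s) {t : ℝ} (hst : √3 * s < t)
    (ht : 0 < 1 + X.curvature * t ^ 2 / 4) :
    ENNReal.ofReal (symmetricVol m X s) ≤ ENNReal.ofReal (ballVol (m + 1) X.curvature t) := by
  have hs3 : 0 ≤ √3 * s := by positivity
  have h := one_add_mul_sq_pos hs3 hst.le ht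
  rw [← vol_ball (X := X) (by omega) (hs3.trans hst.le) ht, ← vol_region₁_symmetricBubble hm hs h]
  exact SpaceForm.vol_mono ((symmetric_regions_subset hs h).trans
    (Metric.closedBall_subset_ball hst))

/-- The term `-log ε` makes the hyperbolic volumes below unbounded. -/
theorem integral_inv_linear {ε : ℝ} (hε : 0 < ε) :
    IntervalIntegrable (fun φ : ℝ => (2 * (ε + 2 * (2 * Real.pi / 3 - φ)))⁻¹) volume (Real.pi / 2)
      (2 * Real.pi / 3) ∧
    ∫ φ in (Real.pi / 2)..(2 * Real.pi / 3), (2 * (ε + 2 * (2 * Real.pi / 3 - φ)))⁻¹ =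
      1 / 4 * Real.log (ε + Real.pi / 3) - 1 / 4 * Real.log ε := by
  have hpi := Real.pi_pos
  have hpos : ∀ φ ∈ uIcc (Real.pi / 2) (2 * Real.pi / 3),
      0 < ε + 2 * (2 * Real.pi / 3 - φ) := fun φ hφ => by
    rw [uIcc_of_le (by linarith)] at hφ
    linarith [hφ.2]
  have hi : IntervalIntegrable (fun φ : ℝ => (2 * (ε + 2 * (2 * Real.pi / 3 - φ)))⁻¹) volume
      (Real.pi / 2) (2 * Real.pi / 3) :=
    ContinuousOn.intervalIntegrable
      (ContinuousOn.inv₀ (by fun_prop) fun φ hφ => by linarith [hpos φ hφ])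
  refine ⟨hi, ?_⟩
  rw [intervalIntegral.integral_eq_sub_of_hasDerivAt
    (f := fun φ => -(1 / 4) * Real.log (ε + 2 * (2 * Real.pi / 3 - φ))) ?_ hi]
  · rw [show ε + 2 * (2 * Real.pi / 3 - 2 * Real.pi / 3) = ε by ring,
      show ε + 2 * (2 * Real.pi / 3 - Real.pi / 2) = ε + Real.pi / 3 by ring]
    ring
  · intro φ hφ
    have h1 : HasDerivAt (fun φ : ℝ => ε + 2 * (2 * Real.pi / 3 - φ)) (2 * (-1)) φ :=
      (((hasDerivAt_id φ).const_sub _).const_mul 2).const_add ε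
    refine ((h1.log (hpos φ hφ).ne').const_mul (-(1 / 4))).congr_deriv ?_
    have := (hpos φ hφ).ne'
    generalize ε + 2 * (2 * Real.pi / 3 - φ) = D at *
    field_simp
    norm_num

/-- For `0 ≤ x < 1` the ODE gives `(1 - x²) a' ≥ 1`. Moreover `1 - x² ≤ 2 (1 - x)`, and `1 - x ≤ ε +
2 (2π/3 - φ)` because the cosine is 1-Lipschitz. -/
theorem inv_linear_le_capProfile' (hm : 1 ≤ m) {ε φ : ℝ} (hε : 0 < ε) (hε1 : ε ≤ 1)
    (hφ : φ ∈ Icc (Real.pi / 2) (2 * Real.pi / 3))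
    (hx1 : -(2 * (1 - ε) * Real.cos φ) < 1) :
    (2 * (ε + 2 * (2 * Real.pi / 3 - φ)))⁻¹ ≤ capProfile' m (-(2 * (1 - ε) * Real.cos φ)) := by
  have hpi := Real.pi_pos
  have hφ0 : 0 ≤ 2 * Real.pi / 3 - φ := by linarith [hφ.2]
  have hcos0 : Real.cos φ ≤ 0 :=
    Real.cos_nonpos_of_pi_div_two_le_of_le hφ.1 (by linarith [hφ.2])
  have hcos1 : -(1 / 2) ≤ Real.cos φ := by
    rw [← Real.cos_two_pi_div_three]
    exact Real.cos_le_cos_of_nonneg_of_le_pi (by linarith [hφ.1]) (by linarith) hφ.2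
  have hcos2 : Real.cos φ ≤ -(1 / 2) + (2 * Real.pi / 3 - φ) := by
    have := (le_abs_self _).trans (Real.abs_cos_sub_cos_le φ (2 * Real.pi / 3))
    rw [Real.cos_two_pi_div_three, abs_sub_comm φ, abs_of_nonneg hφ0] at this
    linarith
  have h3 : 1 - -(2 * (1 - ε) * Real.cos φ) ≤ ε + 2 * (2 * Real.pi / 3 - φ) := by
    nlinarith [mul_nonneg hε.le (show 0 ≤ Real.cos φ + 1 / 2 by linarith)]
  have hx0 : 0 ≤ -(2 * (1 - ε) * Real.cos φ) := by
    nlinarith [mul_nonneg (sub_nonneg.2 hε1) (neg_nonneg.2 hcos0)]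
  generalize -(2 * (1 - ε) * Real.cos φ) = x at *
  have ha' := capProfile'_nonneg m hx1
  have h1 : 1 ≤ (1 - x ^ 2) * capProfile' m x := by
    rw [capProfile_ode hm hx1]
    have := mul_nonneg (mul_nonneg m.cast_nonneg hx0) (capProfile_nonneg m hx1)
    linarith
  have h2 : 1 - x ^ 2 ≤ 2 * (ε + 2 * (2 * Real.pi / 3 - φ)) := by nlinarith
  rw [inv_le_iff_one_le_mul₀ (by linarith)]
  have := mul_le_mul_of_nonneg_right h2 ha'
  linarith

/-- Double bubbles with a totally geodesic interface in hyperbolic space have arbitrarily large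
volume. -/
theorem exists_le_symmetricVol_hyperbolic (hm : 1 ≤ m) (M : ℝ) :
    ∃ s : ℝ, 0 < s ∧ 0 < 1 + SpaceForm.hyperbolic.curvature * (√3 * s) ^ 2 / 4 ∧
      M ≤ symmetricVol m .hyperbolic s := by
  have hpi := Real.pi_gt_three
  have hσ := sphereConst_pos hm
  have hm0 : (0 : ℝ) < m := by exact_mod_cast hm
  -- As `ε` tends to `0` the outer caps approach horospheres and the volume diverges like `-log ε`.
  -- The bound `1/6` ensures `k ≥ 1/4` below.
  obtain ⟨ε, hε0, hε6, hεlog⟩ : ∃ ε : ℝ, 0 < ε ∧ ε ≤ 1 / 6 ∧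
      4 * m * M / sphereConst m ≤ -Real.log ε := by
    refine ⟨min (1 / 6) (Real.exp (-(4 * m * M / sphereConst m))),
      lt_min (by norm_num) (Real.exp_pos _), min_le_left _ _, ?_⟩
    have := Real.log_le_log (lt_min (by norm_num) (Real.exp_pos _))
      (min_le_right (1 / 6) (Real.exp (-(4 * m * M / sphereConst m))))
    rw [Real.log_exp] at this
    linarith
  -- Here `k = s² / 4`, chosen so that the geodesic cosine `(1 + k) / (1 - k)` is `2 (1 - ε)`. The
  -- value `2` would give argument `1` at the outer caps. From `k ≥ 1/4` follow `s ≥ 1` and a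
  -- geodesic sine of at least `1`.
  obtain ⟨k, hkd, hk4, hk3⟩ : ∃ k : ℝ, k * (3 - 2 * ε) = 1 - 2 * ε ∧ 1 / 4 ≤ k ∧ 3 * k < 1 := by
    have hd : 0 < 3 - 2 * ε := by linarith
    refine ⟨(1 - 2 * ε) / (3 - 2 * ε), div_mul_cancel₀ _ hd.ne', ?_, ?_⟩
    · rw [div_le_div_iff₀ (by norm_num) hd]
      linarith
    · rw [mul_div_assoc', div_lt_one hd]
      linarith
  obtain ⟨s, hs1, hs2⟩ : ∃ s : ℝ, 1 ≤ s ∧ s ^ 2 = 4 * k :=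
    ⟨√(4 * k), Real.one_le_sqrt.2 (by linarith), Real.sq_sqrt (by linarith)⟩
  have hs0 : 0 < s := by linarith
  have hval : 0 < 1 + SpaceForm.hyperbolic.curvature * (√3 * s) ^ 2 / 4 := by
    rw [mul_pow, BubbleParam.sq_sqrt_three, hs2]
    simp only [SpaceForm.curvature]
    linarith
  refine ⟨s, hs0, hval, ?_⟩
  have hkv := one_add_mul_sq_pos hs0.le (le_sqrt_three_mul hs0.le) hval
  have hcos : SpaceForm.hyperbolic.cosine s = 2 * (1 - ε) := by
    rw [SpaceForm.cosine, div_eq_iff hkv.ne', hs2]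
    simp only [SpaceForm.curvature]
    linear_combination hkd
  have hsin : 1 ≤ SpaceForm.hyperbolic.sine s := by
    rw [SpaceForm.sine, le_div_iff₀ hkv, hs2]
    simp only [SpaceForm.curvature]
    linarith
  have hadm := admissible_symmetric hs0 hval
  rw [symmetricVol, BubbleParam.vol₁, BubbleParam.sectorVol]
  have hS : BubbleParam.sine SpaceForm.hyperbolic.curvature
      (SpaceForm.hyperbolic.paramX s Real.pi) 0 = SpaceForm.hyperbolic.sine s := by
    rw [← SpaceForm.sine_param hs0 hkv Real.pi, SpaceForm.paramY_pi]
  have harg : ∀ φ, BubbleParam.capArg SpaceForm.hyperbolic.curvature φ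
      (SpaceForm.hyperbolic.paramX s Real.pi) 0 = -(2 * (1 - ε) * Real.cos φ) := fun φ => by
    rw [← SpaceForm.paramY_pi .hyperbolic s, SpaceForm.capArg_param hs0 hkv, hcos, add_comm,
      Real.cos_add_pi]
    ring
  have hlt : ∀ φ ∈ Icc 0 (2 * Real.pi / 3), -(2 * (1 - ε) * Real.cos φ) < 1 := fun φ hφ => by
    rw [← harg]
    exact hadm.capArg_lt_one (by linarith [hφ.1]) hφ.2
  simp only [harg, hS]
  generalize SpaceForm.hyperbolic.sine s = S at hsin
  set f : ℝ → ℝ := fun φ => S ^ (m + 1) * capProfile' m (-(2 * (1 - ε) * Real.cos φ)) with hf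
  have hfc : ContinuousOn f (Icc 0 (2 * Real.pi / 3)) :=
    continuousOn_const.mul ((BubbleParam.continuousOn_capProfile' m).comp (by fun_prop) hlt)
  have hi1 : IntervalIntegrable f volume 0 (Real.pi / 2) := by
    refine (hfc.mono ?_).intervalIntegrable
    rw [uIcc_of_le (by linarith)]
    exact Icc_subset_Icc_right (by linarith)
  have hi2 : IntervalIntegrable f volume (Real.pi / 2) (2 * Real.pi / 3) := by
    refine (hfc.mono ?_).intervalIntegrable
    rw [uIcc_of_le (by linarith)]
    exact Icc_subset_Icc_left (by linarith)
  have hle : -(1 / 4) * Real.log ε ≤ ∫ φ in (0 : ℝ)..(2 * Real.pi / 3), f φ := by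
    rw [← intervalIntegral.integral_add_adjacent_intervals hi1 hi2]
    have e1 : 0 ≤ ∫ φ in (0 : ℝ)..(Real.pi / 2), f φ :=
      intervalIntegral.integral_nonneg (by linarith) fun φ hφ =>
        mul_nonneg (by positivity) (capProfile'_nonneg m (hlt φ ⟨hφ.1, by linarith [hφ.2]⟩))
    obtain ⟨hgi, hge⟩ := integral_inv_linear hε0
    have e2 := intervalIntegral.integral_mono_on (by linarith) hgi hi2 fun φ hφ => by
      have hφ1 := hlt φ ⟨by linarith [hφ.1], hφ.2⟩
      exact (inv_linear_le_capProfile' hm hε0 (by linarith) hφ hφ1).trans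
        (le_mul_of_one_le_left (capProfile'_nonneg m hφ1) (one_le_pow₀ hsin))
    rw [hge] at e2
    have e3 : 0 ≤ Real.log (ε + Real.pi / 3) := Real.log_nonneg (by linarith)
    linarith
  rw [div_le_iff₀ hσ] at hεlog
  rw [mul_div_assoc', le_div_iff₀ hm0]
  nlinarith [mul_le_mul_of_nonneg_left hle hσ.le]

/-- Balls exhaust the Euclidean and spherical models. In hyperbolic space a large symmetric bubble
is enclosed in a ball, since its closure stays inside the model. -/
theorem exists_lt_ballVol (hm : 1 ≤ m) {v : ℝ} (hv : 0 < v) (hvol : X = SpaceForm.spherical →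
      ENNReal.ofReal v < X.vol (univ : Set (EuclideanSpace ℝ (Fin (m + 1))))) :
    ∃ t : ℝ, 0 < t ∧ 0 < 1 + X.curvature * t ^ 2 / 4 ∧ v ≤ ballVol (m + 1) X.curvature t := by
  have key : X ≠ SpaceForm.hyperbolic →
      ENNReal.ofReal v < X.vol (univ : Set (EuclideanSpace ℝ (Fin (m + 1)))) →
      ∃ t : ℝ, 0 < t ∧ 0 < 1 + X.curvature * t ^ 2 / 4 ∧ v ≤ ballVol (m + 1) X.curvature t := by
    intro hX h
    have hκ := SpaceForm.curvature_nonneg hX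
    obtain ⟨t, ht, hlt⟩ := SpaceForm.exists_lt_vol_ball h
    have htk : 0 < 1 + X.curvature * t ^ 2 / 4 := by positivity
    rw [vol_ball (by omega) ht.le htk] at hlt
    exact ⟨t, ht, htk, ((ENNReal.ofReal_lt_ofReal_iff_of_nonneg hv.le).1 hlt).le⟩
  cases X
  · refine key (by simp) ?_
    rw [SpaceForm.vol_univ_euclidean (by omega)]
    exact ENNReal.ofReal_lt_top
  · obtain ⟨s, hs, hk, hle⟩ := exists_le_symmetricVol_hyperbolic hm v
    have hs2 : √3 * s < 2 := by
      refine lt_of_pow_lt_pow_left₀ 2 (by norm_num) ?_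
      simp only [SpaceForm.curvature] at hk
      linarith
    obtain ⟨t, h1, h2⟩ := exists_between hs2
    have ht0 : 0 < t := lt_of_le_of_lt (by positivity) h1
    have htk : 0 < 1 + SpaceForm.hyperbolic.curvature * t ^ 2 / 4 := by
      simp only [SpaceForm.curvature]
      nlinarith
    refine ⟨t, ht0, htk, ?_⟩
    have h3 := (ENNReal.ofReal_le_ofReal hle).trans (symmetricVol_le_ballVol hm hs h1 htk)
    rcases ENNReal.ofReal_le_ofReal_iff'.1 h3 with h | h
    · exact h
    · linarith
  · exact key (by simp) (hvol rfl)

/-- Balls of every volume less than the total volume exist. -/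
theorem exists_ballVol_eq (hm : 1 ≤ m) {v : ℝ} (hv : 0 < v) (hvol : X = SpaceForm.spherical →
      ENNReal.ofReal v < X.vol (univ : Set (EuclideanSpace ℝ (Fin (m + 1))))) :
    ∃ t : ℝ, 0 < t ∧ 0 < 1 + X.curvature * t ^ 2 / 4 ∧ ballVol (m + 1) X.curvature t = v := by
  obtain ⟨T, hT, hTk, hle⟩ := exists_lt_ballVol hm hv hvol
  obtain ⟨t, ht, hte⟩ := intermediate_value_Icc hT.le (continuousOn_ballVol hT.le hTk)
    (show v ∈ Icc _ _ from ⟨by rw [ballVol_zero]; exact hv.le, hle⟩)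
  refine ⟨t, ht.1.lt_of_ne ?_, one_add_mul_sq_pos ht.1 ht.2 hTk, hte⟩
  rintro rfl
  rw [ballVol_zero] at hte
  exact hv.ne hte

/-- For `κ ≥ 0` every `s` is allowed, and the symmetric bubble contains the ball of radius `s` up to
a null set. A ball of volume at least `2 M` therefore suffices; on the sphere it exists because `2
M` is less than the total volume. -/
theorem exists_le_symmetricVol (hm : 1 ≤ m) (hM : 0 < M) (hvol : X = SpaceForm.spherical →
      ENNReal.ofReal (M + M) < X.vol (univ : Set (EuclideanSpace ℝ (Fin (m + 1))))) :
    ∃ s : ℝ, 0 < s ∧ 0 < 1 + X.curvature * (√3 * s) ^ 2 / 4 ∧ M ≤ symmetricVol m X s := by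
  by_cases hX : X = SpaceForm.hyperbolic
  · subst hX
    exact exists_le_symmetricVol_hyperbolic hm M
  have hκ := SpaceForm.curvature_nonneg hX
  obtain ⟨t, ht, -, hle⟩ := exists_lt_ballVol hm (add_pos hM hM) hvol
  have htk : 0 < 1 + X.curvature * (√3 * t) ^ 2 / 4 := by positivity
  refine ⟨t, ht, htk, ?_⟩
  have h := (ENNReal.ofReal_le_ofReal hle).trans (ballVol_le_symmetricVol hm ht htk)
  rw [← ENNReal.ofReal_ofNat, ← ENNReal.ofReal_mul zero_le_two] at h
  rcases ENNReal.ofReal_le_ofReal_iff'.1 h with h | h <;> linarith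

/-- Double bubbles with a totally geodesic interface that enclose two equal volumes of total less
than the volume of the space form exist. -/
theorem exists_symmetricVol_eq (hm : 1 ≤ m) (hM : 0 < M) (hvol : X = SpaceForm.spherical →
      ENNReal.ofReal (M + M) < X.vol (univ : Set (EuclideanSpace ℝ (Fin (m + 1))))) :
    ∃ s : ℝ, 0 < s ∧ 0 < 1 + X.curvature * (√3 * s) ^ 2 / 4 ∧ symmetricVol m X s = M := by
  obtain ⟨s₁, hs₁, hk₁, hle₁⟩ := exists_le_symmetricVol hm hM hvol
  obtain ⟨t, ht, htk, hte⟩ := exists_ballVol_eq hm hM fun h =>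
    (ENNReal.ofReal_le_ofReal (by linarith)).trans_lt (hvol h)
  have h3 : √3 < 2 := by
    rw [Real.sqrt_lt' two_pos]
    norm_num
  -- The lower end for the intermediate value theorem: since `√3 < 2`, the bubble with `s = t / 2`
  -- lies in the ball of volume `M`.
  have hst : √3 * (t / 2) < t := by nlinarith
  have hk₂ := one_add_mul_sq_pos (by positivity) hst.le htk
  have hle₂ : symmetricVol m X (t / 2) ≤ M := by
    have := symmetricVol_le_ballVol hm (half_pos ht) hst htk
    rw [hte] at this
    rcases ENNReal.ofReal_le_ofReal_iff'.1 this with h | h <;> linarith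
  have hval : ∀ s ∈ uIcc (t / 2) s₁, 0 < s ∧ 0 < 1 + X.curvature * (√3 * s) ^ 2 / 4 := by
    intro s hs
    have h0 : 0 < s := (lt_min (half_pos ht) hs₁).trans_le hs.1
    refine ⟨h0, ?_⟩
    rcases le_max_iff.1 hs.2 with h | h
    · exact one_add_mul_sq_pos (by positivity) (by gcongr) hk₂
    · exact one_add_mul_sq_pos (by positivity) (by gcongr) hk₁
  obtain ⟨s, hs, hse⟩ := intermediate_value_uIcc (f := symmetricVol m X) (fun s hs =>
    (continuousAt_symmetricVol hm (hval s hs).1 (hval s hs).2).continuousWithinAt)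
    (mem_uIcc.2 (Or.inl ⟨hle₂, hle₁⟩))
  exact ⟨s, (hval s hs).1, (hval s hs).2, hse⟩

end Symmetric

end

/-! ### Comparison of areas -/

noncomputable section

section Compare

variable {m : ℕ} {X : SpaceForm} {M : ℝ}

theorem StandardDoubleBubble.volumes_eq (hm : 1 ≤ m) (B : StandardDoubleBubble X (m + 1)) {v w : ℝ}
    (hv : 0 < v) (hw : 0 < w) (h₁ : X.vol B.region₁ = ENNReal.ofReal v)
    (h₂ : X.vol B.region₂ = ENNReal.ofReal w) :
    sphereConst m * BubbleParam.vol₁ m X.curvature (X.paramX B.s B.α) (X.paramY B.s B.α) = v ∧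
    sphereConst m * BubbleParam.vol₂ m X.curvature (X.paramX B.s B.α) (X.paramY B.s B.α) = w := by
  rw [B.vol_region₁ hm] at h₁
  rw [B.vol_region₂ hm] at h₂
  exact ⟨eq_of_ofReal_eq_ofReal hv h₁, eq_of_ofReal_eq_ofReal hw h₂⟩

/-- A double bubble with a totally geodesic interface has at least the area of any other double
bubble with the same total volume. -/
theorem StandardDoubleBubble.area_le_area_of_volumes_add_eq (hm : 1 ≤ m)
    (B B' : StandardDoubleBubble X (m + 1)) {v w : ℝ} (hv : 0 < v) (hw : 0 < w) (hM : 0 < M)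
    (hvw : v + w = M + M) (hα : X.paramY B.s B.α = 0)
    (h₁ : X.vol B.region₁ = ENNReal.ofReal M) (h₂ : X.vol B.region₂ = ENNReal.ofReal M)
    (h₁' : X.vol B'.region₁ = ENNReal.ofReal v) (h₂' : X.vol B'.region₂ = ENNReal.ofReal w) :
    X.area B'.surface ≤ X.area B.surface := by
  have hσ := sphereConst_pos hm
  obtain ⟨e1, e2⟩ := B.volumes_eq hm hM hM h₁ h₂
  obtain ⟨e1', e2'⟩ := B'.volumes_eq hm hv hw h₁' h₂'
  have h := mul_le_mul_of_nonneg_left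
    (BubbleParam.totalArea_sub_le hm B.admissible B'.admissible) hσ.le
  -- At a totally geodesic interface the two pressures agree, so the tangent inequality involves
  -- only the total volume.
  have hp : BubbleParam.press₂ (X.paramX B.s B.α) (X.paramY B.s B.α) =
      BubbleParam.press₁ (X.paramX B.s B.α) (X.paramY B.s B.α) := by
    rw [hα, BubbleParam.press₁, BubbleParam.press₂, zero_div, sub_zero, add_zero]
  rw [hp] at h
  rw [B.area_eq hm, B'.area_eq hm]
  generalize BubbleParam.press₁ (X.paramX B.s B.α) (X.paramY B.s B.α) = p at h
  linear_combination h + m * p * (e1' + e2' - e1 - e2 + hvw)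

/-- Double bubbles that enclose the same volumes as one with a totally geodesic interface have the
same area. -/
theorem StandardDoubleBubble.area_le_area_of_volumes_eq (hm : 1 ≤ m)
    (B B' : StandardDoubleBubble X (m + 1)) (hM : 0 < M)
    (h₁ : X.vol B.region₁ = ENNReal.ofReal M) (h₂ : X.vol B.region₂ = ENNReal.ofReal M)
    (h₁' : X.vol B'.region₁ = ENNReal.ofReal M) (h₂' : X.vol B'.region₂ = ENNReal.ofReal M) :
    X.area B'.surface ≤ X.area B.surface := by
  have hσ := sphereConst_pos hm
  obtain ⟨e1, e2⟩ := B.volumes_eq hm hM hM h₁ h₂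
  obtain ⟨e1', e2'⟩ := B'.volumes_eq hm hM hM h₁' h₂'
  have h := BubbleParam.totalArea_sub_le hm B.admissible B'.admissible
  -- With equal volumes the pressure terms on both sides coincide.
  rw [mul_left_cancel₀ hσ.ne' (e1'.trans e1.symm), mul_left_cancel₀ hσ.ne' (e2'.trans e2.symm)] at h
  rw [B.area_eq hm, B'.area_eq hm]
  exact mul_le_mul_of_nonneg_left (by linarith) hσ.le

theorem SpaceForm.area_nonneg {n : ℕ} (S : Set (EuclideanSpace ℝ (Fin n))) : 0 ≤ X.area S :=
  ENNReal.toReal_nonneg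

/-- Among double bubbles of a given total volume, those with equal volumes have the largest
area. -/
theorem doubleBubbleArea_le (hm : 1 ≤ m) {v w : ℝ} (hv : 0 < v) (hw : 0 < w)
    (hM : 0 < M) (hvw : v + w = M + M) (hvol : X = SpaceForm.spherical →
      ENNReal.ofReal (M + M) < X.vol (univ : Set (EuclideanSpace ℝ (Fin (m + 1))))) :
    X.doubleBubbleArea (m + 1) v w ≤ X.doubleBubbleArea (m + 1) M M := by
  obtain ⟨s, hs, hk, hsM⟩ := exists_symmetricVol_eq hm hM hvol
  set B₀ : StandardDoubleBubble X (m + 1) := symmetricBubble X hs hk with hB₀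
  have h₁ : X.vol B₀.region₁ = ENNReal.ofReal M := by
    rw [hB₀, vol_region₁_symmetricBubble hm, hsM]
  have h₂ : X.vol B₀.region₂ = ENNReal.ofReal M := by
    rw [hB₀, vol_region₂_symmetricBubble hm, hsM]
  -- Uniqueness of double bubbles is not used: an arbitrary bubble `B` enclosing `M` and `M` is
  -- bounded below by the area of the symmetric one.
  refine le_csInf ⟨_, B₀, h₁, h₂, rfl⟩ ?_
  rintro _ ⟨B, hB₁, hB₂, rfl⟩
  by_cases h : ∃ B' : StandardDoubleBubble X (m + 1),
      X.vol B'.region₁ = ENNReal.ofReal v ∧ X.vol B'.region₂ = ENNReal.ofReal w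
  · obtain ⟨B', hB₁', hB₂'⟩ := h
    rw [SpaceForm.doubleBubbleArea]
    refine le_trans (b := X.area B'.surface) (csInf_le ?_ ⟨B', hB₁', hB₂', rfl⟩) ?_
    · refine ⟨0, ?_⟩
      rintro _ ⟨-, -, -, rfl⟩
      exact SpaceForm.area_nonneg _
    · exact (B₀.area_le_area_of_volumes_add_eq hm B' hv hw hM hvw (X.paramY_pi s) h₁ h₂ hB₁'
        hB₂').trans (B.area_le_area_of_volumes_eq hm B₀ hM hB₁ hB₂ h₁ h₂)
  -- Existence for `v`, `w` is not needed either: without such a bubble the infimum is `sInf ∅ = 0`.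
  · refine ((congrArg sInf (eq_empty_of_forall_notMem ?_)).trans Real.sInf_empty).trans_le
      (SpaceForm.area_nonneg _)
    rintro a ⟨B', hB₁', hB₂', -⟩
    exact h ⟨B', hB₁', hB₂'⟩

/-- Balls: replacing the volumes `v / 2, v / 2, w` by `M / 2, M / 2, M`, where `M` is the mean of `v`
and `w`, does not increase the area. -/
theorem ballArea_mean_le (hm : 1 ≤ m) {v w : ℝ} (hwv : w < v) (hv : v ≤ 2 * w)
    (hM : v + w = M + M) (hvol : X = SpaceForm.spherical →
      ENNReal.ofReal (M + M) < X.vol (univ : Set (EuclideanSpace ℝ (Fin (m + 1))))) :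
    2 * X.ballArea (m + 1) (M / 2) + X.ballArea (m + 1) M ≤
      2 * X.ballArea (m + 1) (v / 2) + X.ballArea (m + 1) w := by
  have hvol' : ∀ u ≤ M + M, X = SpaceForm.spherical →
      ENNReal.ofReal u < X.vol (univ : Set (EuclideanSpace ℝ (Fin (m + 1)))) := fun u hu hX =>
    (ENNReal.ofReal_le_ofReal hu).trans_lt (hvol hX)
  have hn : 1 ≤ m + 1 := by omega
  obtain ⟨r₁, p₁, k₁, e₁⟩ := exists_ballVol_eq hm (by linarith) (hvol' (M / 2) (by linarith))
  obtain ⟨r₂, p₂, k₂, e₂⟩ := exists_ballVol_eq hm (by linarith) (hvol' (v / 2) (by linarith))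
  obtain ⟨r₃, p₃, k₃, e₃⟩ := exists_ballVol_eq hm (by linarith) (hvol' w (by linarith))
  obtain ⟨r₄, p₄, k₄, e₄⟩ := exists_ballVol_eq hm (by linarith) (hvol' M (by linarith))
  rw [← e₁, ← e₂, ← e₃, ← e₄, ballArea_ballVol hn p₁ k₁, ballArea_ballVol hn p₂ k₂,
    ballArea_ballVol hn p₃ k₃, ballArea_ballVol hn p₄ k₄]
  -- The radii inherit the order `M/2 < v/2 ≤ w < M` of the volumes; the middle inequality is `v ≤ 2
  -- * w`.
  have h12 := (ballVol_lt_iff hn p₁.le p₂.le k₁ k₂).1 (by linarith)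
  have h34 := (ballVol_lt_iff hn p₃.le p₄.le k₃ k₄).1 (by linarith)
  have h23 : r₂ ≤ r₃ := le_of_not_gt fun h => by
    have := (ballVol_lt_iff hn p₃.le p₂.le k₃ k₂).2 h
    linarith
  have := slope_le (n := m + 1) (by omega)
    (c := (μHE[m + 1 - 1] (Metric.sphere (0 : EuclideanSpace ℝ (Fin (m + 1))) 1)).toReal)
    ENNReal.toReal_nonneg p₁ h12 h23 h34 k₄ (δ := M - w) (by linarith) (by linarith) (by linarith)
  linarith

end Compare

end

theorem proposition2p11 (X : SpaceForm) (n : ℕ) [NeZero n] (hn : 3 ≤ n) (v w : ℝ)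
    (hwv : w < v) (hv : v ≤ 2 * w)
    (hvol : X = SpaceForm.spherical →
      ENNReal.ofReal (v + w) < X.vol (Set.univ : Set (EuclideanSpace ℝ (Fin n))))
    (hF : 0 < X.hutchings n ((v + w) / 2) ((v + w) / 2)) :
    0 < X.hutchings n v w := by
  obtain ⟨m, rfl⟩ : ∃ m, n = m + 1 := ⟨n - 1, by omega⟩
  have hm : 1 ≤ m := by omega
  have hM : v + w = (v + w) / 2 + (v + w) / 2 := (add_halves _).symm
  rw [hM] at hvol
  have h₁ := ballArea_mean_le hm hwv hv hM hvol
  -- Positivity of `w`, and with it of `v` and the mean, follows from `w < v ≤ 2 * w`.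
  have h₂ := doubleBubbleArea_le hm (by linarith) (by linarith) (by linarith) hM hvol
  rw [SpaceForm.hutchings, ← hM] at hF
  rw [SpaceForm.hutchings]
  linarith
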